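/- For $n\ge 0$ let $\mathbb H_n$ be the Siegel upper half space (symmetric $\tau\in\mathbb C^{n\times n}$ with $\operatorname{Im}\tau$ positive definite), and let $\Lambda_n$ be the set of symmetric half-integral $n\times n$ matrices (integral diagonal, off-diagonal entries in $\tfrac12\mathbb Z$). Two matrices $T,S\in\Lambda_n$ are equivalent if $T=U^tSU$ for some $U\in\mathrm{GL}(n,\mathbb Z)$. Write $e(z)=\exp(2\pi i z)$. For even $k$ the Siegel Eisenstein series of genus $g$ and weight $k$ is \[ E^k_g(\tau)=\sum_{\left(\begin{smallmatrix}A&B\\C&D\end{smallmatrix}\right)\in P_g\backslash \mathrm{Sp}_{2g}(\mathbb Z)}\det(C\tau+D)^{-k},\qquad \tau\in\mathbb H_g, \] where $P_g=\{C=0\}$ is the Siegel parabolic subgroup. Let $k$ be an even integer, let $g=r+s$ with $r,s\ge 0$, and assume $k>g+1$. Then the series $E^k_g$ converges absolutely on $\mathbb H_g$ and has an (absolutely convergent) Fourier–Jacobi expansion \[ E^k_g(\tau)=\sum_{T_r\in\Lambda_r,\;T_r\ge 0}\phi_{g,r}(\tau_4,\tau_2,T_r)\,e(\operatorname{tr}T_r\tau_1),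 \qquad \tau=\begin{pmatrix}\tau_1&\tau_2\\ \tau_2^t&\tau_4\end{pmatrix}\in\mathbb H_g,\ \tau_1\in\mathbb H_r,\ \tau_4\in\mathbb H_s, \] where $\phi_{g,r}(\tau_4,\tau_2,T_r)$ is the $T_r$-th Fourier coefficient of $\tau_1\mapsto E^k_g(\tau)$. These coefficients satisfy: 1. If $r\ge1$ and $T_r\in\Lambda_r$ is positive semidefinite and equivalent to $\begin{pmatrix}0&0\\0&T_{r-1}\end{pmatrix}$ for some $T_{r-1}\in\Lambda_{r-1}$, then \[ \phi_{g,r}(\tau_4,0,T_r)=\phi_{g-1,r-1}(\tau_4,0,T_{r-1})\qquad\text{for all }\tau_4\in\mathbb H_{g-r}. \] 2. $\phi_{g,r}(\tau_4,0,0)=E^k_{g-r}(\tau_4)$ for all $\tau_4\in\mathbb H_{g-r}$. -/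

import Mathlib

open Matrix MeasureTheory

noncomputable section

namespace SiegelEisenstein

variable {ι : Type*} [Fintype ι] [DecidableEq ι]

/-- The Siegel upper half space of genus `|ι|`: symmetric complex matrices with positive definite
imaginary part. -/
def siegelUpperHalfSpace (ι : Type*) [Fintype ι] : Set (Matrix ι ι ℂ) :=
  {τ | τ.IsSymm ∧ (τ.map Complex.im).PosDef}

/-- The lower blocks `C`, `D` of `M = (A B; C D) ∈ Sp(ℤ)`, as complex matrices. -/
def blockC (M : symplecticGroup ι ℤ) : Matrix ι ι ℂ :=
  (M : Matrix (ι ⊕ ι) (ι ⊕ ι) ℤ).toBlocks₂₁.map (Int.cast : ℤ → ℂ)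

/-- See `blockC`. -/
def blockD (M : symplecticGroup ι ℤ) : Matrix ι ι ℂ :=
  (M : Matrix (ι ⊕ ι) (ι ⊕ ι) ℤ).toBlocks₂₂.map (Int.cast : ℤ → ℂ)

/-- The automorphy factor `j(M, τ) = det (C τ + D)`. -/
def autFactor (M : symplecticGroup ι ℤ) (τ : Matrix ι ι ℂ) : ℂ :=
  (blockC M * τ + blockD M).det

theorem toBlocks₂₁_mul {κ : Type*} [Fintype κ] (M N : Matrix (κ ⊕ κ) (κ ⊕ κ) ℤ) :
    (M * N).toBlocks₂₁ = M.toBlocks₂₁ * N.toBlocks₁₁ + M.toBlocks₂₂ * N.toBlocks₂₁ := by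
  ext i j
  simp [toBlocks₂₁, toBlocks₂₂, toBlocks₁₁, Matrix.mul_apply, Fintype.sum_sum_type]

theorem toBlocks₂₂_mul {κ : Type*} [Fintype κ] (M N : Matrix (κ ⊕ κ) (κ ⊕ κ) ℤ) :
    (M * N).toBlocks₂₂ = M.toBlocks₂₁ * N.toBlocks₁₂ + M.toBlocks₂₂ * N.toBlocks₂₂ := by
  ext i j
  simp [toBlocks₂₁, toBlocks₂₂, toBlocks₁₂, Matrix.mul_apply, Fintype.sum_sum_type]

theorem toBlocks₂₁_inv (M : symplecticGroup ι ℤ) :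
    ((M⁻¹ : symplecticGroup ι ℤ) : Matrix (ι ⊕ ι) (ι ⊕ ι) ℤ).toBlocks₂₁ =
      -((M : Matrix (ι ⊕ ι) (ι ⊕ ι) ℤ).toBlocks₂₁)ᵀ := by
  rw [SymplecticGroup.coe_inv]
  conv_lhs => rw [← fromBlocks_toBlocks (M : Matrix (ι ⊕ ι) (ι ⊕ ι) ℤ)]
  simp [Matrix.J, fromBlocks_transpose, fromBlocks_multiply, fromBlocks_neg]

/-- The Siegel parabolic subgroup `{C = 0}` of `Sp(ℤ)`. -/
def siegelParabolic (ι : Type*) [Fintype ι] [DecidableEq ι] : Subgroup (symplecticGroup ι ℤ) where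
  carrier := {M | (M : Matrix (ι ⊕ ι) (ι ⊕ ι) ℤ).toBlocks₂₁ = 0}
  mul_mem' {M N} hM hN := by
    change Matrix.toBlocks₂₁ _ = 0 at hM hN ⊢
    rw [Submonoid.coe_mul, toBlocks₂₁_mul, hM, hN]
    simp
  one_mem' := by
    ext i j
    simp [toBlocks₂₁]
  inv_mem' {M} hM := by
    change Matrix.toBlocks₂₁ _ = 0 at hM ⊢
    rw [toBlocks₂₁_inv, hM]
    simp

/-- The Siegel Eisenstein series
`E^k(τ) = ∑ det (C τ + D) ^ (-k)`, summed over the cosets `P \ Sp(ℤ)` of the Siegel parabolic `P`.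
For even `k` the summand does not depend on the representative of the coset, see
`autFactor_zpow_eq_of_rightRel`. -/
def eisenstein (k : ℕ) (τ : Matrix ι ι ℂ) : ℂ :=
  ∑' q : Quotient (QuotientGroup.rightRel (siegelParabolic ι)), autFactor q.out τ ^ (-(k : ℤ))

theorem autFactor_mul_of_mem {P : symplecticGroup ι ℤ} (hP : P ∈ siegelParabolic ι)
    (M : symplecticGroup ι ℤ) (τ : Matrix ι ι ℂ) :
    autFactor (P * M) τ = (blockD P).det * autFactor M τ := by
  have hC : (P : Matrix (ι ⊕ ι) (ι ⊕ ι) ℤ).toBlocks₂₁ = 0 := hP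
  have h1 : blockC (P * M) = blockD P * blockC M := by
    rw [blockC, blockC, blockD, Submonoid.coe_mul, toBlocks₂₁_mul, hC, zero_mul, zero_add]
    exact Matrix.map_mul (f := Int.castRingHom ℂ)
  have h2 : blockD (P * M) = blockD P * blockD M := by
    rw [blockD, blockD, blockD, Submonoid.coe_mul, toBlocks₂₂_mul, hC, zero_mul, zero_add]
    exact Matrix.map_mul (f := Int.castRingHom ℂ)
  rw [autFactor, autFactor, h1, h2, mul_assoc, ← mul_add, det_mul]

theorem blockD_det_of_mem {P : symplecticGroup ι ℤ} (hP : P ∈ siegelParabolic ι) :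
    (blockD P).det = 1 ∨ (blockD P).det = -1 := by
  have hC : (P : Matrix (ι ⊕ ι) (ι ⊕ ι) ℤ).toBlocks₂₁ = 0 := hP
  have h1 : ((P : Matrix (ι ⊕ ι) (ι ⊕ ι) ℤ).toBlocks₂₂) *
      ((P⁻¹ : symplecticGroup ι ℤ) : Matrix (ι ⊕ ι) (ι ⊕ ι) ℤ).toBlocks₂₂ = 1 := by
    have := toBlocks₂₂_mul (P : Matrix (ι ⊕ ι) (ι ⊕ ι) ℤ)
      ((P⁻¹ : symplecticGroup ι ℤ) : Matrix (ι ⊕ ι) (ι ⊕ ι) ℤ)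
    rw [hC, zero_mul, zero_add, ← Submonoid.coe_mul, mul_inv_cancel] at this
    rw [← this]
    ext i j
    simp [toBlocks₂₂, Matrix.one_apply]
  have h2 : IsUnit ((P : Matrix (ι ⊕ ι) (ι ⊕ ι) ℤ).toBlocks₂₂).det := by
    have := congrArg det h1
    rw [det_mul, det_one] at this
    exact IsUnit.of_mul_eq_one _ this
  have h3 : (blockD P).det =
      ((((P : Matrix (ι ⊕ ι) (ι ⊕ ι) ℤ).toBlocks₂₂).det : ℤ) : ℂ) :=
    ((Int.castRingHom ℂ).map_det _).symm
  rw [h3]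
  rcases Int.isUnit_iff.mp h2 with h | h <;> simp [h]

/-- For even `k` the summand of the Siegel Eisenstein series only depends on the coset. -/
theorem autFactor_zpow_eq_of_rightRel {k : ℕ} (hk : Even k) {M N : symplecticGroup ι ℤ}
    (h : QuotientGroup.rightRel (siegelParabolic ι) M N) (τ : Matrix ι ι ℂ) :
    autFactor M τ ^ (-(k : ℤ)) = autFactor N τ ^ (-(k : ℤ)) := by
  have hP := QuotientGroup.rightRel_apply.mp h
  have hN : autFactor N τ = (blockD (N * M⁻¹)).det * autFactor M τ := by
    rw [← autFactor_mul_of_mem hP, inv_mul_cancel_right]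
  have hk' : Even (-(k : ℤ)) := by simpa using hk
  rw [hN]
  rcases blockD_det_of_mem hP with h | h <;> simp [h, hk'.neg_zpow]

/-- `e(z) = exp(2πi z)`. -/
def e (z : ℂ) : ℂ := Complex.exp (2 * Real.pi * Complex.I * z)

/-- Symmetric half-integral matrices: integral diagonal, off-diagonal entries in `½ℤ`. -/
def IsHalfIntegral (T : Matrix ι ι ℝ) : Prop :=
  T.IsSymm ∧ (∀ i, ∃ n : ℤ, T i i = n) ∧ ∀ i j, ∃ n : ℤ, 2 * T i j = n

/-- `T` and `S` are equivalent: `T = Uᵀ S U` for some `U ∈ GL(ℤ)`. -/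
def UnimodularEquiv (T S : Matrix ι ι ℝ) : Prop :=
  ∃ U : GL ι ℤ, T = ((U : Matrix ι ι ℤ).map (Int.cast : ℤ → ℝ))ᵀ * S *
    (U : Matrix ι ι ℤ).map (Int.cast : ℤ → ℝ)

/-- The matrix `diag(0, T')` with a `1 × 1` zero block. -/
def zeroDiag {m : ℕ} (T' : Matrix (Fin m) (Fin m) ℝ) : Matrix (Fin (1 + m)) (Fin (1 + m)) ℝ :=
  Matrix.reindex finSumFinEquiv finSumFinEquiv
    (fromBlocks (0 : Matrix (Fin 1) (Fin 1) ℝ) 0 0 T')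

/-- The point `X + iY`, where `X` is the real symmetric matrix with entries `X i j = x {i, j}`. -/
def symmPoint (x : Sym2 ι → ℝ) (Y : Matrix ι ι ℝ) : Matrix ι ι ℂ :=
  Matrix.of fun i j => (x s(i, j) : ℂ) + Complex.I * (Y i j : ℂ)

/-- An admissible imaginary part of `τ₁` for given `τ₂`, `τ₄`: with `Y₁ = 1 + Y₂ Y₄⁻¹ Y₂ᵀ` the matrix
`(Y₁ Y₂; Y₂ᵀ Y₄)` is positive definite whenever `Y₄` is. -/
def baseHeight {κ : Type*} [Fintype κ] [DecidableEq κ] (τ₄ : Matrix κ κ ℂ) (τ₂ : Matrix ι κ ℂ) :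
    Matrix ι ι ℝ :=
  1 + τ₂.map Complex.im * (τ₄.map Complex.im)⁻¹ * (τ₂.map Complex.im)ᵀ

/-- The Fourier–Jacobi coefficient `φ_{r+s,r}(τ₄, τ₂, T)` of the Siegel Eisenstein series of weight
`k` and genus `r + s`: the `T`-th Fourier coefficient of
`τ₁ ↦ E^k (τ₁ τ₂; τ₂ᵀ τ₄)`, i.e. the integral of `E^k(τ) e(-tr T τ₁)` over the real parts of `τ₁`
in a unit cube of symmetric matrices (at a fixed imaginary part of `τ₁`). -/
def fourierJacobiCoeff (k r s : ℕ) (τ₄ : Matrix (Fin s) (Fin s) ℂ) (τ₂ : Matrix (Fin r) (Fin s) ℂ)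
    (T : Matrix (Fin r) (Fin r) ℝ) : ℂ :=
  ∫ x in Set.Icc (0 : Sym2 (Fin r) → ℝ) 1,
    eisenstein k (fromBlocks (symmPoint x (baseHeight τ₄ τ₂)) τ₂ τ₂ᵀ τ₄) *
      e (-(T.map Complex.ofReal * symmPoint x (baseHeight τ₄ τ₂)).trace)

end SiegelEisenstein

end

open SiegelEisenstein

set_option linter.unusedSectionVars false

open Matrix MeasureTheory

noncomputable section

namespace SiegelEisenstein

variable {ι : Type*} [Fintype ι] [DecidableEq ι]

/-- The upper blocks `A`, `B` of `M = (A B; C D) ∈ Sp(ℤ)`, as complex matrices. -/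
def blockA (M : symplecticGroup ι ℤ) : Matrix ι ι ℂ :=
  (M : Matrix (ι ⊕ ι) (ι ⊕ ι) ℤ).toBlocks₁₁.map (Int.cast : ℤ → ℂ)

/-- See `blockA`. -/
def blockB (M : symplecticGroup ι ℤ) : Matrix ι ι ℂ :=
  (M : Matrix (ι ⊕ ι) (ι ⊕ ι) ℤ).toBlocks₁₂.map (Int.cast : ℤ → ℂ)

/-! ### Symplectic relations between the blocks -/

theorem map_eq_fromBlocks (M : symplecticGroup ι ℤ) :
    (M : Matrix (ι ⊕ ι) (ι ⊕ ι) ℤ).map (Int.cast : ℤ → ℂ) =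
      fromBlocks (blockA M) (blockB M) (blockC M) (blockD M) := by
  conv_lhs => rw [← fromBlocks_toBlocks (M : Matrix (ι ⊕ ι) (ι ⊕ ι) ℤ)]
  rw [fromBlocks_map]
  rfl

theorem fromBlocks_mem (M : symplecticGroup ι ℤ) :
    fromBlocks (blockA M) (blockB M) (blockC M) (blockD M) ∈ symplecticGroup ι ℂ := by
  rw [← map_eq_fromBlocks]
  exact SymplecticGroup.map_mem M.2 (Int.castRingHom ℂ)

theorem transpose_fromBlocks_mem (M : symplecticGroup ι ℤ) :
    fromBlocks (blockA M)ᵀ (blockC M)ᵀ (blockB M)ᵀ (blockD M)ᵀ ∈ symplecticGroup ι ℂ := by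
  rw [← fromBlocks_transpose]
  exact SymplecticGroup.transpose_mem (fromBlocks_mem M)

theorem blockA_transpose_mul_blockC (M : symplecticGroup ι ℤ) :
    (blockA M)ᵀ * blockC M = (blockC M)ᵀ * blockA M :=
  (SymplecticGroup.fromBlocks_mem_iff.1 (fromBlocks_mem M)).1

theorem blockB_transpose_mul_blockD (M : symplecticGroup ι ℤ) :
    (blockB M)ᵀ * blockD M = (blockD M)ᵀ * blockB M :=
  (SymplecticGroup.fromBlocks_mem_iff.1 (fromBlocks_mem M)).2.1

theorem blockA_transpose_mul_blockD (M : symplecticGroup ι ℤ) :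
    (blockA M)ᵀ * blockD M = 1 + (blockC M)ᵀ * blockB M :=
  sub_eq_iff_eq_add.1 (SymplecticGroup.fromBlocks_mem_iff.1 (fromBlocks_mem M)).2.2

theorem blockC_mul_blockD_transpose (M : symplecticGroup ι ℤ) :
    blockC M * (blockD M)ᵀ = blockD M * (blockC M)ᵀ := by
  simpa using (SymplecticGroup.fromBlocks_mem_iff.1 (transpose_fromBlocks_mem M)).2.1

theorem blockD_mul_blockA_transpose (M : symplecticGroup ι ℤ) :
    blockD M * (blockA M)ᵀ = 1 + blockC M * (blockB M)ᵀ := by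
  have h := sub_eq_iff_eq_add.1
    (SymplecticGroup.fromBlocks_mem_iff.1 (transpose_fromBlocks_mem M)).2.2
  have h2 := congrArg transpose h
  simpa [transpose_mul] using h2

theorem conjTranspose_map_intCast {m n : Type*} (N : Matrix m n ℤ) :
    (N.map (Int.cast : ℤ → ℂ))ᴴ = (N.map (Int.cast : ℤ → ℂ))ᵀ := by
  ext i j
  simp [conjTranspose_apply]

theorem blockC_conjTranspose (M : symplecticGroup ι ℤ) : (blockC M)ᴴ = (blockC M)ᵀ :=
  conjTranspose_map_intCast _

theorem blockD_conjTranspose (M : symplecticGroup ι ℤ) : (blockD M)ᴴ = (blockD M)ᵀ :=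
  conjTranspose_map_intCast _

/-- The matrix `C τ + D`, whose determinant is the automorphy factor. -/
def autMatrix (M : symplecticGroup ι ℤ) (τ : Matrix ι ι ℂ) : Matrix ι ι ℂ :=
  blockC M * τ + blockD M

theorem autFactor_eq_det (M : symplecticGroup ι ℤ) (τ : Matrix ι ι ℂ) :
    autFactor M τ = (autMatrix M τ).det := rfl

/-! ### Automorphy factors and the matrix (Cτ + D)⁻¹C -/

/-- The symmetric matrix `τ` has imaginary part at least `δ`. -/
def ImGE (δ : ℝ) (τ : Matrix ι ι ℂ) : Prop :=
  τ.IsSymm ∧ ∀ v : ι → ℝ, δ * ∑ i, v i ^ 2 ≤ v ⬝ᵥ (τ.map Complex.im) *ᵥ v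

/-- The minimum over the compact unit sphere, extended by homogeneity. A numerical lower bound δ is
what makes the later estimates uniform in the group element. -/
theorem exists_forall_le_dotProduct_mulVec {Y : Matrix ι ι ℝ} (hY : Y.PosDef) :
    ∃ δ > 0, ∀ v : ι → ℝ, δ * ∑ i, v i ^ 2 ≤ v ⬝ᵥ Y *ᵥ v := by
  let S : Set (ι → ℝ) := {v | ∑ i, v i ^ 2 = 1}
  have hcont : Continuous fun v : ι → ℝ => v ⬝ᵥ Y *ᵥ v := by
    simp only [dotProduct, mulVec]
    fun_prop
  have hS : IsCompact S := by
    refine Metric.isCompact_of_isClosed_isBounded ?_ ?_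
    · exact isClosed_eq (by fun_prop) continuous_const
    · refine (Metric.isBounded_closedBall (x := (0 : ι → ℝ)) (r := 1)).subset fun v hv => ?_
      rw [mem_closedBall_zero_iff, pi_norm_le_iff_of_nonneg zero_le_one]
      intro i
      have h1 : v i ^ 2 ≤ 1 := by
        rw [← (show ∑ i, v i ^ 2 = 1 from hv)]
        exact Finset.single_le_sum (f := fun i => v i ^ 2) (fun i _ => sq_nonneg _)
          (Finset.mem_univ i)
      rw [Real.norm_eq_abs]
      exact abs_le_one_iff_mul_self_le_one.2 (by nlinarith)
  have key : ∃ δ > 0, ∀ v ∈ S, δ ≤ v ⬝ᵥ Y *ᵥ v := by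
    -- The sphere is empty when there are no indices; then any δ will do.
    rcases S.eq_empty_or_nonempty with h | h
    · exact ⟨1, one_pos, by simp [h]⟩
    · obtain ⟨v, hv, hmin⟩ := hS.exists_isMinOn h hcont.continuousOn
      refine ⟨v ⬝ᵥ Y *ᵥ v, ?_, fun w hw => hmin hw⟩
      have hv0 : v ≠ 0 := by
        rintro rfl
        simp [S] at hv
      simpa using hY.dotProduct_mulVec_pos hv0
  obtain ⟨δ, hδ, h⟩ := key
  refine ⟨δ, hδ, fun v => ?_⟩
  rcases eq_or_ne v 0 with rfl | hv
  · simp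
  have hpos : 0 < ∑ i, v i ^ 2 := by
    refine lt_of_le_of_ne (Finset.sum_nonneg fun i _ => sq_nonneg _) fun h0 => hv ?_
    ext i
    have := (Finset.sum_eq_zero_iff_of_nonneg (fun i _ => sq_nonneg (v i))).1 h0.symm i
      (Finset.mem_univ i)
    simpa using this
  set s := Real.sqrt (∑ i, v i ^ 2) with hs
  have hs0 : 0 < s := Real.sqrt_pos.2 hpos
  have hs2 : s ^ 2 = ∑ i, v i ^ 2 := Real.sq_sqrt hpos.le
  have hw : s⁻¹ • v ∈ S := by
    change ∑ i, (s⁻¹ • v) i ^ 2 = 1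
    simp only [Pi.smul_apply, smul_eq_mul, mul_pow, ← Finset.mul_sum, ← hs2]
    field_simp
  have h2 := h _ hw
  rw [mulVec_smul, dotProduct_smul, smul_dotProduct, smul_eq_mul, smul_eq_mul, ← mul_assoc] at h2
  rw [← hs2]
  have : s ^ 2 * (s⁻¹ * s⁻¹ * (v ⬝ᵥ Y *ᵥ v)) = v ⬝ᵥ Y *ᵥ v := by field_simp
  nlinarith [mul_le_mul_of_nonneg_left h2 (sq_nonneg s)]

theorem exists_imGE {τ : Matrix ι ι ℂ} (hτ : τ ∈ siegelUpperHalfSpace ι) :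
    ∃ δ > 0, ImGE δ τ := by
  obtain ⟨δ, hδ, h⟩ := exists_forall_le_dotProduct_mulVec hτ.2
  exact ⟨δ, hδ, hτ.1, h⟩

theorem ImGE.mem {δ : ℝ} (hδ : 0 < δ) {τ : Matrix ι ι ℂ} (h : ImGE δ τ) :
    τ ∈ siegelUpperHalfSpace ι := by
  refine ⟨h.1, Matrix.PosDef.of_dotProduct_mulVec_pos ?_ fun v hv => ?_⟩
  · have := h.1
    ext i j
    simp [conjTranspose_apply, this.apply i j]
  · obtain ⟨i, hi⟩ := Function.ne_iff.1 hv
    have h1 : 0 < ∑ i, v i ^ 2 :=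
      Finset.sum_pos' (fun i _ => sq_nonneg _) ⟨i, Finset.mem_univ i, sq_pos_of_ne_zero hi⟩
    simpa using lt_of_lt_of_le (mul_pos hδ h1) (h.2 v)

/-- The imaginary part, as a complex matrix. -/
def imC (τ : Matrix ι ι ℂ) : Matrix ι ι ℂ := (τ.map Complex.im).map Complex.ofReal

theorem sub_conjTranspose {τ : Matrix ι ι ℂ} (h : τ.IsSymm) :
    τ - τᴴ = (2 * Complex.I) • imC τ := by
  ext i j
  have := h.apply i j
  simp only [Matrix.sub_apply, conjTranspose_apply, this, Matrix.smul_apply, imC, Matrix.map_apply,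
    smul_eq_mul]
  apply Complex.ext <;> simp
  ring

theorem ImGE.le_re {δ : ℝ} {τ : Matrix ι ι ℂ} (h : ImGE δ τ) (u : ι → ℂ) :
    δ * ∑ i, ‖u i‖ ^ 2 ≤ (u ⬝ᵥ imC τ *ᵥ star u).re := by
  have h1 := h.2 fun i => (u i).re
  have h2 := h.2 fun i => (u i).im
  have h3 : (u ⬝ᵥ imC τ *ᵥ star u).re = ((fun i => (u i).re) ⬝ᵥ (τ.map Complex.im) *ᵥ fun i =>
      (u i).re) + ((fun i => (u i).im) ⬝ᵥ (τ.map Complex.im) *ᵥ fun i => (u i).im) := by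
    simp only [dotProduct, mulVec, imC, Matrix.map_apply, Complex.re_sum, Finset.mul_sum,
      ← Finset.sum_add_distrib]
    refine Finset.sum_congr rfl fun i _ => Finset.sum_congr rfl fun j _ => ?_
    simp
  have h4 : ∑ i, ‖u i‖ ^ 2 = ∑ i, (u i).re ^ 2 + ∑ i, (u i).im ^ 2 := by
    rw [← Finset.sum_add_distrib]
    refine Finset.sum_congr rfl fun i _ => ?_
    rw [← Complex.normSq_eq_norm_sq, Complex.normSq_apply]
    ring
  rw [h3, h4]
  linarith

theorem ImGE.eq_zero_of_dotProduct {δ : ℝ} (hδ : 0 < δ) {τ : Matrix ι ι ℂ} (h : ImGE δ τ)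
    {u : ι → ℂ} (hu : u ⬝ᵥ imC τ *ᵥ star u = 0) : u = 0 := by
  have h1 := h.le_re u
  rw [hu, Complex.zero_re] at h1
  have h2 : ∑ i, ‖u i‖ ^ 2 ≤ 0 := by
    by_contra! hc
    exact absurd (mul_pos hδ hc) (not_lt.2 h1)
  ext i
  have := (Finset.sum_eq_zero_iff_of_nonneg (fun i _ => sq_nonneg ‖u i‖)).1
    (le_antisymm h2 (Finset.sum_nonneg fun i _ => sq_nonneg _)) i (Finset.mem_univ i)
  simpa using this

/-- As C Dᵀ is symmetric, the terms with D cancel and only C(τ - τ*)Cᵀ is left. -/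
theorem autMatrix_mul_blockC_transpose_sub (M : symplecticGroup ι ℤ) {τ : Matrix ι ι ℂ}
    (hτ : τ.IsSymm) :
    autMatrix M τ * (blockC M)ᵀ - blockC M * (autMatrix M τ)ᴴ =
      (2 * Complex.I) • (blockC M * imC τ * (blockC M)ᵀ) := by
  rw [← Matrix.smul_mul, ← Matrix.mul_smul, ← sub_conjTranspose hτ]
  simp only [autMatrix, conjTranspose_add, conjTranspose_mul, blockC_conjTranspose,
    blockD_conjTranspose, Matrix.add_mul, Matrix.mul_add, Matrix.mul_sub, Matrix.sub_mul,
    blockC_mul_blockD_transpose, Matrix.mul_assoc]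
  abel

/-- If v(Cτ + D) = 0, the preceding identity makes the form Im τ vanish at vC, hence vC = 0 and then
vD = 0. The relation D Aᵀ - C Bᵀ = 1 forces v = 0. -/
theorem autFactor_ne_zero {δ : ℝ} (hδ : 0 < δ) {τ : Matrix ι ι ℂ} (h : ImGE δ τ)
    (M : symplecticGroup ι ℤ) : autFactor M τ ≠ 0 := by
  intro h0
  rw [autFactor_eq_det, ← exists_vecMul_eq_zero_iff] at h0
  obtain ⟨v, hv, hv0⟩ := h0
  have h1 := congrArg (fun N => v ᵥ* N ⬝ᵥ star v) (autMatrix_mul_blockC_transpose_sub M h.1)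
  have h2 : (v ᵥ* (blockC M * (autMatrix M τ)ᴴ)) ⬝ᵥ star v = 0 := by
    rw [← vecMul_vecMul, ← dotProduct_mulVec, ← star_vecMul, hv0]
    simp
  have h3 : (v ᵥ* blockC M) ⬝ᵥ imC τ *ᵥ star (v ᵥ* blockC M) = 0 := by
    simp only [vecMul_sub, sub_dotProduct, h2, vecMul_smul, smul_dotProduct] at h1
    rw [← vecMul_vecMul, hv0, zero_vecMul, zero_dotProduct, sub_zero] at h1
    rw [star_vecMul, blockC_conjTranspose, dotProduct_mulVec, dotProduct_mulVec, vecMul_vecMul,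
      vecMul_vecMul]
    rw [← Matrix.mul_assoc]
    exact (smul_eq_zero.1 h1.symm).resolve_left (by simp)
  have h4 := h.eq_zero_of_dotProduct hδ h3
  have h5 : v ᵥ* blockD M = 0 := by
    have := hv0
    rwa [autMatrix, vecMul_add, ← vecMul_vecMul, h4, zero_vecMul, zero_add] at this
  have h6 := congrArg (fun N => v ᵥ* N) (blockD_mul_blockA_transpose M)
  simp only [vecMul_add, ← vecMul_vecMul, h4, h5, zero_vecMul, vecMul_one, add_zero] at h6
  exact hv h6.symm

/-- The symmetric matrix `(C τ + D)⁻¹ C`. -/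
def autZ (M : symplecticGroup ι ℤ) (τ : Matrix ι ι ℂ) : Matrix ι ι ℂ :=
  (autMatrix M τ)⁻¹ * blockC M

section

variable {δ : ℝ} {τ : Matrix ι ι ℂ} (M : symplecticGroup ι ℤ)

theorem isUnit_det_autMatrix (hδ : 0 < δ) (h : ImGE δ τ) : IsUnit (autMatrix M τ).det :=
  isUnit_iff_ne_zero.2 (autFactor_ne_zero hδ h M)

theorem autMatrix_mul_autZ (hδ : 0 < δ) (h : ImGE δ τ) :
    autMatrix M τ * autZ M τ = blockC M := by
  rw [autZ, ← Matrix.mul_assoc, mul_nonsing_inv _ (isUnit_det_autMatrix M hδ h), Matrix.one_mul]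

theorem autMatrix_mul_transpose_blockC (hτ : τ.IsSymm) :
    autMatrix M τ * (blockC M)ᵀ = blockC M * (autMatrix M τ)ᵀ := by
  simp only [autMatrix, transpose_add, transpose_mul, Matrix.add_mul, Matrix.mul_add, hτ.eq,
    blockC_mul_blockD_transpose, Matrix.mul_assoc]

theorem autZ_isSymm (hδ : 0 < δ) (h : ImGE δ τ) : (autZ M τ).IsSymm := by
  have hW := isUnit_det_autMatrix M hδ h
  have hWt : IsUnit (autMatrix M τ)ᵀ.det := by rwa [det_transpose]
  have h1 : autMatrix M τ * ((autZ M τ)ᵀ) * (autMatrix M τ)ᵀ =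
      autMatrix M τ * autZ M τ * (autMatrix M τ)ᵀ := by
    rw [autMatrix_mul_autZ M hδ h, Matrix.mul_assoc, ← transpose_mul, autMatrix_mul_autZ M hδ h,
      autMatrix_mul_transpose_blockC M h.1]
  exact (isUnit_iff_isUnit_det _).2 hW |>.mul_left_cancel
    (((isUnit_iff_isUnit_det _).2 hWt).mul_right_cancel h1)

/-- Multiplying by Cτ + D on the left and its adjoint on the right turns this into
`autMatrix_mul_blockC_transpose_sub`. -/
theorem autZ_sub_conjTranspose (hδ : 0 < δ) (h : ImGE δ τ) :
    autZ M τ - (autZ M τ)ᴴ = -((2 * Complex.I) • (autZ M τ * imC τ * (autZ M τ)ᴴ)) := by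
  have hW := isUnit_det_autMatrix M hδ h
  have hWt : IsUnit (autMatrix M τ)ᴴ.det := by
    rw [det_conjTranspose]
    exact hW.star
  have hC : (autZ M τ)ᴴ * (autMatrix M τ)ᴴ = (blockC M)ᵀ := by
    rw [← conjTranspose_mul, autMatrix_mul_autZ M hδ h, blockC_conjTranspose]
  have h1 : autMatrix M τ * (autZ M τ - (autZ M τ)ᴴ) * (autMatrix M τ)ᴴ =
      autMatrix M τ * (-((2 * Complex.I) • (autZ M τ * imC τ * (autZ M τ)ᴴ))) *
        (autMatrix M τ)ᴴ := by
    have h2 := autMatrix_mul_blockC_transpose_sub M h.1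
    rw [Matrix.mul_sub, Matrix.sub_mul, autMatrix_mul_autZ M hδ h, Matrix.mul_assoc, hC,
      Matrix.mul_neg, Matrix.neg_mul, Matrix.mul_smul, Matrix.smul_mul, Matrix.mul_assoc,
      Matrix.mul_assoc, Matrix.mul_assoc, hC, ← Matrix.mul_assoc, autMatrix_mul_autZ M hδ h,
      ← neg_sub, h2, Matrix.mul_assoc]
  exact (isUnit_iff_isUnit_det _).2 hW |>.mul_left_cancel
    (((isUnit_iff_isUnit_det _).2 hWt).mul_right_cancel h1)

/-- For real v the identity Im Z = -Z (Im τ) Z* expresses -Im(vᵀZv) as the form Im τ at vZ. Both the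
size and the sign of this quantity are used. -/
theorem dotProduct_autZ_im (hδ : 0 < δ) (h : ImGE δ τ) (v : ι → ℝ) :
    δ * ∑ i, ‖((fun i => (v i : ℂ)) ᵥ* autZ M τ) i‖ ^ 2 ≤
      -((fun i => (v i : ℂ)) ⬝ᵥ autZ M τ *ᵥ fun i => (v i : ℂ)).im := by
  set w : ι → ℂ := fun i => (v i : ℂ) with hw
  have hstar : star w = w := by
    ext i
    simp [hw]
  have h1 := congrArg (fun N => w ᵥ* N ⬝ᵥ w) (autZ_sub_conjTranspose M hδ h)
  have h2 : w ᵥ* (autZ M τ)ᴴ ⬝ᵥ w = star (w ᵥ* autZ M τ ⬝ᵥ w) := by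
    rw [← dotProduct_mulVec, ← star_dotProduct_star, star_vecMul, hstar, dotProduct_comm]
  have h3 : w ᵥ* (autZ M τ * imC τ * (autZ M τ)ᴴ) ⬝ᵥ w =
      (w ᵥ* autZ M τ) ⬝ᵥ imC τ *ᵥ star (w ᵥ* autZ M τ) := by
    rw [star_vecMul, hstar, dotProduct_mulVec, dotProduct_mulVec, vecMul_vecMul, vecMul_vecMul,
      Matrix.mul_assoc]
  simp only [vecMul_sub, sub_dotProduct, vecMul_neg, neg_dotProduct, vecMul_smul, smul_dotProduct,
    h2, h3] at h1
  have h4 := congrArg Complex.im h1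
  have h5 := h.le_re (w ᵥ* autZ M τ)
  simp at h4
  rw [dotProduct_mulVec]
  linarith

/-- With v a basis vector, δ times the squared length of row i is at most |Z i i|. This bounds the
diagonal entry first and then the whole row. -/
theorem norm_autZ_apply_le (hδ : 0 < δ) (h : ImGE δ τ) (i j : ι) : ‖autZ M τ i j‖ ≤ δ⁻¹ := by
  have h1 := dotProduct_autZ_im M hδ h (Pi.single i 1)
  have h2 : (fun j => ((Pi.single i 1 : ι → ℝ) j : ℂ)) = Pi.single i (1 : ℂ) := by
    ext j
    by_cases hj : j = i
    · subst hj
      simp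
    · simp [hj]
  rw [h2] at h1
  simp only [single_one_vecMul, mulVec_single_one, single_one_dotProduct, row_apply, col_apply]
    at h1
  have h3 : ∀ j, ‖autZ M τ i j‖ ^ 2 ≤ ∑ j, ‖autZ M τ i j‖ ^ 2 := fun j =>
    Finset.single_le_sum (f := fun j => ‖autZ M τ i j‖ ^ 2) (fun _ _ => sq_nonneg _)
      (Finset.mem_univ j)
  have h4 : -(autZ M τ i i).im ≤ ‖autZ M τ i i‖ :=
    (neg_le_abs _).trans (Complex.abs_im_le_norm _)
  have h5 : ‖autZ M τ i i‖ ≤ δ⁻¹ := by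
    rcases (norm_nonneg (autZ M τ i i)).eq_or_lt with h0 | h0
    · rw [← h0]
      positivity
    · rw [← one_div, le_div_iff₀ hδ]
      have := mul_le_mul_of_nonneg_left (h3 i) hδ.le
      nlinarith
  have h6 : δ * ‖autZ M τ i j‖ ^ 2 ≤ δ⁻¹ :=
    ((mul_le_mul_of_nonneg_left (h3 j) hδ.le).trans h1).trans (h4.trans h5)
  refine abs_le_of_sq_le_sq' ?_ (by positivity) |>.2
  calc ‖autZ M τ i j‖ ^ 2 = δ⁻¹ * (δ * ‖autZ M τ i j‖ ^ 2) := by field_simp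
    _ ≤ δ⁻¹ * δ⁻¹ := by gcongr
    _ = δ⁻¹ ^ 2 := by ring

/-- Cτ' + D = (Cτ + D) + C(τ' - τ) and C = (Cτ + D)Z. The quotient of the two factors involves M
only through the bounded matrix Z. -/
theorem autFactor_eq_mul_det (hδ : 0 < δ) (h : ImGE δ τ) (τ' : Matrix ι ι ℂ) :
    autFactor M τ' = autFactor M τ * (1 + autZ M τ * (τ' - τ)).det := by
  rw [autFactor_eq_det, autFactor_eq_det, ← det_mul, Matrix.mul_add, ← Matrix.mul_assoc,
    autMatrix_mul_autZ M hδ h]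
  simp only [autMatrix, Matrix.mul_one, Matrix.mul_sub]
  congr 1
  abel

theorem norm_det_le {N : Matrix ι ι ℂ} {x : ℝ} (hx : ∀ i j, ‖N i j‖ ≤ x) :
    ‖N.det‖ ≤ (Fintype.card ι).factorial * x ^ Fintype.card ι := by
  rw [det_apply]
  refine (norm_sum_le _ _).trans ?_
  refine (Finset.sum_le_card_nsmul _ _ (x ^ Fintype.card ι) fun p _ => ?_).trans ?_
  · have h1 : ‖Equiv.Perm.sign p • ∏ i, N (p i) i‖ = ∏ i, ‖N (p i) i‖ := by
      rcases Int.units_eq_one_or (Equiv.Perm.sign p) with h | h <;> simp [h]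
    rw [h1]
    refine (Finset.prod_le_prod (fun i _ => norm_nonneg _) fun i _ => hx (p i) i).trans ?_
    simp
  · rw [Finset.card_univ, Fintype.card_perm, nsmul_eq_mul]

/-- Automorphy factors at two points of bounded distance are comparable, uniformly in the
group element. -/
theorem norm_autFactor_le (hδ : 0 < δ) (h : ImGE δ τ) {R : ℝ} {τ' : Matrix ι ι ℂ}
    (hR : ∀ i j, ‖τ' i j - τ i j‖ ≤ R) :
    ‖autFactor M τ'‖ ≤ ((Fintype.card ι).factorial *
      (1 + Fintype.card ι * (δ⁻¹ * R)) ^ Fintype.card ι) * ‖autFactor M τ‖ := by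
  rw [autFactor_eq_mul_det M hδ h τ', norm_mul, mul_comm]
  gcongr
  refine norm_det_le fun i j => ?_
  rw [Matrix.add_apply, Matrix.mul_apply]
  refine (norm_add_le _ _).trans (add_le_add ?_ ?_)
  · rw [Matrix.one_apply]
    split_ifs <;> simp
  · refine (norm_sum_le _ _).trans ?_
    refine (Finset.sum_le_card_nsmul _ _ (δ⁻¹ * R) fun l _ => ?_).trans ?_
    · rw [norm_mul]
      exact mul_le_mul (norm_autZ_apply_le M hδ h i l) (hR l j) (norm_nonneg _) (by positivity)
    · simp [nsmul_eq_mul]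

theorem autFactor_add_smul_vecMulVec (hδ : 0 < δ) (h : ImGE δ τ) (c : ℂ) (v : ι → ℂ) :
    autFactor M (τ + c • vecMulVec v v) =
      autFactor M τ * (1 + c * (v ⬝ᵥ autZ M τ *ᵥ v)) := by
  rw [autFactor_eq_mul_det M hδ h, add_sub_cancel_left, Matrix.mul_smul, mul_vecMulVec,
    ← smul_vecMulVec, vecMulVec_eq Unit, det_one_add_replicateCol_mul_replicateRow,
    dotProduct_smul, smul_eq_mul]

/-- The automorphy factor does not decrease in absolute value when a positive semidefinite matrix
of rank one is added to the imaginary part. -/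
theorem norm_autFactor_le_add_smul_vecMulVec (hδ : 0 < δ) (h : ImGE δ τ) {t : ℝ} (ht : 0 ≤ t)
    (v : ι → ℝ) :
    ‖autFactor M τ‖ ≤ ‖autFactor M (τ + (Complex.I * t) •
      vecMulVec (fun i => (v i : ℂ)) (fun i => (v i : ℂ)))‖ := by
  rw [autFactor_add_smul_vecMulVec M hδ h, norm_mul]
  refine le_mul_of_one_le_right (norm_nonneg _) ?_
  -- The real part of 1 + it·vᵀZv is 1 - t Im(vᵀZv), which is at least 1.
  refine le_trans ?_ (Complex.re_le_norm _)
  have h1 := dotProduct_autZ_im M hδ h v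
  have h2 : 0 ≤ δ * ∑ i, ‖((fun i => (v i : ℂ)) ᵥ* autZ M τ) i‖ ^ 2 := by positivity
  simp
  nlinarith [mul_nonneg ht (h2.trans h1)]

end

/-! ### Hermite reduction of positive integral forms -/

/-- A symmetric integral matrix that is positive on nonzero integral vectors. -/
def IsPosInt (S : Matrix ι ι ℤ) : Prop :=
  S.IsSymm ∧ ∀ v : ι → ℤ, v ≠ 0 → 0 < v ⬝ᵥ S *ᵥ v

theorem mul_mul_transpose_apply {κ : Type*} (U : Matrix κ ι ℤ) (S : Matrix ι ι ℤ) (i j : κ) :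
    (U * S * Uᵀ) i j = U i ⬝ᵥ S *ᵥ U j := by
  rw [Matrix.mul_assoc, Matrix.mul_apply]
  simp only [dotProduct, mulVec, Matrix.mul_apply, transpose_apply]

theorem IsPosInt.conj {S : Matrix ι ι ℤ} (hS : IsPosInt S) {U : Matrix ι ι ℤ}
    (hU : IsUnit U.det) : IsPosInt (U * S * Uᵀ) := by
  refine ⟨?_, fun v hv => ?_⟩
  · rw [IsSymm, transpose_mul, transpose_mul, transpose_transpose, hS.1.eq, Matrix.mul_assoc]
  · have h1 : v ᵥ* U ≠ 0 := by
      intro h0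
      refine hv ?_
      have := congrArg (fun w => w ᵥ* U⁻¹) h0
      simpa [vecMul_vecMul, mul_nonsing_inv _ hU] using this
    have h2 := hS.2 _ h1
    rw [dotProduct_mulVec, vecMul_vecMul] at h2
    rwa [← mulVec_mulVec, dotProduct_mulVec, mulVec_transpose]

/-- Every class of positive definite integral matrices contains a matrix whose orthogonality defect
is bounded in terms of the size only. -/
def HasReducedForms (ι : Type*) [Fintype ι] [DecidableEq ι] : Prop :=
  ∃ K : ℤ, 0 < K ∧ ∀ S : Matrix ι ι ℤ, IsPosInt S →
    ∃ U : Matrix ι ι ℤ, IsUnit U.det ∧ ∏ i, (U * S * Uᵀ) i i ≤ K * S.det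

theorem HasReducedForms.congr {κ : Type*} [Fintype κ] [DecidableEq κ] (e : ι ≃ κ)
    (h : HasReducedForms ι) : HasReducedForms κ := by
  obtain ⟨K, hK, h⟩ := h
  refine ⟨K, hK, fun S hS => ?_⟩
  have hpos : IsPosInt (S.submatrix e e) := by
    refine ⟨hS.1.submatrix e, fun v hv => ?_⟩
    have h1 := hS.2 (v ∘ e.symm) fun h0 => hv (by
      ext i
      simpa using congrFun h0 (e i))
    convert h1 using 1
    simp only [dotProduct, mulVec, submatrix_apply]
    refine Fintype.sum_equiv e _ _ fun i => ?_
    simp only [Function.comp, Equiv.symm_apply_apply]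
    congr 1
    exact Fintype.sum_equiv e _ _ fun i => by simp
  obtain ⟨U, hU, hle⟩ := h (S.submatrix e e) hpos
  refine ⟨U.submatrix e.symm e.symm, by rwa [det_submatrix_equiv_self], ?_⟩
  have h1 : U.submatrix e.symm e.symm * S * (U.submatrix e.symm e.symm)ᵀ =
      (U * S.submatrix e e * Uᵀ).submatrix e.symm e.symm := by
    conv_lhs => rw [show S = (S.submatrix e e).submatrix e.symm e.symm by simp]
    rw [transpose_submatrix, submatrix_mul_equiv, submatrix_mul_equiv]
  rw [h1, ← det_submatrix_equiv_self e S]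
  refine le_trans (le_of_eq ?_) hle
  exact Fintype.prod_equiv e.symm _ _ fun i => rfl

/-- Diagonal entries of unimodular conjugates are positive integers, so a least one exists; a row
permutation moves it to the corner. -/
theorem exists_minimal_corner {κ : Type*} [Fintype κ] [DecidableEq κ]
    {S : Matrix (Unit ⊕ κ) (Unit ⊕ κ) ℤ} (hS : IsPosInt S) :
    ∃ U : Matrix (Unit ⊕ κ) (Unit ⊕ κ) ℤ, IsUnit U.det ∧
      ∀ V : Matrix (Unit ⊕ κ) (Unit ⊕ κ) ℤ, IsUnit V.det → ∀ i,
        (U * S * Uᵀ) (Sum.inl ()) (Sum.inl ()) ≤ (V * S * Vᵀ) i i := by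
  let A : Set ℕ := {n | ∃ V : Matrix (Unit ⊕ κ) (Unit ⊕ κ) ℤ, IsUnit V.det ∧
    ∃ i, (V * S * Vᵀ) i i = n}
  have hnonneg : ∀ V : Matrix (Unit ⊕ κ) (Unit ⊕ κ) ℤ, IsUnit V.det → ∀ i,
      0 < (V * S * Vᵀ) i i := by
    intro V hV i
    have := (hS.conj hV).2 (Pi.single i 1) (by simp)
    simpa using this
  have hA : A.Nonempty := by
    have h1 := (hnonneg 1 (by simp) (Sum.inl ())).le
    refine ⟨(S (Sum.inl ()) (Sum.inl ())).toNat, 1, by simp, Sum.inl (), ?_⟩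
    rw [transpose_one, Matrix.mul_one, Matrix.one_mul] at h1 ⊢
    rw [Int.toNat_of_nonneg h1]
  obtain ⟨V, hV, i, hi⟩ := Nat.sInf_mem hA
  let σ := Equiv.swap (Sum.inl () : Unit ⊕ κ) i
  refine ⟨V.submatrix σ id, ?_, fun W hW j => ?_⟩
  · rw [det_permute]
    exact ((Units.isUnit _).map (Int.castRingHom ℤ)).mul hV
  · have h1 : (V.submatrix σ id * S * (V.submatrix σ id)ᵀ) (Sum.inl ()) (Sum.inl ()) =
        (V * S * Vᵀ) i i := by
      simp [mul_mul_transpose_apply, σ, Matrix.submatrix]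
      rfl
    rw [h1, hi, ← Int.toNat_of_nonneg (hnonneg W hW j).le, Nat.cast_le]
    exact Nat.sInf_le ⟨W, hW, j, (Int.toNat_of_nonneg (hnonneg W hW j).le).symm⟩

theorem exists_abs_two_mul_le {a : ℤ} (ha : 0 < a) (c : ℤ) : ∃ x : ℤ, |2 * (a * x + c)| ≤ a := by
  -- Minus the integer nearest to c / a.
  refine ⟨-((2 * c + a) / (2 * a)), ?_⟩
  have h1 := Int.mul_ediv_add_emod (2 * c + a) (2 * a)
  have h2 := Int.emod_nonneg (2 * c + a) (b := 2 * a) (by omega)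
  have h3 := Int.emod_lt_of_pos (2 * c + a) (b := 2 * a) (by omega)
  rw [abs_le]
  constructor <;> linarith

section

variable {κ : Type*} [Fintype κ] [DecidableEq κ] (S : Matrix (Unit ⊕ κ) (Unit ⊕ κ) ℤ)

/-- The integral matrix `a S₁ - b bᵀ` of the form induced on the orthogonal complement of the first
basis vector, for `S = (a bᵀ; b S₁)`. -/
def schurInt : Matrix κ κ ℤ := Matrix.of fun i j =>
  S (Sum.inl ()) (Sum.inl ()) * S (Sum.inr i) (Sum.inr j) -
    S (Sum.inr i) (Sum.inl ()) * S (Sum.inr j) (Sum.inl ())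

/-- Completion of the square, multiplied by the corner entry to stay integral. -/
theorem corner_mul_dotProduct_mulVec (hS : S.IsSymm) (x : ℤ) (v : κ → ℤ) :
    S (Sum.inl ()) (Sum.inl ()) * (Sum.elim (fun _ => x) v ⬝ᵥ S *ᵥ Sum.elim (fun _ => x) v) =
      (S (Sum.inl ()) (Sum.inl ()) * x + ∑ i, S (Sum.inr i) (Sum.inl ()) * v i) ^ 2 +
        v ⬝ᵥ schurInt S *ᵥ v := by
  have h0 : ∀ i, S (Sum.inl ()) (Sum.inr i) = S (Sum.inr i) (Sum.inl ()) := fun i => hS.apply _ _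
  set a := S (Sum.inl ()) (Sum.inl ())
  set β := ∑ i, S (Sum.inr i) (Sum.inl ()) * v i with hβ
  set q := ∑ i, v i * ∑ j, S (Sum.inr i) (Sum.inr j) * v j with hq
  have h1 : Sum.elim (fun _ => x) v ⬝ᵥ S *ᵥ Sum.elim (fun _ => x) v =
      a * x ^ 2 + 2 * x * β + q := by
    simp only [dotProduct, mulVec, Fintype.sum_sum_type, Sum.elim_inl, Sum.elim_inr,
      Finset.univ_unique, Finset.sum_singleton, PUnit.default_eq_unit, mul_add,
      Finset.sum_add_distrib, h0]
    rw [← hβ]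
    have h2 : ∑ i, v i * (S (Sum.inr i) (Sum.inl ()) * x) = β * x := by
      rw [hβ, Finset.sum_mul]
      exact Finset.sum_congr rfl fun i _ => by ring
    rw [h2]
    ring
  have h2 : v ⬝ᵥ schurInt S *ᵥ v = a * q - β ^ 2 := by
    simp only [dotProduct, mulVec, schurInt, Matrix.of_apply, sub_mul, Finset.sum_sub_distrib,
      mul_sub]
    congr 1
    · rw [hq, Finset.mul_sum]
      refine Finset.sum_congr rfl fun i _ => ?_
      rw [Finset.mul_sum, Finset.mul_sum, Finset.mul_sum]
      exact Finset.sum_congr rfl fun j _ => by ring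
    · rw [sq, hβ, Finset.sum_mul_sum]
      refine Finset.sum_congr rfl fun i _ => ?_
      rw [Finset.mul_sum]
      exact Finset.sum_congr rfl fun j _ => by ring
  rw [h1, h2]
  ring

/-- Clearing the first column with a lower triangular matrix of determinant a^|κ|. One factor a is
left uncancelled, so that κ may be empty. -/
theorem corner_pow_mul_det (hS : S.IsSymm) :
    S (Sum.inl ()) (Sum.inl ()) ^ Fintype.card κ * S.det =
      S (Sum.inl ()) (Sum.inl ()) * (schurInt S).det := by
  have h0 : ∀ i, S (Sum.inl ()) (Sum.inr i) = S (Sum.inr i) (Sum.inl ()) := fun i => hS.apply _ _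
  let L : Matrix (Unit ⊕ κ) (Unit ⊕ κ) ℤ := fromBlocks 1 0
    (Matrix.of fun i _ => -S (Sum.inr i) (Sum.inl ())) (diagonal fun _ => S (Sum.inl ()) (Sum.inl ()))
  have h1 : L * S = fromBlocks (Matrix.of fun _ _ => S (Sum.inl ()) (Sum.inl ()))
      (Matrix.of fun _ j => S (Sum.inl ()) (Sum.inr j)) 0 (schurInt S) := by
    ext (i | i) (j | j) <;>
      simp [L, Matrix.mul_apply, Fintype.sum_sum_type, schurInt, diagonal_apply, h0] <;> ring
  have h2 := congrArg det h1
  rw [det_mul, det_fromBlocks_zero₁₂, det_fromBlocks_zero₂₁] at h2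
  simpa using h2

variable {S}

theorem IsPosInt.corner_pos (hS : IsPosInt S) : 0 < S (Sum.inl ()) (Sum.inl ()) := by
  simpa using hS.2 (Pi.single (Sum.inl ()) 1) (by simp)

theorem IsPosInt.schurInt (hS : IsPosInt S) : IsPosInt (schurInt S) := by
  refine ⟨?_, fun v hv => ?_⟩
  · ext i j
    simp only [transpose_apply, SiegelEisenstein.schurInt, Matrix.of_apply,
      hS.1.apply (Sum.inr i) (Sum.inr j)]
    ring
  · have ha := hS.corner_pos
    set a := S (Sum.inl ()) (Sum.inl ()) with ha'
    set β := ∑ i, S (Sum.inr i) (Sum.inl ()) * v i with hβ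
    -- The vector (-β, a v) makes the square vanish and leaves a² times the induced form at v.
    have h1 := corner_mul_dotProduct_mulVec S hS.1 (-β) (a • v)
    have h2 := hS.2 (Sum.elim (fun _ => -β) (a • v)) fun h0 => hv ?_
    · rw [← ha'] at h1
      have h3 : a * -β + ∑ i, S (Sum.inr i) (Sum.inl ()) * (a • v) i = 0 := by
        rw [hβ, mul_neg, Finset.mul_sum, neg_add_eq_zero]
        exact Finset.sum_congr rfl fun i _ => by simp; ring
      rw [h3, mulVec_smul, dotProduct_smul, smul_dotProduct] at h1
      have h4 := mul_pos ha h2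
      rw [h1] at h4
      simp only [smul_eq_mul] at h4
      have h5 : 0 < a * (a * (v ⬝ᵥ SiegelEisenstein.schurInt S *ᵥ v)) := by linarith
      exact (mul_pos_iff_of_pos_left ha).1 ((mul_pos_iff_of_pos_left ha).1 h5)
    · ext i
      have := congrFun h0 (Sum.inr i)
      simpa [ha.ne'] using this

end

/-- Hermite's induction: take a minimal vector as the first basis vector, reduce the form induced on
its complement, and lift that basis with offsets as small as possible. -/
theorem HasReducedForms.sum {κ : Type*} [Fintype κ] [DecidableEq κ] (h : HasReducedForms κ) :
    HasReducedForms (Unit ⊕ κ) := by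
  obtain ⟨K, hK, h⟩ := h
  refine ⟨2 ^ Fintype.card κ * K, by positivity, fun S₀ hS₀ => ?_⟩
  obtain ⟨U, hU, hmin⟩ := exists_minimal_corner hS₀
  set S := U * S₀ * Uᵀ with hSdef
  have hS : IsPosInt S := hS₀.conj hU
  have hdet : S.det = S₀.det := by
    rw [hSdef, det_mul, det_mul, det_transpose, mul_right_comm]
    rcases Int.isUnit_iff.1 hU with h | h <;> simp [h]
  have ha := hS.corner_pos
  obtain ⟨V, hV, hle⟩ := h (schurInt S) hS.schurInt
  have hx := fun i => exists_abs_two_mul_le ha (∑ j, S (Sum.inr j) (Sum.inl ()) * V i j)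
  choose x hx using hx
  set a := S (Sum.inl ()) (Sum.inl ()) with ha'
  -- The reduced basis V of the complement, each vector shifted by the multiple x i of the minimal
  -- one.
  let W : Matrix (Unit ⊕ κ) (Unit ⊕ κ) ℤ := fromBlocks 1 0 (Matrix.of fun i _ => x i) V
  have hW : IsUnit W.det := by simpa [W, det_fromBlocks_zero₁₂] using hV
  have hWU : W * U * S₀ * (W * U)ᵀ = W * S * Wᵀ := by
    rw [hSdef, transpose_mul]
    simp only [Matrix.mul_assoc]
  refine ⟨W * U, by rw [det_mul]; exact hW.mul hU, ?_⟩
  rw [hWU, Fintype.prod_sum_type, ← hdet]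
  have hrow : ∀ i, W (Sum.inr i) = Sum.elim (fun _ => x i) (V i) := by
    intro i
    ext (j | j) <;> simp [W]
  have hrow0 : W (Sum.inl ()) = Pi.single (Sum.inl ()) 1 := by
    ext (j | j) <;> simp [W]
  have h0 : ∏ i : Unit, (W * S * Wᵀ) (Sum.inl i) (Sum.inl i) = a := by
    simp [mul_mul_transpose_apply, hrow0, ha']
  -- By the choice of x i the square is at most a²/4, and minimality gives a² ≤ a·(new diagonal
  -- entry). So the factor 4/3 is available, and 2 is enough.
  have h1 : ∀ i, a * (W * S * Wᵀ) (Sum.inr i) (Sum.inr i) ≤ 2 * (V * schurInt S * Vᵀ) i i := by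
    intro i
    have h2 : a ≤ (W * S * Wᵀ) (Sum.inr i) (Sum.inr i) := by
      rw [← hWU]
      exact hmin (W * U) (by rw [det_mul]; exact hW.mul hU) _
    have h3 := corner_mul_dotProduct_mulVec S hS.1 (x i) (V i)
    rw [← hrow, ← mul_mul_transpose_apply, ← mul_mul_transpose_apply, ← ha'] at h3
    have h4 := abs_le.1 (hx i)
    nlinarith [mul_le_mul_of_nonneg_left h2 ha.le]
  rw [h0]
  have h2 : a ^ Fintype.card κ * ∏ i, (W * S * Wᵀ) (Sum.inr i) (Sum.inr i) ≤
      2 ^ Fintype.card κ * (K * (schurInt S).det) := by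
    calc a ^ Fintype.card κ * ∏ i, (W * S * Wᵀ) (Sum.inr i) (Sum.inr i) =
        ∏ i, (a * (W * S * Wᵀ) (Sum.inr i) (Sum.inr i)) := by
          rw [Finset.prod_mul_distrib]
          simp
      _ ≤ ∏ i, (2 * (V * schurInt S * Vᵀ) i i) := by
          refine Finset.prod_le_prod (fun i _ => mul_nonneg ha.le ?_) fun i _ => h1 i
          have := (hS.conj hW).2 (Pi.single (Sum.inr i) 1) (by simp)
          simpa using this.le
      _ = 2 ^ Fintype.card κ * ∏ i, (V * schurInt S * Vᵀ) i i := by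
          rw [Finset.prod_mul_distrib]
          simp
      _ ≤ _ := by gcongr
  have h3 := corner_pow_mul_det S hS.1
  rw [← ha'] at h3
  refine le_of_mul_le_mul_left ?_ (pow_pos ha (Fintype.card κ))
  calc a ^ Fintype.card κ * (a * ∏ i, (W * S * Wᵀ) (Sum.inr i) (Sum.inr i)) =
      a * (a ^ Fintype.card κ * ∏ i, (W * S * Wᵀ) (Sum.inr i) (Sum.inr i)) := by ring
    _ ≤ a * (2 ^ Fintype.card κ * (K * (schurInt S).det)) := by gcongr
    _ = 2 ^ Fintype.card κ * K * (a * (schurInt S).det) := by ring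
    _ = _ := by rw [← h3]; ring

/-- Hermite reduction: positive definite integral quadratic forms have a basis whose orthogonality
defect is bounded in terms of the rank. -/
theorem hasReducedForms (ι : Type*) [Fintype ι] [DecidableEq ι] : HasReducedForms ι := by
  have h : ∀ n : ℕ, HasReducedForms (Fin n) := by
    intro n
    induction n with
    | zero => exact ⟨1, one_pos, fun S _ => ⟨1, by simp, by simp⟩⟩
    | succ n ih => exact ih.sum.congr (Fintype.equivOfCardEq (by simp [add_comm]))
  exact (h _).congr (Fintype.equivFin ι).symm

/-! ### Cosets, Gram matrices and the orbit of the base point -/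

theorem summable_pi_prod {σ α : Type*} [Fintype σ] {f : σ → α → ℝ} (h0 : ∀ i a, 0 ≤ f i a)
    (hf : ∀ i, Summable (f i)) : Summable fun x : σ → α => ∏ i, f i (x i) := by
  classical
  refine summable_of_sum_le (c := ∏ i, ∑' a, f i a)
    (fun x => Finset.prod_nonneg fun i _ => h0 i _) fun u => ?_
  calc ∑ x ∈ u, ∏ i, f i (x i) ≤
      ∑ x ∈ Fintype.piFinset fun i => u.image fun x => x i, ∏ i, f i (x i) := by
        refine Finset.sum_le_sum_of_subset_of_nonneg (fun x hx => ?_)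
          fun x _ _ => Finset.prod_nonneg fun i _ => h0 i _
        exact Fintype.mem_piFinset.2 fun i => Finset.mem_image_of_mem (fun x => x i) hx
    _ = ∏ i, ∑ a ∈ u.image fun x => x i, f i a := (Finset.prod_univ_sum _ _).symm
    _ ≤ _ := Finset.prod_le_prod (fun i _ => Finset.sum_nonneg fun a _ => h0 i a)
        fun i _ => (hf i).sum_le_tsum _ fun a _ => h0 i a

/-- The summand of the Siegel Eisenstein series. -/
def cosetTerm (k : ℕ) (q : Quotient (QuotientGroup.rightRel (siegelParabolic ι)))
    (τ : Matrix ι ι ℂ) : ℂ := autFactor q.out τ ^ (-(k : ℤ))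

/-- The coset of an element of `Sp(ℤ)` modulo the Siegel parabolic. -/
def coset (M : symplecticGroup ι ℤ) : Quotient (QuotientGroup.rightRel (siegelParabolic ι)) :=
  Quotient.mk _ M

theorem coset_eq_iff {M N : symplecticGroup ι ℤ} :
    coset M = coset N ↔ N * M⁻¹ ∈ siegelParabolic ι := by
  rw [coset, coset, Quotient.eq, QuotientGroup.rightRel_apply]

theorem coset_out (q : Quotient (QuotientGroup.rightRel (siegelParabolic ι))) :
    coset q.out = q := Quotient.out_eq q

theorem coset_mul_of_mem {P : symplecticGroup ι ℤ} (hP : P ∈ siegelParabolic ι)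
    (M : symplecticGroup ι ℤ) : coset (P * M) = coset M := by
  rw [eq_comm, coset_eq_iff, mul_inv_cancel_right]
  exact hP

theorem cosetTerm_coset {k : ℕ} (hk : Even k) (M : symplecticGroup ι ℤ) (τ : Matrix ι ι ℂ) :
    cosetTerm k (coset M) τ = autFactor M τ ^ (-(k : ℤ)) := by
  refine autFactor_zpow_eq_of_rightRel hk ?_ τ
  exact QuotientGroup.rightRel_apply.2 (coset_eq_iff.1 (coset_out (coset M)))

/-- The element `diag (U⁻ᵀ, U)` of `Sp(ℤ)`. -/
def levi (U : Matrix ι ι ℤ) (hU : IsUnit U.det) : symplecticGroup ι ℤ :=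
  ⟨fromBlocks (U⁻¹)ᵀ 0 0 U, SymplecticGroup.fromBlocks_mem_iff.2 (by
    simp [transpose_transpose, nonsing_inv_mul _ hU])⟩

/-- The element `(1 N; 0 1)` of `Sp(ℤ)`, for symmetric `N`. -/
def unip (N : Matrix ι ι ℤ) (hN : N.IsSymm) : symplecticGroup ι ℤ :=
  ⟨fromBlocks 1 N 0 1, SymplecticGroup.fromBlocks_mem_iff.2 (by simp [hN.eq])⟩

theorem levi_mem (U : Matrix ι ι ℤ) (hU : IsUnit U.det) : levi U hU ∈ siegelParabolic ι := by
  change Matrix.toBlocks₂₁ (fromBlocks _ _ _ _) = 0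
  simp

theorem unip_mem (N : Matrix ι ι ℤ) (hN : N.IsSymm) : unip N hN ∈ siegelParabolic ι := by
  change Matrix.toBlocks₂₁ (fromBlocks _ _ _ _) = 0
  simp

theorem fromBlocks_blocks_eq_map (M : symplecticGroup ι ℤ) {A B C D : Matrix ι ι ℤ}
    (h : (M : Matrix (ι ⊕ ι) (ι ⊕ ι) ℤ) = fromBlocks A B C D) :
    blockA M = A.map Int.cast ∧ blockB M = B.map Int.cast ∧ blockC M = C.map Int.cast ∧
      blockD M = D.map Int.cast := by
  simp [blockA, blockB, blockC, blockD, h]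

theorem blocks_mul (M N : symplecticGroup ι ℤ) :
    blockA (M * N) = blockA M * blockA N + blockB M * blockC N ∧
    blockB (M * N) = blockA M * blockB N + blockB M * blockD N ∧
    blockC (M * N) = blockC M * blockA N + blockD M * blockC N ∧
    blockD (M * N) = blockC M * blockB N + blockD M * blockD N := by
  have h : ((M * N : symplecticGroup ι ℤ) : Matrix (ι ⊕ ι) (ι ⊕ ι) ℤ).map (Int.cast : ℤ → ℂ) =
      (M : Matrix (ι ⊕ ι) (ι ⊕ ι) ℤ).map (Int.cast : ℤ → ℂ) *
        (N : Matrix (ι ⊕ ι) (ι ⊕ ι) ℤ).map (Int.cast : ℤ → ℂ) := by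
    rw [Submonoid.coe_mul]
    exact Matrix.map_mul (f := Int.castRingHom ℂ)
  rw [map_eq_fromBlocks, map_eq_fromBlocks, map_eq_fromBlocks, fromBlocks_multiply,
    fromBlocks_inj] at h
  exact h

/-- The Gram matrix `C Cᵀ + D Dᵀ` of the lower rows. -/
def gram (M : symplecticGroup ι ℤ) : Matrix ι ι ℤ :=
  (M : Matrix (ι ⊕ ι) (ι ⊕ ι) ℤ).toBlocks₂₁ * ((M : Matrix (ι ⊕ ι) (ι ⊕ ι) ℤ).toBlocks₂₁)ᵀ +
    (M : Matrix (ι ⊕ ι) (ι ⊕ ι) ℤ).toBlocks₂₂ * ((M : Matrix (ι ⊕ ι) (ι ⊕ ι) ℤ).toBlocks₂₂)ᵀ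

/-- The cross terms of (Ci + D)(Ci + D)* cancel because C Dᵀ is symmetric. Thus the Gram matrix
controls the rows and the determinant of Ci + D. -/
theorem gram_map (M : symplecticGroup ι ℤ) :
    (gram M).map (Int.cast : ℤ → ℂ) = autMatrix M (Complex.I • 1) *
      (autMatrix M (Complex.I • 1))ᴴ := by
  have h1 : (gram M).map (Int.cast : ℤ → ℂ) =
      blockC M * (blockC M)ᵀ + blockD M * (blockD M)ᵀ := by
    ext i j
    simp [gram, blockC, blockD, Matrix.mul_apply]
  rw [h1]
  simp only [autMatrix, conjTranspose_add, blockC_conjTranspose,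
    blockD_conjTranspose, Matrix.mul_smul, Matrix.mul_one, Matrix.smul_mul, Matrix.add_mul, Matrix.mul_add,
    conjTranspose_smul, blockC_mul_blockD_transpose]
  simp [smul_smul]

/-- The value at v is |vC|² + |vD|², and the lower rows of an invertible matrix are independent. -/
theorem gram_isPosInt (M : symplecticGroup ι ℤ) : IsPosInt (gram M) := by
  refine ⟨?_, fun v hv => ?_⟩
  · simp [gram, IsSymm, transpose_mul]
  · set C := (M : Matrix (ι ⊕ ι) (ι ⊕ ι) ℤ).toBlocks₂₁ with hC
    set D := (M : Matrix (ι ⊕ ι) (ι ⊕ ι) ℤ).toBlocks₂₂ with hD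
    have h1 : v ⬝ᵥ gram M *ᵥ v = ∑ i, (v ᵥ* C) i ^ 2 + ∑ i, (v ᵥ* D) i ^ 2 := by
      rw [gram, ← hC, ← hD, add_mulVec, dotProduct_add, ← mulVec_mulVec, ← mulVec_mulVec,
        dotProduct_mulVec, dotProduct_mulVec v D, mulVec_transpose, mulVec_transpose]
      simp only [dotProduct, sq]
    rw [h1]
    by_contra hcon
    have h2 : 0 ≤ ∑ i, (v ᵥ* C) i ^ 2 := Finset.sum_nonneg fun i _ => sq_nonneg _
    have h3 : 0 ≤ ∑ i, (v ᵥ* D) i ^ 2 := Finset.sum_nonneg fun i _ => sq_nonneg _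
    have h4 : v ᵥ* C = 0 := by
      ext i
      simpa using (Finset.sum_eq_zero_iff_of_nonneg (fun i _ => sq_nonneg ((v ᵥ* C) i))).1
        (by omega) i (Finset.mem_univ i)
    have h5 : v ᵥ* D = 0 := by
      ext i
      simpa using (Finset.sum_eq_zero_iff_of_nonneg (fun i _ => sq_nonneg ((v ᵥ* D) i))).1
        (by omega) i (Finset.mem_univ i)
    have h6 : Sum.elim (0 : ι → ℤ) v ᵥ* (M : Matrix (ι ⊕ ι) (ι ⊕ ι) ℤ) = 0 := by
      rw [← fromBlocks_toBlocks (M : Matrix (ι ⊕ ι) (ι ⊕ ι) ℤ), vecMul_fromBlocks]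
      ext (i | i) <;> simp [← hC, ← hD, h4, h5]
    have h7 := congrArg (fun w => w ᵥ* ((M⁻¹ : symplecticGroup ι ℤ) : Matrix (ι ⊕ ι) (ι ⊕ ι) ℤ)) h6
    simp only [vecMul_vecMul, ← Submonoid.coe_mul, mul_inv_cancel, Submonoid.coe_one, vecMul_one,
      zero_vecMul] at h7
    refine hv ?_
    ext i
    simpa using congrFun h7 (Sum.inr i)

/-- Levi elements replace the Gram matrix by an equivalent form and unipotent ones leave it
unchanged. Hence the form can be reduced first and the real part translated afterwards. -/
theorem gram_levi_mul (U : Matrix ι ι ℤ) (hU : IsUnit U.det) (M : symplecticGroup ι ℤ) :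
    gram (levi U hU * M) = U * gram M * Uᵀ := by
  rw [gram, Submonoid.coe_mul, toBlocks₂₁_mul, toBlocks₂₂_mul]
  simp [levi, gram, transpose_mul, Matrix.mul_add, Matrix.add_mul, Matrix.mul_assoc]

theorem gram_unip_mul (N : Matrix ι ι ℤ) (hN : N.IsSymm) (M : symplecticGroup ι ℤ) :
    gram (unip N hN * M) = gram M := by
  rw [gram, Submonoid.coe_mul, toBlocks₂₁_mul, toBlocks₂₂_mul]
  simp [unip, gram]

/-- The numerator `A i + B` of the action on the base point. -/
def baseNum (M : symplecticGroup ι ℤ) : Matrix ι ι ℂ := Complex.I • blockA M + blockB M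

/-- The denominator `C i + D` of the action on the base point. -/
def baseDen (M : symplecticGroup ι ℤ) : Matrix ι ι ℂ := Complex.I • blockC M + blockD M

theorem baseDen_eq (M : symplecticGroup ι ℤ) : baseDen M = autMatrix M (Complex.I • 1) := by
  simp [baseDen, autMatrix]

/-- The image of the base point. -/
def basePoint (M : symplecticGroup ι ℤ) : Matrix ι ι ℂ := baseNum M * (baseDen M)⁻¹

theorem imGE_base : ImGE 1 (Complex.I • (1 : Matrix ι ι ℂ)) := by
  refine ⟨by simp [IsSymm], fun v => ?_⟩
  have : (Complex.I • (1 : Matrix ι ι ℂ)).map Complex.im = 1 := by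
    ext i j
    by_cases h : i = j <;> simp [Matrix.one_apply, h]
  rw [this, one_mulVec, one_mul]
  simp [dotProduct, sq]

theorem isUnit_det_baseDen (M : symplecticGroup ι ℤ) : IsUnit (baseDen M).det := by
  rw [baseDen_eq]
  exact isUnit_det_autMatrix M one_pos imGE_base

theorem basePoint_mul_baseDen (M : symplecticGroup ι ℤ) :
    basePoint M * baseDen M = baseNum M := by
  rw [basePoint, Matrix.mul_assoc, nonsing_inv_mul _ (isUnit_det_baseDen M), Matrix.mul_one]

theorem blockD_transpose_mul_blockA (M : symplecticGroup ι ℤ) :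
    (blockD M)ᵀ * blockA M = 1 + (blockB M)ᵀ * blockC M := by
  have := congrArg transpose (blockA_transpose_mul_blockD M)
  simpa [transpose_mul] using this

theorem basePoint_isSymm (M : symplecticGroup ι ℤ) : (basePoint M).IsSymm := by
  have hW := isUnit_det_baseDen M
  have hWt : IsUnit (baseDen M)ᵀ.det := by rwa [det_transpose]
  have h1 : (baseDen M)ᵀ * (basePoint M)ᵀ * baseDen M =
      (baseDen M)ᵀ * basePoint M * baseDen M := by
    rw [← transpose_mul, basePoint_mul_baseDen, Matrix.mul_assoc, basePoint_mul_baseDen]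
    simp only [baseNum, baseDen, transpose_add, transpose_smul, Matrix.add_mul, Matrix.mul_add,
      Matrix.smul_mul, Matrix.mul_smul, blockA_transpose_mul_blockC, blockB_transpose_mul_blockD,
      blockA_transpose_mul_blockD, blockD_transpose_mul_blockA, smul_add]
    abel
  exact (isUnit_iff_isUnit_det _).2 hWt |>.mul_left_cancel
    (((isUnit_iff_isUnit_det _).2 hW).mul_right_cancel h1)

/-- The transformation law Im(M·i) = (den*)⁻¹ den⁻¹, with denominators cleared. -/
theorem baseDen_conjTranspose_mul (M : symplecticGroup ι ℤ) :
    (baseDen M)ᴴ * (basePoint M - (basePoint M)ᴴ) * baseDen M = (2 * Complex.I) • 1 := by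
  have hA : (blockA M)ᴴ = (blockA M)ᵀ := conjTranspose_map_intCast _
  have hB : (blockB M)ᴴ = (blockB M)ᵀ := conjTranspose_map_intCast _
  rw [Matrix.mul_sub, Matrix.sub_mul, ← conjTranspose_mul, basePoint_mul_baseDen, Matrix.mul_assoc,
    basePoint_mul_baseDen]
  simp only [baseNum, baseDen, conjTranspose_add, conjTranspose_smul, Matrix.add_mul,
    Matrix.mul_add, Matrix.smul_mul, Matrix.mul_smul, hA, hB, blockC_conjTranspose,
    blockD_conjTranspose, blockA_transpose_mul_blockC, blockB_transpose_mul_blockD,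
    blockA_transpose_mul_blockD, blockD_transpose_mul_blockA, smul_add]
  simp only [Complex.star_def, Complex.conj_I, smul_smul]
  module

theorem basePoint_unip_mul (N : Matrix ι ι ℤ) (hN : N.IsSymm) (M : symplecticGroup ι ℤ) :
    basePoint (unip N hN * M) = basePoint M + N.map Int.cast := by
  obtain ⟨hA, hB, hC, hD⟩ := fromBlocks_blocks_eq_map (unip N hN) rfl
  obtain ⟨h1, h2, h3, h4⟩ := blocks_mul (unip N hN) M
  have h5 : baseDen (unip N hN * M) = baseDen M := by
    rw [baseDen, h3, h4, hC, hD]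
    simp [baseDen]
  have h6 : baseNum (unip N hN * M) = baseNum M + N.map Int.cast * baseDen M := by
    rw [baseNum, h1, h2, hA, hB]
    simp [baseDen, baseNum, Matrix.mul_add]
    abel
  rw [basePoint, h5, h6, Matrix.add_mul, Matrix.mul_assoc, mul_nonsing_inv _ (isUnit_det_baseDen M),
    Matrix.mul_one, basePoint]

/-- Each coset has a representative with reduced Gram matrix that maps the base point into the unit
cube horizontally. -/
theorem exists_reduced (ι : Type*) [Fintype ι] [DecidableEq ι] :
    ∃ K : ℤ, 0 < K ∧ ∀ q : Quotient (QuotientGroup.rightRel (siegelParabolic ι)),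
      ∃ M : symplecticGroup ι ℤ, coset M = q ∧ ∏ i, gram M i i ≤ K * (gram M).det ∧
        ∀ i j, (basePoint M i j).re ∈ Set.Ico (0 : ℝ) 1 := by
  obtain ⟨K, hK, h⟩ := hasReducedForms ι
  refine ⟨K, hK, fun q => ?_⟩
  obtain ⟨U, hU, hle⟩ := h (gram q.out) (gram_isPosInt _)
  set M := levi U hU * q.out with hM
  let N : Matrix ι ι ℤ := Matrix.of fun i j => -⌊(basePoint M i j).re⌋
  have hN : N.IsSymm := by
    ext i j
    simp [N, (basePoint_isSymm M).apply i j]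
  refine ⟨unip N hN * M, ?_, ?_, fun i j => ?_⟩
  · rw [coset_mul_of_mem (unip_mem N hN), hM, coset_mul_of_mem (levi_mem U hU), coset_out]
  · rw [gram_unip_mul, hM, gram_levi_mul]
    refine hle.trans_eq ?_
    rw [det_mul, det_mul, det_transpose, mul_right_comm U.det]
    rcases Int.isUnit_iff.1 hU with h | h <;> simp [h]
  · rw [basePoint_unip_mul]
    simp only [Matrix.add_apply, Matrix.map_apply, N, Matrix.of_apply, Complex.add_re,
      Complex.intCast_re]
    push_cast
    exact ⟨by linarith [Int.floor_le (basePoint M i j).re],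
      by linarith [Int.lt_floor_add_one (basePoint M i j).re]⟩

theorem norm_adjugate_le {N : Matrix ι ι ℂ} {x : ℝ} (h1 : 1 ≤ x) (hx : ∀ i j, ‖N i j‖ ≤ x)
    (i j : ι) : ‖N.adjugate i j‖ ≤ (Fintype.card ι).factorial * x ^ Fintype.card ι := by
  rw [adjugate_apply]
  refine norm_det_le fun k l => ?_
  rw [updateRow_apply]
  split_ifs
  · rw [Pi.single_apply]
    split_ifs <;> simp <;> linarith
  · exact hx k l

theorem norm_mul_apply_le {κ : Type*} [Fintype κ] {M N : Matrix κ κ ℂ} {x y : ℝ}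
    (hx : ∀ i j, ‖M i j‖ ≤ x) (hy : ∀ i j, ‖N i j‖ ≤ y) (i j : κ) :
    ‖(M * N) i j‖ ≤ Fintype.card κ * (x * y) := by
  rw [Matrix.mul_apply]
  refine (norm_sum_le _ _).trans ((Finset.sum_le_card_nsmul _ _ (x * y) fun l _ => ?_).trans ?_)
  · rw [norm_mul]
    exact mul_le_mul (hx i l) (hy l j) (norm_nonneg _) ((norm_nonneg _).trans (hx i l))
  · simp [nsmul_eq_mul]

theorem sum_norm_baseDen_sq (M : symplecticGroup ι ℤ) (i : ι) :
    ∑ j, ‖baseDen M i j‖ ^ 2 = gram M i i := by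
  have h1 := congrFun (congrFun (gram_map M) i) i
  rw [← baseDen_eq, Matrix.map_apply, Matrix.mul_apply] at h1
  have h2 := congrArg Complex.re h1
  simp only [Complex.intCast_re, Complex.re_sum, conjTranspose_apply] at h2
  rw [h2]
  refine Finset.sum_congr rfl fun j _ => ?_
  rw [Complex.star_def, Complex.mul_conj, Complex.ofReal_re, Complex.normSq_eq_norm_sq]

theorem norm_det_baseDen_sq (M : symplecticGroup ι ℤ) :
    ‖(baseDen M).det‖ ^ 2 = (gram M).det := by
  have h1 := congrArg det (gram_map M)
  rw [← baseDen_eq, det_mul, det_conjTranspose, Complex.star_def, Complex.mul_conj] at h1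
  have h2 : ((gram M).map (Int.cast : ℤ → ℂ)).det = (((gram M).det : ℤ) : ℂ) :=
    ((Int.castRingHom ℂ).map_det _).symm
  rw [h2] at h1
  have h3 := congrArg Complex.re h1
  rw [Complex.intCast_re, Complex.ofReal_re, Complex.normSq_eq_norm_sq] at h3
  exact h3.symm

theorem gram_diag_pos (M : symplecticGroup ι ℤ) (i : ι) : 0 < gram M i i := by
  simpa using (gram_isPosInt M).2 (Pi.single i 1) (by simp)

/-! ### Counting reduced representatives -/

/-- Dyadic scales of the lower rows of `M`. -/
def scale (M : symplecticGroup ι ℤ) (i : ι) : ℕ := Nat.log 2 (gram M i i).toNat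

theorem two_pow_scale_le (M : symplecticGroup ι ℤ) (i : ι) :
    (2 : ℝ) ^ scale M i ≤ gram M i i ∧ (gram M i i : ℝ) ≤ 2 * 2 ^ scale M i := by
  have h0 := gram_diag_pos M i
  have h1 : ((gram M i i).toNat : ℤ) = gram M i i := Int.toNat_of_nonneg h0.le
  have h2 : (gram M i i).toNat ≠ 0 := by omega
  have h3 := Nat.pow_log_le_self 2 h2
  have h4 := (Nat.lt_pow_succ_log_self (b := 2) (by norm_num) (gram M i i).toNat).le
  have h5 : (gram M i i : ℝ) = ((gram M i i).toNat : ℝ) := by exact_mod_cast h1.symm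
  rw [h5, scale]
  constructor
  · exact_mod_cast h3
  · rw [pow_succ'] at h4
    exact_mod_cast h4

/-- The square root `2 ^ (m / 2)`. -/
def scl (m : ℕ) : ℝ := Real.sqrt 2 ^ m

theorem scl_pos (m : ℕ) : 0 < scl m := pow_pos (Real.sqrt_pos.2 two_pos) m

theorem scl_sq (m : ℕ) : scl m ^ 2 = 2 ^ m := by
  rw [scl, ← pow_mul, mul_comm, pow_mul, Real.sq_sqrt two_pos.le]

theorem one_le_scl (m : ℕ) : 1 ≤ scl m := by
  refine one_le_pow₀ ?_
  rw [Real.one_le_sqrt]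
  norm_num

/-- The scales as a complex diagonal matrix. -/
def sclMatrix (m : ι → ℕ) : Matrix ι ι ℂ := diagonal fun i => (scl (m i) : ℂ)

/-- See `sclMatrix`. -/
def sclMatrixInv (m : ι → ℕ) : Matrix ι ι ℂ := diagonal fun i => ((scl (m i))⁻¹ : ℂ)

theorem sclMatrix_mul_inv (m : ι → ℕ) : sclMatrix m * sclMatrixInv m = 1 := by
  rw [sclMatrix, sclMatrixInv, diagonal_mul_diagonal, ← diagonal_one]
  congr 1
  ext i
  rw [mul_inv_cancel₀]
  exact_mod_cast (scl_pos _).ne'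

theorem sclMatrixInv_mul (m : ι → ℕ) : sclMatrixInv m * sclMatrix m = 1 := by
  rw [mul_eq_one_comm, sclMatrix_mul_inv]

/-- The rescaled real parts of the image of the base point, rounded down. -/
def roundRe (M : symplecticGroup ι ℤ) : Matrix ι ι ℕ := Matrix.of fun i j =>
  ⌊scl (scale M i) * (basePoint M i j).re * scl (scale M j)⌋₊

theorem roundRe_isSymm (M : symplecticGroup ι ℤ) : (roundRe M).IsSymm := by
  ext i j
  simp only [roundRe, transpose_apply, Matrix.of_apply, (basePoint_isSymm M).apply]
  congr 1
  ring

/-- A real symplectic matrix determined by the scales `m` and a symmetric matrix `F`. -/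
def normalizer (m : ι → ℕ) (F : Matrix ι ι ℕ) : Matrix (ι ⊕ ι) (ι ⊕ ι) ℂ :=
  fromBlocks (sclMatrix m) (-(F.map (Nat.cast : ℕ → ℂ) * sclMatrixInv m)) 0 (sclMatrixInv m)

theorem normalizer_mem (m : ι → ℕ) {F : Matrix ι ι ℕ} (hF : F.IsSymm) :
    normalizer m F ∈ symplecticGroup ι ℂ := by
  have h1 : (sclMatrix m)ᵀ = sclMatrix m := diagonal_transpose _
  have h2 : (sclMatrixInv m)ᵀ = sclMatrixInv m := diagonal_transpose _
  have h3 : (F.map (Nat.cast : ℕ → ℂ))ᵀ = F.map (Nat.cast : ℕ → ℂ) := by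
    rw [← transpose_map, hF.eq]
  refine SymplecticGroup.fromBlocks_mem_iff.2 ⟨by simp, ?_, ?_⟩
  · simp [transpose_mul, h2, h3, Matrix.mul_assoc]
  · simp [h1, sclMatrix_mul_inv]

theorem norm_re_im_le {κ : Type*} {M N : Matrix κ κ ℂ} (hM : ∀ i j, (M i j).im = 0)
    (hN : ∀ i j, (N i j).im = 0) (i j : κ) :
    ‖M i j‖ ≤ ‖(Complex.I • M + N) i j‖ ∧ ‖N i j‖ ≤ ‖(Complex.I • M + N) i j‖ := by
  have h1 : M i j = ((M i j).re : ℂ) := Complex.ext rfl (by simp [hM])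
  have h2 : N i j = ((N i j).re : ℂ) := Complex.ext rfl (by simp [hN])
  have h3 : ((Complex.I • M + N) i j).im = (M i j).re := by simp [hN]
  have h4 : ((Complex.I • M + N) i j).re = (N i j).re := by simp [hM]
  constructor
  · rw [h1, Complex.norm_real, Real.norm_eq_abs, ← h3]
    exact Complex.abs_im_le_norm _
  · rw [h2, Complex.norm_real, Real.norm_eq_abs, ← h4]
    exact Complex.abs_re_le_norm _

/-- Row i of Ci + D has squared length `gram M i i`, which is at most twice the square of the scale.
-/
theorem scaled_baseDen_le (M : symplecticGroup ι ℤ) (i j : ι) :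
    ‖(sclMatrixInv (scale M) * baseDen M) i j‖ ≤ 2 := by
  rw [sclMatrixInv, diagonal_mul, norm_mul, norm_inv, Complex.norm_real, Real.norm_eq_abs,
    abs_of_pos (scl_pos _), inv_mul_le_iff₀ (scl_pos _)]
  have h1 : ‖baseDen M i j‖ ^ 2 ≤ gram M i i := by
    rw [← sum_norm_baseDen_sq]
    exact Finset.single_le_sum (f := fun j => ‖baseDen M i j‖ ^ 2) (fun _ _ => sq_nonneg _)
      (Finset.mem_univ j)
  have h2 := (two_pow_scale_le M i).2
  rw [← scl_sq] at h2
  have h3 := scl_pos (scale M i)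
  refine abs_le_of_sq_le_sq' ?_ (by positivity) |>.2
  nlinarith

/-- The only place where reducedness enters: the product of the row scales is no larger than the
determinant, up to K. Squaring would give √K, and K ≥ 1 permits K. -/
theorem prod_scl_le {K : ℤ} (hK : 0 < K) {M : symplecticGroup ι ℤ}
    (hM : ∏ i, gram M i i ≤ K * (gram M).det) :
    ∏ i, scl (scale M i) ≤ K * ‖(baseDen M).det‖ := by
  have h1 : (∏ i, scl (scale M i)) ^ 2 ≤ K * ‖(baseDen M).det‖ ^ 2 := by
    rw [norm_det_baseDen_sq, ← Finset.prod_pow]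
    refine le_trans (Finset.prod_le_prod (fun i _ => by positivity) fun i _ => ?_)
      (b := ∏ i, (gram M i i : ℝ)) ?_
    · rw [scl_sq]
      exact (two_pow_scale_le M i).1
    · exact_mod_cast hM
  have hK1 : (1 : ℝ) ≤ K := by exact_mod_cast hK
  refine abs_le_of_sq_le_sq' (h1.trans ?_) (by positivity) |>.2
  rw [mul_pow]
  gcongr
  nlinarith

/-- The entries of a reduced element of `Sp(ℤ)` are uniformly bounded after normalization. -/
theorem exists_norm_normalizer_mul_le (ι : Type*) [Fintype ι] [DecidableEq ι] {K : ℤ}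
    (hK : 0 < K) : ∃ R : ℝ, ∀ M : symplecticGroup ι ℤ, ∏ i, gram M i i ≤ K * (gram M).det →
      (∀ i j, (basePoint M i j).re ∈ Set.Ico (0 : ℝ) 1) → ∀ i j,
      ‖(normalizer (scale M) (roundRe M) *
        (M : Matrix (ι ⊕ ι) (ι ⊕ ι) ℤ).map (Int.cast : ℤ → ℂ)) i j‖ ≤ R := by
  set g : ℝ := (Fintype.card ι : ℝ)
  -- Bound for the entries of W⁻¹ by Cramer's rule: adjugate entries are at most n!·2ⁿ, and |det W|
  -- ≥ 1/K by reducedness.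
  set R₁ : ℝ := K * ((Fintype.card ι).factorial * 2 ^ Fintype.card ι) with hR₁
  -- The summand 2 bounds the lower rows, the other one the upper rows.
  refine ⟨2 + g * ((1 + g * (R₁ * R₁)) * 2), fun M hM hre => ?_⟩
  set a := sclMatrix (scale M) with ha
  set b := sclMatrixInv (scale M) with hb
  have hab : a * b = 1 := sclMatrix_mul_inv _
  have hba : b * a = 1 := sclMatrixInv_mul _
  set F := (roundRe M).map (Nat.cast : ℕ → ℂ) with hF
  set W := b * baseDen M with hW
  set T := a * basePoint M * a with hT
  have hKR : (0 : ℝ) < K := by exact_mod_cast hK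
  have hW2 : ∀ i j, ‖W i j‖ ≤ 2 := scaled_baseDen_le M
  have hdet : 1 ≤ K * ‖W.det‖ := by
    have h1 : W.det = (∏ i, ((scl (scale M i))⁻¹ : ℂ)) * (baseDen M).det := by
      rw [hW, det_mul, hb, sclMatrixInv, det_diagonal]
    have h2 : ‖W.det‖ = (∏ i, scl (scale M i))⁻¹ * ‖(baseDen M).det‖ := by
      rw [h1, norm_mul, norm_prod, ← Finset.prod_inv_distrib]
      congr 1
      refine Finset.prod_congr rfl fun i _ => ?_
      rw [norm_inv, Complex.norm_real, Real.norm_eq_abs, abs_of_pos (scl_pos _)]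
    have h3 : 0 < ∏ i, scl (scale M i) := Finset.prod_pos fun i _ => scl_pos _
    rw [h2, mul_left_comm, le_inv_mul_iff₀ h3, mul_one]
    exact prod_scl_le hK hM
  have hdet0 : W.det ≠ 0 := by
    intro h0
    rw [h0, norm_zero, mul_zero] at hdet
    linarith
  have hWinv : ∀ i j, ‖W⁻¹ i j‖ ≤ R₁ := by
    intro i j
    rw [Matrix.inv_def, Matrix.smul_apply, smul_eq_mul, norm_mul, Ring.inverse_eq_inv', norm_inv]
    refine mul_le_mul ?_ (norm_adjugate_le one_le_two hW2 i j) (norm_nonneg _) hKR.le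
    rw [inv_le_comm₀ (norm_pos_iff.2 hdet0) hKR, ← one_div, div_le_iff₀ hKR]
    linarith
  have hTsymm : ∀ i j, T j i = T i j := by
    intro i j
    simp only [hT, ha, sclMatrix, mul_diagonal, diagonal_mul, (basePoint_isSymm M).apply i j]
    ring
  have hTim : ∀ i j, |(T i j).im| ≤ g * (R₁ * R₁) := by
    intro i j
    have haH : aᴴ = a := by
      rw [ha, sclMatrix, diagonal_conjTranspose]
      congr 1
      ext i
      simp
    have hbH : bᴴ = b := by
      rw [hb, sclMatrixInv, diagonal_conjTranspose]
      congr 1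
      ext i
      simp
    -- The imaginary part formula survives the rescaling, so Im T = (W*)⁻¹W⁻¹ is bounded through
    -- W⁻¹.
    have h1 : Wᴴ * (T - Tᴴ) * W = (2 * Complex.I) • 1 := by
      rw [← baseDen_conjTranspose_mul M]
      have h2 : T - Tᴴ = a * (basePoint M - (basePoint M)ᴴ) * a := by
        rw [hT, conjTranspose_mul, conjTranspose_mul, haH, Matrix.mul_sub, Matrix.sub_mul,
          Matrix.mul_assoc a (basePoint M)ᴴ a]
      rw [h2, hW, conjTranspose_mul, hbH]
      calc (baseDen M)ᴴ * b * (a * (basePoint M - (basePoint M)ᴴ) * a) * (b * baseDen M) =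
          (baseDen M)ᴴ * (b * a) * (basePoint M - (basePoint M)ᴴ) * (a * b) * baseDen M := by
            simp only [Matrix.mul_assoc]
        _ = _ := by rw [hab, hba, Matrix.mul_one, Matrix.mul_one]
    have hWu : IsUnit W.det := isUnit_iff_ne_zero.2 hdet0
    have hWu' : IsUnit (Wᴴ).det := by
      rw [det_conjTranspose]
      exact hWu.star
    have h3 : T - Tᴴ = (2 * Complex.I) • ((Wᴴ)⁻¹ * W⁻¹) := by
      calc T - Tᴴ = (Wᴴ)⁻¹ * (Wᴴ * (T - Tᴴ) * W) * W⁻¹ := by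
            rw [Matrix.mul_assoc, Matrix.mul_assoc, mul_nonsing_inv _ hWu, Matrix.mul_one,
              ← Matrix.mul_assoc, nonsing_inv_mul _ hWu', Matrix.one_mul]
        _ = _ := by rw [h1, Matrix.mul_smul, Matrix.smul_mul, Matrix.mul_one]
    have h4 : (T - Tᴴ) i j = (2 * Complex.I) * ((T i j).im : ℂ) := by
      rw [Matrix.sub_apply, conjTranspose_apply, hTsymm, Complex.star_def, Complex.sub_conj]
      push_cast
      ring
    rw [h3, Matrix.smul_apply, smul_eq_mul] at h4
    have h5 := mul_left_cancel₀ (by simp) h4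
    rw [← Real.norm_eq_abs, ← Complex.norm_real, ← h5]
    refine norm_mul_apply_le (fun i j => ?_) hWinv i j
    rw [← conjTranspose_nonsing_inv, conjTranspose_apply, norm_star]
    exact hWinv j i
  -- F is the real part of T rounded down, so only a fractional part and the bounded imaginary part
  -- remain.
  have hTF : ∀ i j, ‖(T - F) i j‖ ≤ 1 + g * (R₁ * R₁) := by
    intro i j
    have h1 : (T i j).re = scl (scale M i) * (basePoint M i j).re * scl (scale M j) := by
      simp [hT, ha, sclMatrix]
    have h2 : 0 ≤ (T i j).re := by
      rw [h1]
      have := (hre i j).1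
      have := scl_pos (scale M i)
      have := scl_pos (scale M j)
      positivity
    have h3 : F i j = (⌊(T i j).re⌋₊ : ℂ) := by
      simp [hF, roundRe, h1]
    refine (Complex.norm_le_abs_re_add_abs_im _).trans (add_le_add ?_ ?_)
    · rw [Matrix.sub_apply, h3, Complex.sub_re, Complex.natCast_re, abs_le]
      constructor <;> linarith [Nat.floor_le h2, Nat.lt_floor_add_one (T i j).re]
    · rw [Matrix.sub_apply, h3, Complex.sub_im, Complex.natCast_im, sub_zero]
      exact hTim i j
  have hup : ∀ i j, ‖((T - F) * W) i j‖ ≤ g * ((1 + g * (R₁ * R₁)) * 2) :=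
    norm_mul_apply_le hTF hW2
  -- The upper rows (P Q) of the normalized matrix satisfy iP + Q = (T - F)W. As P and Q are real, a
  -- bound for iP + Q bounds both.
  have hnum : (T - F) * W = Complex.I • (a * blockA M + -(F * b) * blockC M) +
      (a * blockB M + -(F * b) * blockD M) := by
    have h1 : T * W = a * baseNum M := by
      rw [hT, hW, ← basePoint_mul_baseDen]
      calc a * basePoint M * a * (b * baseDen M) = a * basePoint M * (a * b) * baseDen M := by
            simp only [Matrix.mul_assoc]
        _ = _ := by rw [hab, Matrix.mul_one, Matrix.mul_assoc]
    rw [Matrix.sub_mul, h1, hW, baseNum, baseDen]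
    simp only [Matrix.mul_add, Matrix.mul_smul, smul_add, Matrix.neg_mul, Matrix.mul_assoc]
    module
  have hden : W = Complex.I • (b * blockC M) + b * blockD M := by
    rw [hW, baseDen, Matrix.mul_add, Matrix.mul_smul]
  have hblk : normalizer (scale M) (roundRe M) *
      (M : Matrix (ι ⊕ ι) (ι ⊕ ι) ℤ).map (Int.cast : ℤ → ℂ) =
      fromBlocks (a * blockA M + -(F * b) * blockC M) (a * blockB M + -(F * b) * blockD M)
        (b * blockC M) (b * blockD M) := by
    rw [map_eq_fromBlocks, normalizer, fromBlocks_multiply, ← ha, ← hb, ← hF, Matrix.zero_mul,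
      Matrix.zero_mul, zero_add, zero_add]
  have hreal : ∀ (N : Matrix ι ι ℤ) (i j : ι), (N.map (Int.cast : ℤ → ℂ) i j).im = 0 := by
    intro N i j
    simp
  have hb0 : ∀ (N : Matrix ι ι ℤ) (i j : ι), ((b * N.map (Int.cast : ℤ → ℂ)) i j).im = 0 := by
    intro N i j
    rw [hb, sclMatrixInv, diagonal_mul, ← Complex.ofReal_inv, Complex.im_ofReal_mul, hreal,
      mul_zero]
  have ha0 : ∀ (N : Matrix ι ι ℤ) (i j : ι), ((a * N.map (Int.cast : ℤ → ℂ)) i j).im = 0 := by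
    intro N i j
    rw [ha, sclMatrix, diagonal_mul, Complex.im_ofReal_mul, hreal, mul_zero]
  have hF0 : ∀ (N : Matrix ι ι ℤ) (i j : ι),
      ((-(F * b) * N.map (Int.cast : ℤ → ℂ)) i j).im = 0 := by
    intro N i j
    rw [Matrix.neg_mul, Matrix.mul_assoc, Matrix.neg_apply, Complex.neg_im, Matrix.mul_apply,
      Complex.im_sum, neg_eq_zero]
    refine Finset.sum_eq_zero fun l _ => ?_
    rw [hF, Matrix.map_apply, Complex.mul_im, hb0]
    simp
  have h1 := norm_re_im_le (M := a * blockA M + -(F * b) * blockC M)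
    (N := a * blockB M + -(F * b) * blockD M)
    (fun i j => by rw [Matrix.add_apply, Complex.add_im, blockA, blockC, ha0, hF0, add_zero])
    (fun i j => by rw [Matrix.add_apply, Complex.add_im, blockB, blockD, ha0, hF0, add_zero])
  have h2 := norm_re_im_le (M := b * blockC M) (N := b * blockD M) (hb0 _) (hb0 _)
  rw [← hnum] at h1
  rw [← hden] at h2
  have hpos : 0 ≤ g * ((1 + g * (R₁ * R₁)) * 2) := by
    have : 0 ≤ R₁ * R₁ := mul_self_nonneg _
    positivity
  rw [hblk]
  rintro (i | i) (j | j)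
  · exact (h1 i j).1.trans ((hup i j).trans (by linarith))
  · exact (h1 i j).2.trans ((hup i j).trans (by linarith))
  · exact (h2 i j).1.trans ((hW2 i j).trans (by linarith))
  · exact (h2 i j).2.trans ((hW2 i j).trans (by linarith))

/-- Pairs of indices that are ordered by an enumeration of the index type. -/
abbrev OrderedPair (ι : Type*) [Fintype ι] : Type _ :=
  {p : ι × ι // Fintype.equivFin ι p.1 ≤ Fintype.equivFin ι p.2}

/-- Among the pairs i ≤ j each index fills g + 1 slots, the diagonal pair counting twice. This is
the g + 1 in the condition on k. -/
theorem prod_orderedPair (a : ι → ℝ) :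
    ∏ p : OrderedPair ι, a p.1.1 * a p.1.2 = ∏ i, a i ^ (Fintype.card ι + 1) := by
  have h1 : ∏ p : OrderedPair ι, a p.1.1 * a p.1.2 =
      ∏ i, ∏ j, if Fintype.equivFin ι i ≤ Fintype.equivFin ι j then a i * a j else 1 := by
    rw [← Fintype.prod_prod_type']
    rw [← Finset.prod_filter]
    exact (Finset.prod_subtype _ (by simp) fun p : ι × ι => a p.1 * a p.2).symm
  have h2 : ∀ i j, (if Fintype.equivFin ι i ≤ Fintype.equivFin ι j then a i * a j else 1) =
      (if Fintype.equivFin ι i ≤ Fintype.equivFin ι j then a i else 1) *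
      (if Fintype.equivFin ι i ≤ Fintype.equivFin ι j then a j else 1) := by
    intro i j
    split_ifs <;> simp
  simp only [h1, h2, Finset.prod_mul_distrib]
  rw [Finset.prod_comm (f := fun i j =>
    if Fintype.equivFin ι i ≤ Fintype.equivFin ι j then a j else 1)]
  simp only [← Finset.prod_mul_distrib]
  refine Finset.prod_congr rfl fun i _ => ?_
  have h3 : ∀ j, ((if Fintype.equivFin ι i ≤ Fintype.equivFin ι j then a i else 1) *
      (if Fintype.equivFin ι j ≤ Fintype.equivFin ι i then a i else 1)) =
      a i * if i = j then a i else 1 := by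
    intro j
    rcases lt_trichotomy (Fintype.equivFin ι i) (Fintype.equivFin ι j) with h | h | h
    · have : i ≠ j := fun h0 => by simp [h0] at h
      simp [h.le, h.not_ge, this]
    · have : i = j := (Fintype.equivFin ι).injective h
      simp [this]
    · have : i ≠ j := fun h0 => by simp [h0] at h
      simp [h.le, h.not_ge, this]
  simp only [h3, Finset.prod_mul_distrib, Finset.prod_const, Finset.card_univ, Finset.prod_ite_eq,
    Finset.mem_univ, if_true, pow_succ]

/-- A product of geometric series of ratio √2^(g+1-k). -/
theorem summable_scl {k : ℕ} (hk : Fintype.card ι + 1 < k) :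
    Summable fun m : ι → ℕ => ∏ i, scl (m i) ^ (Fintype.card ι + 1) * (scl (m i) ^ k)⁻¹ := by
  refine summable_pi_prod (f := fun _ m => scl m ^ (Fintype.card ι + 1) * (scl m ^ k)⁻¹)
    (fun _ m => by have := scl_pos m; positivity) fun _ => ?_
  have h2 : (1 : ℝ) < Real.sqrt 2 := by
    rw [Real.lt_sqrt zero_le_one]
    norm_num
  have h0 : (0 : ℝ) < Real.sqrt 2 := one_pos.trans h2
  have h1 : ∀ m, scl m ^ (Fintype.card ι + 1) * (scl m ^ k)⁻¹ =
      (Real.sqrt 2 ^ (Fintype.card ι + 1) * (Real.sqrt 2 ^ k)⁻¹) ^ m := by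
    intro m
    rw [scl, mul_pow, inv_pow, pow_right_comm, pow_right_comm _ m k]
  simp only [h1]
  refine summable_geometric_of_lt_one (by positivity) ?_
  rw [mul_inv_lt_iff₀ (by positivity), one_mul]
  exact pow_lt_pow_right₀ h2 hk

/-- The weights of scales and rounded real parts. -/
def indexWeight (ι : Type*) [Fintype ι] (k : ℕ) (x : (ι → ℕ) × (OrderedPair ι → ℕ)) : ℝ :=
  if ∀ p, x.2 p ≤ scl (x.1 p.1.1) * scl (x.1 p.1.2) then ∏ i, (scl (x.1 i) ^ k)⁻¹ else 0

theorem indexWeight_nonneg (k : ℕ) : 0 ≤ indexWeight ι k := by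
  intro x
  rw [indexWeight]
  split_ifs
  · exact Finset.prod_nonneg fun i _ => by have := scl_pos (x.1 i); positivity
  · exact le_rfl

/-- For fixed scales the admissible roundings form a box; its size times the weight is, up to a
constant, the summand of `summable_scl`. -/
theorem summable_indexWeight {k : ℕ} (hk : Fintype.card ι + 1 < k) :
    Summable (indexWeight ι k) := by
  classical
  let s : (ι → ℕ) → Finset (OrderedPair ι → ℕ) := fun m =>
    Fintype.piFinset fun p => Finset.range (⌊scl (m p.1.1) * scl (m p.1.2)⌋₊ + 1)
  have hs : ∀ m F, F ∈ s m ↔ ∀ p, (F p : ℝ) ≤ scl (m p.1.1) * scl (m p.1.2) := by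
    intro m F
    simp only [s, Fintype.mem_piFinset, Finset.mem_range, Nat.lt_succ_iff]
    refine forall_congr' fun p => ?_
    rw [Nat.le_floor_iff (mul_pos (scl_pos _) (scl_pos _)).le]
  have hzero : ∀ m, ∀ F ∉ s m, indexWeight ι k (m, F) = 0 := by
    intro m F hF
    rw [hs] at hF
    simp only [indexWeight, if_neg hF]
  rw [summable_prod_of_nonneg (indexWeight_nonneg k)]
  refine ⟨fun m => summable_of_ne_finset_zero (hzero m), ?_⟩
  refine Summable.of_nonneg_of_le (fun m => tsum_nonneg fun F => indexWeight_nonneg k _)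
    (fun m => ?_) ((summable_scl hk).mul_left (∏ _p : OrderedPair ι, (2 : ℝ)))
  rw [tsum_eq_sum (hzero m)]
  have h1 : ∀ F ∈ s m, indexWeight ι k (m, F) = ∏ i, (scl (m i) ^ k)⁻¹ := by
    intro F hF
    rw [hs] at hF
    simp only [indexWeight, if_pos hF]
  rw [Finset.sum_congr rfl h1, Finset.sum_const, nsmul_eq_mul, Finset.prod_mul_distrib,
    ← prod_orderedPair, ← mul_assoc, ← Finset.prod_mul_distrib, Fintype.card_piFinset]
  refine mul_le_mul_of_nonneg_right ?_
    (Finset.prod_nonneg fun i _ => by have := scl_pos (m i); positivity)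
  push_cast
  -- Each side has ⌊x⌋ + 1 ≤ 2x points, because x ≥ 1.
  refine Finset.prod_le_prod (fun p _ => by positivity) fun p _ => ?_
  have h2 := Nat.floor_le (mul_pos (scl_pos (m p.1.1)) (scl_pos (m p.1.2))).le
  have h3 := one_le_mul_of_one_le_of_one_le (one_le_scl (m p.1.1)) (one_le_scl (m p.1.2))
  rw [Finset.card_range]
  push_cast
  linarith

/-- Cosets are injected into pairs of an index (scales and roundings) and a point of a finite set;
the summand is bounded by the weight of the index. -/
theorem summable_cosetTerm_base {k : ℕ} (hk : Even k) (hk' : Fintype.card ι + 1 < k) :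
    Summable fun q : Quotient (QuotientGroup.rightRel (siegelParabolic ι)) =>
      ‖cosetTerm k q (Complex.I • 1)‖ := by
  classical
  obtain ⟨K, hK, hred⟩ := exists_reduced ι
  choose M hMq hM hre using hred
  obtain ⟨R, hR⟩ := exists_norm_normalizer_mul_le ι hK
  let idx : Quotient (QuotientGroup.rightRel (siegelParabolic ι)) →
      (ι → ℕ) × (OrderedPair ι → ℕ) := fun q =>
    (scale (M q), fun p => roundRe (M q) p.1.1 p.1.2)
  have hidx : ∀ q q', idx q = idx q' → scale (M q) = scale (M q') ∧
      roundRe (M q) = roundRe (M q') := by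
    intro q q' h
    refine ⟨congrArg Prod.fst h, ?_⟩
    have h2 : ∀ i j, Fintype.equivFin ι i ≤ Fintype.equivFin ι j →
        roundRe (M q) i j = roundRe (M q') i j := fun i j hij =>
      congrFun (congrArg Prod.snd h) ⟨(i, j), hij⟩
    ext i j
    rcases le_total (Fintype.equivFin ι i) (Fintype.equivFin ι j) with hij | hij
    · exact h2 i j hij
    · rw [← (roundRe_isSymm (M q)).apply, ← (roundRe_isSymm (M q')).apply]
      exact h2 j i hij
  have : Nonempty (Quotient (QuotientGroup.rightRel (siegelParabolic ι))) := ⟨coset 1⟩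
  let sec := Function.invFun idx
  have hsec : ∀ q, idx (sec (idx q)) = idx q := fun q => Function.invFun_eq ⟨q, rfl⟩
  -- M is compared with a fixed M₀ of the same index. Since M₀ᵀJ is invertible, this integral matrix
  -- determines M.
  let N : Quotient (QuotientGroup.rightRel (siegelParabolic ι)) → (ι ⊕ ι → ι ⊕ ι → ℤ) := fun q =>
    ((M (sec (idx q)) : Matrix (ι ⊕ ι) (ι ⊕ ι) ℤ))ᵀ * J ι ℤ * (M q : Matrix (ι ⊕ ι) (ι ⊕ ι) ℤ)
  set g2 : ℝ := (Fintype.card (ι ⊕ ι) : ℝ)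
  set R' : ℤ := ⌈g2 * ((g2 * (R * 1)) * R)⌉ with hR'
  have hN : ∀ q, N q ∈ Set.Icc (fun _ _ => -R') (fun _ _ => R') := by
    intro q
    obtain ⟨h1, h2⟩ := hidx _ _ (hsec q)
    set G := normalizer (scale (M q)) (roundRe (M q)) with hG
    -- Both elements have the same normalizer G, which is symplectic, so M₀ᵀJM = (GM₀)ᵀJ(GM) is
    -- bounded.
    have hGm : Gᵀ * J ι ℂ * G = J ι ℂ :=
      SymplecticGroup.mem_iff'.1 (normalizer_mem _ (roundRe_isSymm _))
    set c₀ := (M (sec (idx q)) : Matrix (ι ⊕ ι) (ι ⊕ ι) ℤ).map (Int.cast : ℤ → ℂ) with hc₀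
    set c := (M q : Matrix (ι ⊕ ι) (ι ⊕ ι) ℤ).map (Int.cast : ℤ → ℂ) with hc
    have h3 : ∀ i j, ((N q i j : ℤ) : ℂ) = ((G * c₀)ᵀ * J ι ℂ * (G * c)) i j := by
      have h4 : (G * c₀)ᵀ * J ι ℂ * (G * c) = c₀ᵀ * J ι ℂ * c := by
        calc (G * c₀)ᵀ * J ι ℂ * (G * c) = c₀ᵀ * (Gᵀ * J ι ℂ * G) * c := by
              rw [transpose_mul]
              simp only [Matrix.mul_assoc]
          _ = _ := by rw [hGm]
      have h5 : Matrix.map (N q) (Int.castRingHom ℂ) = c₀ᵀ * J ι ℂ * c := by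
        rw [← map_J _ (Int.castRingHom ℂ)]
        simp only [N, Matrix.map_mul, hc₀, hc]
        rfl
      intro i j
      rw [h4, ← h5]
      rfl
    have hA : ∀ i j, ‖(G * c₀)ᵀ i j‖ ≤ R := by
      intro i j
      rw [transpose_apply, hG, ← h1, ← h2]
      exact hR _ (hM _) (hre _) j i
    have hB : ∀ i j, ‖(G * c) i j‖ ≤ R := hR _ (hM _) (hre _)
    have hJ : ∀ i j, ‖J ι ℂ i j‖ ≤ 1 := by
      rintro (i | i) (j | j) <;> simp [J, Matrix.one_apply] <;> split_ifs <;> simp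
    have h6 := fun i j => norm_mul_apply_le (norm_mul_apply_le hA hJ) hB i j
    have h7 : ∀ i j, |N q i j| ≤ R' := by
      intro i j
      have h8 := h6 i j
      rw [← h3, Complex.norm_intCast] at h8
      exact_mod_cast h8.trans (Int.le_ceil _)
    exact ⟨fun i j => (abs_le.1 (h7 i j)).1, fun i j => (abs_le.1 (h7 i j)).2⟩
  let Φ : Quotient (QuotientGroup.rightRel (siegelParabolic ι)) →
      ((ι → ℕ) × (OrderedPair ι → ℕ)) ×
        (Set.Icc (fun _ _ => -R') (fun _ _ => R') : Set (ι ⊕ ι → ι ⊕ ι → ℤ)) :=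
    fun q => (idx q, ⟨N q, hN q⟩)
  have hΦ : Function.Injective Φ := by
    intro q q' h
    have h1 : idx q = idx q' := congrArg Prod.fst h
    have h2 : N q = N q' := congrArg Subtype.val (congrArg Prod.snd h)
    have h3 : (M (sec (idx q)) : Matrix (ι ⊕ ι) (ι ⊕ ι) ℤ)ᵀ * J ι ℤ *
        (M q : Matrix (ι ⊕ ι) (ι ⊕ ι) ℤ) = (M (sec (idx q)) : Matrix (ι ⊕ ι) (ι ⊕ ι) ℤ)ᵀ *
        J ι ℤ * (M q' : Matrix (ι ⊕ ι) (ι ⊕ ι) ℤ) := by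
      simp only [N, ← h1] at h2
      exact h2
    have h4 : IsUnit ((M (sec (idx q)) : Matrix (ι ⊕ ι) (ι ⊕ ι) ℤ)ᵀ * J ι ℤ) := by
      rw [isUnit_iff_isUnit_det, det_mul, det_transpose]
      exact (SymplecticGroup.symplectic_det (M (sec (idx q))).2).mul (isUnit_det_J ι ℤ)
    rw [← hMq q, ← hMq q', Subtype.ext (h4.mul_left_cancel h3)]
  have hsum : Summable fun x : ((ι → ℕ) × (OrderedPair ι → ℕ)) ×
      (Set.Icc (fun _ _ => -R') (fun _ _ => R') : Set (ι ⊕ ι → ι ⊕ ι → ℤ)) =>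
      indexWeight ι k x.1 * 1 :=
    (summable_indexWeight hk').mul_of_nonneg (Summable.of_finite (f := fun _ => (1 : ℝ)))
      (indexWeight_nonneg k) fun _ => zero_le_one
  refine Summable.of_nonneg_of_le (fun _ => norm_nonneg _) (fun q => ?_)
    ((hsum.comp_injective hΦ).mul_left ((K : ℝ) ^ k))
  change _ ≤ (K : ℝ) ^ k * (indexWeight ι k (idx q) * 1)
  have hle : ∀ p : OrderedPair ι, (roundRe (M q) p.1.1 p.1.2 : ℝ) ≤
      scl (scale (M q) p.1.1) * scl (scale (M q) p.1.2) := by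
    intro p
    have h1 := hre q p.1.1 p.1.2
    have h2 := scl_pos (scale (M q) p.1.1)
    have h3 := scl_pos (scale (M q) p.1.2)
    refine (Nat.floor_le (by have := h1.1; positivity)).trans ?_
    rw [mul_right_comm]
    exact mul_le_of_le_one_right (by positivity) h1.2.le
  have h1 : indexWeight ι k (idx q) = ∏ i, (scl (scale (M q) i) ^ k)⁻¹ := if_pos hle
  rw [h1, mul_one, Finset.prod_inv_distrib, Finset.prod_pow, ← hMq q, cosetTerm_coset hk, hMq q,
    autFactor_eq_det, ← baseDen_eq, _root_.zpow_neg, zpow_natCast, norm_inv, norm_pow]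
  have h2 := prod_scl_le hK (hM q)
  have h3 : 0 < ∏ i, scl (scale (M q) i) := Finset.prod_pos fun i _ => scl_pos _
  have h4 : 0 < ‖(baseDen (M q)).det‖ := norm_pos_iff.2 (isUnit_det_baseDen (M q)).ne_zero
  rw [← div_eq_mul_inv, ← div_pow, ← inv_pow]
  refine pow_le_pow_left₀ (by positivity) ?_ k
  rw [inv_eq_one_div, div_le_div_iff₀ h4 h3, one_mul]
  exact h2

/-! ### Convergence on the whole half space -/

/-- The constant in the comparison of automorphy factors. -/
def compConst (ι : Type*) [Fintype ι] (δ R : ℝ) : ℝ :=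
  (Fintype.card ι).factorial * (1 + Fintype.card ι * (δ⁻¹ * R)) ^ Fintype.card ι

theorem norm_cosetTerm_eq (k : ℕ) (q : Quotient (QuotientGroup.rightRel (siegelParabolic ι)))
    (τ : Matrix ι ι ℂ) : ‖cosetTerm k q τ‖ = (‖autFactor q.out τ‖⁻¹) ^ k := by
  rw [cosetTerm, _root_.zpow_neg, zpow_natCast, norm_inv, norm_pow, inv_pow]

theorem norm_cosetTerm_le {δ δ' R : ℝ} (hδ : 0 < δ) (hδ' : 0 < δ') {τ τ' : Matrix ι ι ℂ}
    (h : ImGE δ τ) (h' : ImGE δ' τ') (hR : ∀ i j, ‖τ' i j - τ i j‖ ≤ R) (k : ℕ)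
    (q : Quotient (QuotientGroup.rightRel (siegelParabolic ι))) :
    ‖cosetTerm k q τ‖ ≤ compConst ι δ R ^ k * ‖cosetTerm k q τ'‖ := by
  rw [norm_cosetTerm_eq, norm_cosetTerm_eq, ← mul_pow]
  refine pow_le_pow_left₀ (by positivity) ?_ k
  have h1 := norm_pos_iff.2 (autFactor_ne_zero hδ h q.out)
  have h2 := norm_pos_iff.2 (autFactor_ne_zero hδ' h' q.out)
  rw [← div_eq_mul_inv, inv_eq_one_div, div_le_div_iff₀ h1 h2, one_mul]
  exact norm_autFactor_le q.out hδ h hR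

theorem exists_norm_sub_le (τ τ' : Matrix ι ι ℂ) : ∃ R, ∀ i j, ‖τ' i j - τ i j‖ ≤ R := by
  refine ⟨∑ i, ∑ j, ‖τ' i j - τ i j‖, fun i j => ?_⟩
  refine (Finset.single_le_sum (f := fun j => ‖τ' i j - τ i j‖) (fun _ _ => norm_nonneg _)
    (Finset.mem_univ j)).trans ?_
  exact Finset.single_le_sum (f := fun i => ∑ j, ‖τ' i j - τ i j‖)
    (fun _ _ => Finset.sum_nonneg fun _ _ => norm_nonneg _) (Finset.mem_univ i)

/-- The Siegel Eisenstein series converges absolutely. -/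
theorem summable_norm_cosetTerm {k : ℕ} (hk : Even k) (hk' : Fintype.card ι + 1 < k)
    {τ : Matrix ι ι ℂ} (hτ : τ ∈ siegelUpperHalfSpace ι) :
    Summable fun q : Quotient (QuotientGroup.rightRel (siegelParabolic ι)) =>
      ‖cosetTerm k q τ‖ := by
  obtain ⟨δ, hδ, h⟩ := exists_imGE hτ
  obtain ⟨R, hR⟩ := exists_norm_sub_le τ (Complex.I • 1)
  exact Summable.of_nonneg_of_le (fun _ => norm_nonneg _)
    (fun q => norm_cosetTerm_le hδ one_pos h imGE_base hR k q)
    ((summable_cosetTerm_base hk hk').mul_left _)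

theorem eisenstein_eq_tsum (k : ℕ) (τ : Matrix ι ι ℂ) :
    eisenstein k τ = ∑' q, cosetTerm k q τ := rfl

/-! ### Fourier series of periodic functions on the unit cube -/

section Fourier

variable {σ : Type*} [Fintype σ]

theorem e_add (z w : ℂ) : e (z + w) = e z * e w := by
  rw [e, e, e, mul_add, Complex.exp_add]

theorem e_zero : e 0 = 1 := by simp [e]

theorem e_neg_mul_self (z : ℂ) : e (-z) * e z = 1 := by
  rw [← e_add, neg_add_cancel, e_zero]

theorem e_intCast (n : ℤ) : e n = 1 := by
  rw [e, mul_comm]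
  exact Complex.exp_int_mul_two_pi_mul_I n

theorem norm_e (z : ℂ) : ‖e z‖ = Real.exp (-(2 * Real.pi * z.im)) := by
  rw [e, Complex.norm_exp]
  simp

theorem differentiable_e : Differentiable ℂ e := by
  unfold e
  fun_prop

theorem continuous_e : Continuous e := differentiable_e.continuous

/-- The pairing of an integral and a complex vector. -/
def pairing (n : σ → ℤ) (z : σ → ℂ) : ℂ := ∑ s, (n s : ℂ) * z s

theorem pairing_add (n : σ → ℤ) (z w : σ → ℂ) : pairing n (z + w) = pairing n z + pairing n w := by
  simp [pairing, mul_add, Finset.sum_add_distrib]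

theorem pairing_smul (n : σ → ℤ) (c : ℂ) (w : σ → ℂ) : pairing n (c • w) = c * pairing n w := by
  simp only [pairing, Pi.smul_apply, smul_eq_mul, Finset.mul_sum]
  exact Finset.sum_congr rfl fun i _ => by ring

theorem pairing_sub_left (n m : σ → ℤ) (z : σ → ℂ) :
    pairing (n - m) z = pairing n z - pairing m z := by
  simp [pairing, sub_mul]

theorem pairing_intCast (n m : σ → ℤ) :
    pairing n (fun s => (m s : ℂ)) = ((∑ s, n s * m s : ℤ) : ℂ) := by
  simp [pairing]

theorem continuous_pairing (n : σ → ℤ) : Continuous (pairing n) := by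
  unfold pairing
  fun_prop

theorem im_pairing (n : σ → ℤ) (z : σ → ℂ) : (pairing n z).im = ∑ s, (n s : ℝ) * (z s).im := by
  simp [pairing]

/-- The point `x + i y`. -/
def cpt (x y : σ → ℝ) : σ → ℂ := fun s => x s + Complex.I * y s

theorem im_cpt (x y : σ → ℝ) (s : σ) : (cpt x y s).im = y s := by simp [cpt]

theorem continuous_cpt (y : σ → ℝ) : Continuous fun x => cpt x y := by
  unfold cpt
  fun_prop

theorem cpt_re_im (z : σ → ℂ) : cpt (fun s => (z s).re) (fun s => (z s).im) = z := by
  ext s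
  rw [cpt, mul_comm, Complex.re_add_im]

/-- The unit cube. -/
def cube (σ : Type*) : Set (σ → ℝ) := Set.Icc 0 1

theorem isCompact_cube : IsCompact (cube σ) := isCompact_Icc

theorem cube_ae_eq : {x : σ → ℝ | ∀ i, x i ∈ Set.Ioc (0 : ℝ) (0 + 1)} =ᵐ[volume] cube σ := by
  have h := Measure.univ_pi_Ioc_ae_eq_Icc (μ := fun _ : σ => (volume : Measure ℝ))
    (f := (0 : σ → ℝ)) (g := 1)
  have h2 : {x : σ → ℝ | ∀ i, x i ∈ Set.Ioc (0 : ℝ) (0 + 1)} =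
      Set.univ.pi fun i => Set.Ioc ((0 : σ → ℝ) i) ((1 : σ → ℝ) i) := by
    ext x
    simp [Set.mem_pi]
  rw [h2]
  exact h

theorem volume_cube : volume (cube σ) = 1 := by
  rw [cube, Real.volume_Icc_pi]
  simp

/-- The representative in the unit cube of a point of the torus. -/
def torusRep (t : UnitAddTorus σ) : σ → ℝ := fun i => (AddCircle.equivIoc 1 0 (t i)).1

theorem exists_torusRep_eq (x : σ → ℝ) :
    ∃ n : σ → ℤ, x = torusRep (fun i => (x i : UnitAddCircle)) + fun i => (n i : ℝ) := by
  have h : ∀ i, ∃ n : ℤ, x i = torusRep (fun i => (x i : UnitAddCircle)) i + n := by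
    intro i
    have h1 : ((torusRep (fun i => (x i : UnitAddCircle)) i : ℝ) : UnitAddCircle) = x i :=
      (AddCircle.equivIoc 1 0).symm_apply_apply (x i : UnitAddCircle)
    rw [← sub_eq_zero, ← AddCircle.coe_sub, AddCircle.coe_eq_zero_iff] at h1
    obtain ⟨n, hn⟩ := h1
    refine ⟨-n, ?_⟩
    rw [zsmul_eq_mul, mul_one] at hn
    push_cast
    linarith
  choose n hn using h
  exact ⟨n, funext hn⟩

theorem torusRep_comp {F : (σ → ℝ) → ℂ} (hF : ∀ x (n : σ → ℤ), F (x + fun i => (n i : ℝ)) = F x)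
    (x : σ → ℝ) : F (torusRep fun i => (x i : UnitAddCircle)) = F x := by
  obtain ⟨n, hn⟩ := exists_torusRep_eq x
  conv_rhs => rw [hn]
  rw [hF]

theorem mFourier_coe (n : σ → ℤ) (x : σ → ℝ) :
    UnitAddTorus.mFourier n (fun i => (x i : UnitAddCircle)) = e (pairing n fun i => (x i : ℂ)) := by
  simp only [UnitAddTorus.mFourier, ContinuousMap.coe_mk, fourier_coe_apply, pairing, e,
    Finset.mul_sum, Complex.exp_sum]
  refine Finset.prod_congr rfl fun i _ => ?_
  congr 1
  push_cast
  ring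

/-- The zeroth Fourier coefficient on the torus can be computed over any translate of the cube. -/
theorem integral_cube_add {F : (σ → ℝ) → ℂ}
    (hF : ∀ x (n : σ → ℤ), F (x + fun i => (n i : ℝ)) = F x) (a : σ → ℝ) :
    ∫ x in cube σ, F (x + a) = ∫ x in cube σ, F x := by
  have h1 : ∀ a : σ → ℝ, UnitAddTorus.mFourierCoeff (fun t => F (torusRep t)) 0 =
      ∫ x in {x : σ → ℝ | ∀ i, x i ∈ Set.Ioc (a i) (a i + 1)}, F x := by
    intro a
    rw [UnitAddTorus.mFourierCoeff_eq_integral _ _ a]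
    refine setIntegral_congr_fun ?_ fun x _ => ?_
    · exact MeasurableSet.univ_pi' fun i => measurableSet_Ioc
    · simp only [neg_zero, UnitAddTorus.mFourier_zero, ContinuousMap.one_apply, one_smul]
      exact torusRep_comp hF x
  have h2 := (measurePreserving_add_right (volume : Measure (σ → ℝ)) a).setIntegral_preimage_emb
    (measurableEmbedding_addRight a) F {x : σ → ℝ | ∀ i, x i ∈ Set.Ioc (a i) (a i + 1)}
  have h3 : (fun x => x + a) ⁻¹' {x : σ → ℝ | ∀ i, x i ∈ Set.Ioc (a i) (a i + 1)} =
      {x : σ → ℝ | ∀ i, x i ∈ Set.Ioc (0 : ℝ) (0 + 1)} := by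
    ext x
    simp [add_comm]
  rw [h3, setIntegral_congr_set cube_ae_eq, ← h1, h1 0] at h2
  rw [h2]
  exact setIntegral_congr_set cube_ae_eq

/-- The `n`-th Fourier coefficient of a periodic function. -/
def cubeCoeff (F : (σ → ℝ) → ℂ) (n : σ → ℤ) : ℂ :=
  ∫ x in cube σ, F x * e (-pairing n fun i => (x i : ℂ))

/-- A periodic continuous function descends along the quotient map to the torus, where summable
coefficients give pointwise convergence. -/
theorem hasSum_cubeCoeff {F : (σ → ℝ) → ℂ} (hc : Continuous F)
    (hF : ∀ x (n : σ → ℤ), F (x + fun i => (n i : ℝ)) = F x) (hs : Summable (cubeCoeff F))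
    (x : σ → ℝ) : HasSum (fun n => cubeCoeff F n * e (pairing n fun i => (x i : ℂ))) (F x) := by
  have hq : IsOpenQuotientMap (Pi.map fun (_ : σ) (x : ℝ) => (x : UnitAddCircle)) :=
    IsOpenQuotientMap.piMap fun _ => QuotientAddGroup.isOpenQuotientMap_mk
  have hcont : Continuous fun t : UnitAddTorus σ => F (torusRep t) := by
    rw [hq.isQuotientMap.continuous_iff]
    refine hc.congr fun x => ?_
    exact (torusRep_comp hF x).symm
  let f : C(UnitAddTorus σ, ℂ) := ⟨_, hcont⟩
  have h1 : ∀ n, UnitAddTorus.mFourierCoeff f n = cubeCoeff F n := by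
    intro n
    rw [UnitAddTorus.mFourierCoeff_eq_integral _ _ 0, cubeCoeff,
      ← setIntegral_congr_set cube_ae_eq]
    refine setIntegral_congr_fun ?_ fun x _ => ?_
    · exact MeasurableSet.univ_pi' fun i => measurableSet_Ioc
    · change UnitAddTorus.mFourier (-n) (fun i => (x i : UnitAddCircle)) •
        F (torusRep fun i => (x i : UnitAddCircle)) = _
      rw [torusRep_comp hF, mFourier_coe, smul_eq_mul, mul_comm]
      simp [pairing]
  have h2 : Summable (UnitAddTorus.mFourierCoeff f) := by
    rwa [funext h1]
  have h3 := UnitAddTorus.hasSum_mFourier_series_apply_of_summable h2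
    fun i => (x i : UnitAddCircle)
  simp only [h1, mFourier_coe, smul_eq_mul] at h3
  have h4 : f (fun i => (x i : UnitAddCircle)) = F x := torusRep_comp hF x
  rwa [h4] at h3

theorem integral_e_pairing [DecidableEq σ] (n : σ → ℤ) :
    ∫ x in cube σ, e (pairing n fun i => (x i : ℂ)) = if n = 0 then 1 else 0 := by
  split_ifs with h
  · simp [h, pairing, e_zero, Measure.real, volume_cube]
  · obtain ⟨s, hs⟩ := Function.ne_iff.1 h
    -- Translation by half a period in a coordinate with n s ≠ 0 changes the sign of the character,
    -- so the integral equals its own negative.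
    let a : σ → ℝ := Pi.single s (1 / (2 * (n s : ℝ)))
    have hs' : (n s : ℂ) ≠ 0 := by exact_mod_cast hs
    have h1 := integral_cube_add (F := fun x => e (pairing n fun i => (x i : ℂ)))
      (fun x m => by
        have : (fun i => ((x + fun i => (m i : ℝ)) i : ℂ)) = (fun i => (x i : ℂ)) +
            fun i => (m i : ℂ) := by
          ext i
          simp
        rw [this, pairing_add, e_add, pairing_intCast, e_intCast, mul_one]) a
    have h2 : pairing n (fun i => (a i : ℂ)) = 1 / 2 := by
      rw [pairing, Finset.sum_eq_single s]
      · simp [a]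
        field_simp
      · intro b _ hb
        simp [a, hb]
      · simp
    have h3 : e (1 / 2) = -1 := by
      rw [e, show 2 * (Real.pi : ℂ) * Complex.I * (1 / 2) = Real.pi * Complex.I by ring,
        Complex.exp_pi_mul_I]
    have h4 : ∀ x : σ → ℝ, e (pairing n fun i => ((x + a) i : ℂ)) =
        -e (pairing n fun i => (x i : ℂ)) := by
      intro x
      have : (fun i => ((x + a) i : ℂ)) = (fun i => (x i : ℂ)) + fun i => (a i : ℂ) := by
        ext i
        simp
      rw [this, pairing_add, e_add, h2, h3, mul_neg_one]
    simp only [h4, integral_neg] at h1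
    linear_combination (-1 / 2 : ℂ) * h1

/-- Summability at x = 0 is absolute summability of the coefficients; the series may then be
integrated term by term against a character. -/
theorem cubeCoeff_eq_of_hasSum {F : (σ → ℝ) → ℂ} {a : (σ → ℤ) → ℂ}
    (h : ∀ x, HasSum (fun n => a n * e (pairing n fun i => (x i : ℂ))) (F x)) (m : σ → ℤ) :
    cubeCoeff F m = a m := by
  classical
  have hnorm : ∀ (n : σ → ℤ) (x : σ → ℝ), ‖e (pairing n fun i => (x i : ℂ))‖ = 1 := by
    intro n x
    simp [norm_e, im_pairing]
  have ha : Summable fun n => ‖a n‖ := by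
    have := (h 0).summable.norm
    simp only [norm_mul, hnorm, mul_one] at this
    exact this
  let G : (σ → ℤ) → (σ → ℝ) → ℂ := fun n x => a n * e (pairing (n - m) fun i => (x i : ℂ))
  have hG : ∀ n x, G n x = a n * e (pairing n fun i => (x i : ℂ)) *
      e (-pairing m fun i => (x i : ℂ)) := by
    intro n x
    simp only [G]
    rw [pairing_sub_left, sub_eq_add_neg, e_add, mul_assoc]
  have hGc : ∀ n, Continuous (G n) := fun n =>
    continuous_const.mul (continuous_e.comp ((continuous_pairing _).comp (by fun_prop)))
  have hint : ∀ n, Integrable (G n) (volume.restrict (cube σ)) := fun n =>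
    (hGc n).continuousOn.integrableOn_compact isCompact_cube
  have hGn : ∀ n x, ‖G n x‖ = ‖a n‖ := by
    intro n x
    simp only [G]
    rw [norm_mul, hnorm, mul_one]
  have h1 := hasSum_integral_of_summable_integral_norm hint (by
    simpa [hGn, Measure.real, volume_cube] using ha)
  have h2 : ∀ x, ∑' n, G n x = F x * e (-pairing m fun i => (x i : ℂ)) := by
    intro x
    simp only [hG]
    exact ((h x).mul_right _).tsum_eq
  have h3 : ∀ n, ∫ x in cube σ, G n x = if n = m then a m else 0 := by
    intro n
    simp only [G]
    rw [integral_const_mul, integral_e_pairing]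
    by_cases hn : n = m
    · simp [hn]
    · simp [hn, sub_eq_zero]
  simp only [h2, h3] at h1
  exact h1.unique (hasSum_ite_eq m (a m))

end Fourier

/-! ### Periodic functions on tubes: independence of the height -/

section Tube

variable {σ : Type*} [Fintype σ]

/-- The tube over a set of imaginary parts. -/
def tube (Ω : Set (σ → ℝ)) : Set (σ → ℂ) := {z | (fun s => (z s).im) ∈ Ω}

theorem cpt_mem_tube {Ω : Set (σ → ℝ)} (x : σ → ℝ) {y : σ → ℝ} (hy : y ∈ Ω) :
    cpt x y ∈ tube Ω := by
  simpa [tube, im_cpt] using hy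

/-- A continuous function on the tube over a convex open set that is invariant under integral
translations and holomorphic on complex lines in real directions. -/
structure IsTubeFunction (f : (σ → ℂ) → ℂ) (Ω : Set (σ → ℝ)) : Prop where
  isOpen : IsOpen Ω
  convex : Convex ℝ Ω
  cont : ContinuousOn f (tube Ω)
  diff : ∀ z ∈ tube Ω, ∀ d : σ → ℝ,
    DifferentiableAt ℂ (fun w : ℂ => f (z + w • fun s => (d s : ℂ))) 0
  per : ∀ z ∈ tube Ω, ∀ n : σ → ℤ, f (z + fun s => (n s : ℂ)) = f z

/-- The Fourier coefficient of a function on a tube, computed at the height `y`. -/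
def tubeCoeff (f : (σ → ℂ) → ℂ) (n : σ → ℤ) (y : σ → ℝ) : ℂ :=
  ∫ x in cube σ, f (cpt x y) * e (-pairing n (cpt x y))

theorem pairing_cpt (n : σ → ℤ) (x y : σ → ℝ) :
    pairing n (cpt x y) = (pairing n fun i => (x i : ℂ)) +
      Complex.I * pairing n fun i => (y i : ℂ) := by
  rw [← pairing_smul, ← pairing_add]
  rfl

theorem tubeCoeff_eq (f : (σ → ℂ) → ℂ) (n : σ → ℤ) (y : σ → ℝ) :
    tubeCoeff f n y = cubeCoeff (fun x => f (cpt x y)) n *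
      e (-(Complex.I * pairing n fun i => (y i : ℂ))) := by
  rw [tubeCoeff, cubeCoeff, ← integral_mul_const]
  refine integral_congr_ae (Filter.Eventually.of_forall fun x => ?_)
  simp only [pairing_cpt, neg_add, e_add, mul_assoc]

theorem cpt_add_intCast (x y : σ → ℝ) (n : σ → ℤ) :
    cpt (x + fun i => (n i : ℝ)) y = cpt x y + fun s => (n s : ℂ) := by
  ext s
  simp [cpt]
  ring

theorem cpt_add_smul (x y d : σ → ℝ) (w : ℂ) :
    cpt x y + w • (fun s => (d s : ℂ)) = cpt (x + w.re • d) (y + w.im • d) := by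
  ext s
  conv_lhs => rw [← Complex.re_add_im w]
  simp only [cpt, Pi.add_apply, Pi.smul_apply, smul_eq_mul, Complex.ofReal_add, Complex.ofReal_mul]
  ring

theorem norm_tubeCoeff_le {f : (σ → ℂ) → ℂ} {y : σ → ℝ} {C : ℝ}
    (hC : ∀ x ∈ cube σ, ‖f (cpt x y)‖ ≤ C) (n : σ → ℤ) :
    ‖tubeCoeff f n y‖ ≤ C * Real.exp (2 * Real.pi * ∑ s, (n s : ℝ) * y s) := by
  have h := norm_setIntegral_le_of_norm_le_const (μ := volume) (s := cube σ)
    (f := fun x => f (cpt x y) * e (-pairing n (cpt x y)))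
    (C := C * Real.exp (2 * Real.pi * ∑ s, (n s : ℝ) * y s))
    (by rw [volume_cube]; exact ENNReal.one_lt_top) fun x hx => by
      rw [norm_mul, norm_e, Complex.neg_im, im_pairing]
      simp only [im_cpt, mul_neg, neg_neg]
      exact mul_le_mul_of_nonneg_right (hC x hx) (Real.exp_pos _).le
  rw [Measure.real, volume_cube, ENNReal.toReal_one, mul_one] at h
  exact h

namespace IsTubeFunction

variable {f : (σ → ℂ) → ℂ} {Ω : Set (σ → ℝ)} (hf : IsTubeFunction f Ω)

include hf

theorem mul_e (n : σ → ℤ) : IsTubeFunction (fun z => f z * e (-pairing n z)) Ω where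
  isOpen := hf.isOpen
  convex := hf.convex
  cont := hf.cont.mul (continuous_e.comp (continuous_pairing n).neg).continuousOn
  diff z hz d := by
    refine (hf.diff z hz d).mul ?_
    simp only [pairing_add, pairing_smul]
    exact (differentiable_e _).comp (0 : ℂ) (by fun_prop)
  per z hz m := by
    simp only [hf.per z hz m, pairing_add, neg_add, e_add, pairing_intCast]
    rw [← Int.cast_neg, e_intCast, mul_one]

theorem continuous_slice {y : σ → ℝ} (hy : y ∈ Ω) : Continuous fun x => f (cpt x y) :=
  hf.cont.comp_continuous (continuous_cpt y) fun x => cpt_mem_tube x hy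

theorem per_slice {y : σ → ℝ} (hy : y ∈ Ω) (x : σ → ℝ) (n : σ → ℤ) :
    f (cpt (x + fun i => (n i : ℝ)) y) = f (cpt x y) := by
  rw [cpt_add_intCast, hf.per _ (cpt_mem_tube x hy)]

theorem differentiableAt_line {z : σ → ℂ} {d : σ → ℝ} {w : ℂ}
    (hw : z + w • (fun s => (d s : ℂ)) ∈ tube Ω) :
    DifferentiableAt ℂ (fun w : ℂ => f (z + w • fun s => (d s : ℂ))) w := by
  have h1 := hf.diff _ hw d
  have h2 : (fun v : ℂ => f (z + v • fun s => (d s : ℂ))) =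
      (fun v : ℂ => f (z + w • (fun s => (d s : ℂ)) + v • fun s => (d s : ℂ))) ∘
        fun v => v - w := by
    ext v
    simp only [Function.comp, add_assoc, ← add_smul]
    congr 3
    ring
  rw [h2]
  refine DifferentiableAt.comp w ?_ (by fun_prop)
  rwa [sub_self]

theorem exists_bound {y : σ → ℝ} (hy : y ∈ Ω) (d : σ → ℝ) :
    ∃ ρ > 0, ∃ C, (∀ w : ℂ, ‖w‖ ≤ ρ → y + w.im • d ∈ Ω) ∧
      ∀ w : ℂ, ‖w‖ ≤ ρ → ∀ x ∈ cube σ, ‖f (cpt x y + w • fun s => (d s : ℂ))‖ ≤ C := by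
  have h1 : ∀ᶠ w : ℂ in nhds 0, y + w.im • d ∈ Ω := by
    have hc : Continuous fun w : ℂ => y + w.im • d := by fun_prop
    refine hc.continuousAt.eventually_mem (hf.isOpen.mem_nhds ?_)
    simpa using hy
  obtain ⟨ρ, hρ, h2⟩ := Metric.eventually_nhds_iff_ball.1 h1
  have h3 : ∀ w : ℂ, ‖w‖ ≤ ρ / 2 → y + w.im • d ∈ Ω := fun w hw =>
    h2 w (by rw [mem_ball_zero_iff]; linarith)
  have hK : IsCompact ((fun p : ℂ × (σ → ℝ) => cpt p.2 y + p.1 • fun s => (d s : ℂ)) ''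
      (Metric.closedBall 0 (ρ / 2) ×ˢ cube σ)) := by
    refine ((isCompact_closedBall _ _).prod isCompact_cube).image ?_
    unfold cpt
    fun_prop
  have hKs : ((fun p : ℂ × (σ → ℝ) => cpt p.2 y + p.1 • fun s => (d s : ℂ)) ''
      (Metric.closedBall 0 (ρ / 2) ×ˢ cube σ)) ⊆ tube Ω := by
    rintro _ ⟨⟨w, x⟩, ⟨hw, -⟩, rfl⟩
    dsimp only
    rw [cpt_add_smul]
    exact cpt_mem_tube _ (h3 w (by simpa using hw))
  obtain ⟨C, hC⟩ := hK.exists_bound_of_continuousOn (hf.cont.mono hKs)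
  exact ⟨ρ / 2, by positivity, C, h3, fun w hw x hx =>
    hC _ ⟨(w, x), ⟨by simpa using hw, hx⟩, rfl⟩⟩

/-- The integral over the cube of f(z + w d) is complex differentiable in w at 0 and, by
periodicity, constant for real w. So its complex derivative vanishes, also in the imaginary
direction, which changes the height. -/
theorem hasDerivAt_integral_line {y : σ → ℝ} (hy : y ∈ Ω) (d : σ → ℝ) :
    HasDerivAt (fun t : ℝ => ∫ x in cube σ, f (cpt x (y + t • d))) 0 0 := by
  obtain ⟨ρ, hρ, C, hΩ, hC⟩ := hf.exists_bound hy d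
  set D : σ → ℂ := fun s => (d s : ℂ) with hD
  set G : ℂ → ℂ := fun w => ∫ x in cube σ, f (cpt x y + w • D) with hG
  have hmem : ∀ w : ℂ, ‖w‖ ≤ ρ → ∀ x, cpt x y + w • D ∈ tube Ω := fun w hw x => by
    rw [hD, cpt_add_smul]
    exact cpt_mem_tube _ (hΩ w hw)
  have hcont : ∀ w : ℂ, ‖w‖ ≤ ρ → Continuous fun x => f (cpt x y + w • D) := fun w hw =>
    hf.cont.comp_continuous ((continuous_cpt y).add continuous_const) (hmem w hw)
  have hdiff : ∀ w : ℂ, ‖w‖ ≤ ρ → ∀ x, DifferentiableAt ℂ (fun w : ℂ => f (cpt x y + w • D)) w :=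
    fun w hw x => hf.differentiableAt_line (hmem w hw x)
  have hC0 : 0 ≤ C := (norm_nonneg _).trans (hC 0 (by simpa using hρ.le) 0 (by simp [cube]))
  have hG' : ∃ c, HasDerivAt G c 0 := by
    refine ⟨_, (hasDerivAt_integral_of_dominated_loc_of_lip (μ := volume.restrict (cube σ))
      (F := fun w x => f (cpt x y + w • D)) (x₀ := (0 : ℂ)) (s := Metric.ball 0 (ρ / 2))
      (F' := fun x => deriv (fun w : ℂ => f (cpt x y + w • D)) 0)
      (bound := fun _ => C / (ρ / 2)) (Metric.ball_mem_nhds _ (by positivity)) ?_ ?_ ?_ ?_ ?_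
      ?_).2⟩
    · filter_upwards [Metric.ball_mem_nhds (0 : ℂ) hρ] with w hw
      exact (hcont w (mem_ball_zero_iff.1 hw).le).aestronglyMeasurable
    · exact (hcont 0 (by simpa using hρ.le)).continuousOn.integrableOn_compact isCompact_cube
    · have hu : ∀ k : ℕ, ‖((ρ / (k + 1 : ℝ) : ℝ) : ℂ)‖ ≤ ρ := fun k => by
        rw [Complex.norm_real, Real.norm_eq_abs, abs_of_pos (by positivity)]
        exact div_le_self hρ.le (by linarith [k.cast_nonneg (α := ℝ)])
      -- The derivative is measurable in x as the limit of difference quotients along ρ/(k+1).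
      refine aestronglyMeasurable_of_tendsto_ae Filter.atTop
        (f := fun (k : ℕ) x => ((ρ / (k + 1 : ℝ) : ℝ) : ℂ)⁻¹ •
          (f (cpt x y + ((ρ / (k + 1 : ℝ) : ℝ) : ℂ) • D) - f (cpt x y + (0 : ℂ) • D)))
        (fun k => by
          have h1 := hcont _ (hu k)
          have h2 := hcont 0 (by simpa using hρ.le)
          have h3 : Continuous fun x => ((ρ / (k + 1 : ℝ) : ℝ) : ℂ)⁻¹ •
              (f (cpt x y + ((ρ / (k + 1 : ℝ) : ℝ) : ℂ) • D) - f (cpt x y + (0 : ℂ) • D)) := by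
            simp only [smul_eq_mul]
            exact continuous_const.mul (h1.sub h2)
          exact h3.aestronglyMeasurable)
        (Filter.Eventually.of_forall fun x => ?_)
      have h1 := (hdiff 0 (by simpa using hρ.le) x).hasDerivAt.tendsto_slope_zero
      simp only [zero_add] at h1
      refine h1.comp ?_
      rw [tendsto_nhdsWithin_iff]
      constructor
      · have h2 : Filter.Tendsto (fun k : ℕ => ρ / (k + 1 : ℝ)) Filter.atTop (nhds 0) :=
          tendsto_const_div_atTop_nhds_zero_nat ρ |>.comp (Filter.tendsto_add_atTop_nat 1) |>.congr
            fun k => by simp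
        have h3 := (Complex.continuous_ofReal.tendsto 0).comp h2
        rwa [Complex.ofReal_zero] at h3
      · refine Filter.Eventually.of_forall fun k => ?_
        simp only [Set.mem_compl_iff, Set.mem_singleton_iff, Complex.ofReal_eq_zero]
        positivity
    · filter_upwards [ae_restrict_mem isCompact_cube.measurableSet] with x hx
      refine (convex_ball (0 : ℂ) (ρ / 2)).lipschitzOnWith_of_nnnorm_deriv_le
        (fun w hw => hdiff w (by rw [mem_ball_zero_iff] at hw; linarith) x) fun w hw => ?_
      rw [mem_ball_zero_iff] at hw
      rw [← NNReal.coe_le_coe, coe_nnnorm, Real.coe_nnabs, abs_of_nonneg (by positivity)]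
      -- Cauchy's estimate on the circle of radius ρ/2 about w, which stays in the disc of radius ρ
      -- where f is bounded by C.
      refine Complex.norm_deriv_le_of_forall_mem_sphere_norm_le (by positivity) ?_ fun v hv => ?_
      · refine DifferentiableOn.diffContOnCl fun v hv => ?_
        refine (hdiff v ?_ x).differentiableWithinAt
        have h1 := Metric.closure_ball_subset_closedBall hv
        rw [mem_closedBall_iff_norm] at h1
        have := norm_le_norm_add_norm_sub' v w
        linarith
      · refine hC v ?_ x hx
        rw [mem_sphere_iff_norm] at hv
        have := norm_le_norm_add_norm_sub' v w
        linarith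
    · exact integrableOn_const (by rw [volume_cube]; exact ENNReal.one_ne_top)
    · exact Filter.Eventually.of_forall fun x => (hdiff 0 (by simpa using hρ.le) x).hasDerivAt
  obtain ⟨c, hc⟩ := hG'
  have hreal : ∀ t : ℝ, G t = G 0 := by
    intro t
    have h1 := integral_cube_add (F := fun x => f (cpt x y)) (fun x n => hf.per_slice hy x n) (t • d)
    simp only [hG, hD, cpt_add_smul]
    simpa using h1
  have hc0 : c = 0 := by
    have h1 : HasDerivAt (fun t : ℝ => G t) c 0 := by
      have h2 : HasDerivAt G c ((0 : ℝ) : ℂ) := by simpa using hc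
      exact h2.comp_ofReal
    exact h1.unique ((hasDerivAt_const (0 : ℝ) (G 0)).congr_of_eventuallyEq
      (Filter.Eventually.of_forall hreal))
  rw [hc0] at hc
  have h3 : HasDerivAt (fun t : ℝ => G (Complex.I * t)) 0 0 := by
    have h4 : HasDerivAt (fun w : ℂ => G (Complex.I * w)) (0 * (Complex.I * 1)) ((0 : ℝ) : ℂ) := by
      refine HasDerivAt.comp (h₂ := G) _ (by simpa using hc) ?_
      exact (hasDerivAt_id _).const_mul Complex.I
    simpa using h4.comp_ofReal
  refine h3.congr_of_eventuallyEq (Filter.Eventually.of_forall fun t => ?_)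
  simp only [hG, hD, cpt_add_smul]
  simp

theorem integral_slice_eq {y y' : σ → ℝ} (hy : y ∈ Ω) (hy' : y' ∈ Ω) :
    ∫ x in cube σ, f (cpt x y') = ∫ x in cube σ, f (cpt x y) := by
  set H : ℝ → ℂ := fun t => ∫ x in cube σ, f (cpt x (y + t • (y' - y))) with hH
  have h1 : ∀ t ∈ Set.Icc (0 : ℝ) 1, HasDerivAt H 0 t := by
    intro t ht
    have h2 := hf.hasDerivAt_integral_line (hf.convex.add_smul_sub_mem hy hy' ht) (y' - y)
    have h3 : H = (fun u : ℝ => ∫ x in cube σ, f (cpt x (y + t • (y' - y) + u • (y' - y)))) ∘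
        fun v => v - t := by
      ext v
      simp only [hH, Function.comp, add_assoc, ← add_smul]
      simp
    rw [h3]
    have h4 : HasDerivAt (fun v : ℝ => v - t) 1 t := (hasDerivAt_id t).sub_const t
    have h5 := HasDerivAt.scomp (h := fun v : ℝ => v - t) t (by rw [sub_self]; exact h2) h4
    simpa using h5
  have h2 := constant_of_has_deriv_right_zero (f := H) (a := 0) (b := 1)
    (fun t ht => (h1 t ht).continuousAt.continuousWithinAt)
    (fun t ht => (h1 t ⟨ht.1, ht.2.le⟩).hasDerivWithinAt) 1 (by simp)
  simpa [hH] using h2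

/-- The Fourier coefficients do not depend on the height at which they are computed. -/
theorem tubeCoeff_eq_tubeCoeff {y y' : σ → ℝ} (hy : y ∈ Ω) (hy' : y' ∈ Ω) (n : σ → ℤ) :
    tubeCoeff f n y' = tubeCoeff f n y :=
  (hf.mul_e n).integral_slice_eq hy hy'

end IsTubeFunction

end Tube

/-! ### Periodic functions on tubes: expansion, uniqueness, vanishing -/

section TubeExpansion

variable {σ : Type*} [Fintype σ]

theorem summable_pow_natAbs {r : ℝ} (h0 : 0 ≤ r) (h1 : r < 1) :
    Summable fun n : ℤ => r ^ n.natAbs := by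
  refine Summable.of_nat_of_neg ?_ ?_ <;> simpa using summable_geometric_of_lt_one h0 h1

namespace IsTubeFunction

variable {f : (σ → ℂ) → ℂ} {Ω : Set (σ → ℝ)} (hf : IsTubeFunction f Ω)

include hf

theorem exists_bound_closedBall {y : σ → ℝ} (hy : y ∈ Ω) :
    ∃ ε > 0, ∃ C, Metric.closedBall y ε ⊆ Ω ∧
      ∀ y' ∈ Metric.closedBall y ε, ∀ x ∈ cube σ, ‖f (cpt x y')‖ ≤ C := by
  obtain ⟨ε, hε, h1⟩ := Metric.nhds_basis_closedBall.mem_iff.1 (hf.isOpen.mem_nhds hy)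
  have hK : IsCompact ((fun p : (σ → ℝ) × (σ → ℝ) => cpt p.2 p.1) ''
      (Metric.closedBall y ε ×ˢ cube σ)) := by
    refine ((isCompact_closedBall _ _).prod isCompact_cube).image ?_
    unfold cpt
    fun_prop
  have hKs : ((fun p : (σ → ℝ) × (σ → ℝ) => cpt p.2 p.1) ''
      (Metric.closedBall y ε ×ˢ cube σ)) ⊆ tube Ω := by
    rintro _ ⟨⟨w, x⟩, ⟨hw, -⟩, rfl⟩
    exact cpt_mem_tube _ (h1 hw)
  obtain ⟨C, hC⟩ := hK.exists_bound_of_continuousOn (hf.cont.mono hKs)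
  exact ⟨ε, hε, C, h1, fun y' hy' x hx => hC _ ⟨(y', x), ⟨hy', hx⟩, rfl⟩⟩

theorem summable_norm {y₀ : σ → ℝ} (hy₀ : y₀ ∈ Ω) {z : σ → ℂ} (hz : z ∈ tube Ω) :
    Summable fun n : σ → ℤ => ‖tubeCoeff f n y₀ * e (pairing n z)‖ := by
  set y : σ → ℝ := fun s => (z s).im with hy
  obtain ⟨ε, hε, C, hΩ, hC⟩ := hf.exists_bound_closedBall (y := y) hz
  set r := Real.exp (-(2 * Real.pi * ε)) with hr
  have hr1 : r < 1 := by
    rw [hr, Real.exp_lt_one_iff]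
    have := Real.pi_pos
    simp only [Left.neg_neg_iff]
    positivity
  refine Summable.of_nonneg_of_le (fun _ => norm_nonneg _) (fun n => ?_)
    ((summable_pi_prod (f := fun (_ : σ) (k : ℤ) => r ^ k.natAbs)
      (fun _ _ => pow_nonneg (Real.exp_pos _).le _)
      fun _ => summable_pow_natAbs (Real.exp_pos _).le hr1).mul_left C)
  -- Computing the n-th coefficient at a height shifted by ε against the sign of each n s gains
  -- exp(-2πε|n s|) in every coordinate.
  let y' : σ → ℝ := fun s => y s - ε * (SignType.sign (n s) : ℤ)
  have hy' : y' ∈ Metric.closedBall y ε := by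
    rw [mem_closedBall_iff_norm, pi_norm_le_iff_of_nonneg hε.le]
    intro s
    rcases lt_trichotomy (n s) 0 with h | h | h <;>
      simp [y', h, abs_of_pos hε, hε.le]
  rw [← hf.tubeCoeff_eq_tubeCoeff hy₀ (hΩ hy'), norm_mul, norm_e, im_pairing]
  have h1 := norm_tubeCoeff_le (fun x hx => hC y' hy' x hx) n
  refine (mul_le_mul_of_nonneg_right h1 (Real.exp_pos _).le).trans_eq ?_
  rw [mul_assoc, ← Real.exp_add, hr]
  simp only [← Real.exp_nat_mul]
  rw [← Real.exp_sum]
  congr 2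
  have h2 : ∀ s, (n s : ℝ) * ((SignType.sign (n s) : ℤ) : ℝ) = ((n s).natAbs : ℝ) := by
    intro s
    rw [← Int.cast_natCast (R := ℝ), Int.natCast_natAbs, ← Int.cast_mul, self_mul_sign]
  simp only [y', mul_sub, Finset.sum_sub_distrib]
  have h3 : ∑ s, (n s : ℝ) * (ε * ((SignType.sign (n s) : ℤ) : ℝ)) =
      ε * ∑ s, ((n s).natAbs : ℝ) := by
    rw [Finset.mul_sum]
    exact Finset.sum_congr rfl fun s _ => by rw [← h2]; ring
  have h4 : ∑ s, ((n s).natAbs : ℝ) * -(2 * Real.pi * ε) =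
      -(2 * Real.pi * ε) * ∑ s, ((n s).natAbs : ℝ) := by
    rw [Finset.mul_sum]
    exact Finset.sum_congr rfl fun s _ => mul_comm _ _
  rw [h3, h4]
  ring

/-- The Fourier expansion of a function on a tube. -/
theorem hasSum {y₀ : σ → ℝ} (hy₀ : y₀ ∈ Ω) {z : σ → ℂ} (hz : z ∈ tube Ω) :
    HasSum (fun n : σ → ℤ => tubeCoeff f n y₀ * e (pairing n z)) (f z) := by
  have h0 := hf.summable_norm hy₀ hz
  set y : σ → ℝ := fun s => (z s).im with hy
  set x : σ → ℝ := fun s => (z s).re with hx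
  have hzc : cpt x y = z := cpt_re_im z
  have h1 : ∀ n, cubeCoeff (fun x => f (cpt x y)) n =
      tubeCoeff f n y₀ * e (Complex.I * pairing n fun i => (y i : ℂ)) := by
    intro n
    rw [← hf.tubeCoeff_eq_tubeCoeff hy₀ hz, tubeCoeff_eq, mul_assoc, e_neg_mul_self, mul_one]
  have h2 : Summable (cubeCoeff fun x => f (cpt x y)) := by
    refine Summable.of_norm (h0.congr fun n => ?_)
    rw [h1, norm_mul, norm_mul, norm_e, norm_e]
    congr 4
    rw [← hzc, pairing_cpt, Complex.add_im]
    simp [im_pairing]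
  have h3 : HasSum (fun n => cubeCoeff (fun x => f (cpt x y)) n * e (pairing n fun i => (x i : ℂ)))
      (f (cpt x y)) := hasSum_cubeCoeff (hf.continuous_slice hz) (hf.per_slice hz) h2 x
  simp only [h1] at h3
  rw [hzc] at h3
  refine h3.congr_fun fun n => ?_
  rw [mul_assoc, ← e_add, ← hzc, pairing_cpt, add_comm]

omit hf in
theorem tubeCoeff_eq_of_hasSum {y : σ → ℝ} {a : (σ → ℤ) → ℂ}
    (h : ∀ x, HasSum (fun n => a n * e (pairing n (cpt x y))) (f (cpt x y))) (n : σ → ℤ) :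
    tubeCoeff f n y = a n := by
  have h1 := cubeCoeff_eq_of_hasSum (F := fun x => f (cpt x y))
    (a := fun n => a n * e (Complex.I * pairing n fun i => (y i : ℂ))) (fun x => by
      refine (h x).congr_fun fun n => ?_
      rw [mul_assoc, ← e_add, pairing_cpt, add_comm]) n
  rw [tubeCoeff_eq, h1, mul_assoc, mul_comm (e _), e_neg_mul_self, mul_one]

omit hf in
-- If f stays bounded along the ray y + td, the coefficient is O(exp(2πt n·d)) for every t ≥ 0,
-- which tends to 0 when n·d < 0.
theorem tubeCoeff_eq_zero {y d : σ → ℝ} {C : ℝ} {n : σ → ℤ}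
    (hconst : ∀ t : ℝ, 0 ≤ t → tubeCoeff f n y = tubeCoeff f n (y + t • d))
    (hC : ∀ t : ℝ, 0 ≤ t → ∀ x ∈ cube σ, ‖f (cpt x (y + t • d))‖ ≤ C)
    (hn : ∑ s, (n s : ℝ) * d s < 0) : tubeCoeff f n y = 0 := by
  set α := ∑ s, (n s : ℝ) * y s with hα
  set β := ∑ s, (n s : ℝ) * d s with hβ
  have h1 : ∀ t : ℝ, 0 ≤ t → ‖tubeCoeff f n y‖ ≤ C * Real.exp (2 * Real.pi * (α + t * β)) := by
    intro t ht
    rw [hconst t ht]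
    refine (norm_tubeCoeff_le (hC t ht) n).trans_eq ?_
    congr 3
    simp only [Pi.add_apply, Pi.smul_apply, smul_eq_mul, mul_add, Finset.sum_add_distrib, hα, hβ,
      Finset.mul_sum]
    congr 1
    exact Finset.sum_congr rfl fun s _ => by ring
  have h2 : Filter.Tendsto (fun t : ℝ => C * Real.exp (2 * Real.pi * (α + t * β)))
      Filter.atTop (nhds 0) := by
    rw [← mul_zero C]
    refine Filter.Tendsto.const_mul C (Real.tendsto_exp_atBot.comp ?_)
    refine Filter.Tendsto.const_mul_atBot Real.two_pi_pos ?_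
    refine Filter.tendsto_atBot_add_const_left _ _ ?_
    exact Filter.tendsto_id.atTop_mul_const_of_neg hn
  have h3 : ‖tubeCoeff f n y‖ ≤ 0 :=
    ge_of_tendsto h2 ((Filter.eventually_ge_atTop 0).mono h1)
  simpa using h3

end IsTubeFunction

end TubeExpansion

/-! ### Invariance of the Eisenstein series -/

/-- Right multiplication on the cosets of the Siegel parabolic. -/
def cosetMulRight (N : symplecticGroup ι ℤ) :
    Quotient (QuotientGroup.rightRel (siegelParabolic ι)) ≃
      Quotient (QuotientGroup.rightRel (siegelParabolic ι)) :=
  Quotient.congr (Equiv.mulRight N) fun M M' => by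
    change (QuotientGroup.rightRel _) M M' ↔ (QuotientGroup.rightRel _) (M * N) (M' * N)
    rw [QuotientGroup.rightRel_apply, QuotientGroup.rightRel_apply, _root_.mul_inv_rev, mul_assoc,
      mul_inv_cancel_left]

theorem cosetMulRight_coset (N M : symplecticGroup ι ℤ) :
    cosetMulRight N (coset M) = coset (M * N) := rfl

/-- Right multiplication permutes the cosets, and a sign disappears in an even power. -/
theorem eisenstein_eq_of_autFactor {k : ℕ} (hk : Even k) (N : symplecticGroup ι ℤ)
    {τ τ' : Matrix ι ι ℂ} (h : ∀ M, autFactor (M * N) τ = autFactor M τ' ∨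
      autFactor (M * N) τ = -autFactor M τ') : eisenstein k τ = eisenstein k τ' := by
  rw [eisenstein_eq_tsum, eisenstein_eq_tsum, ← (cosetMulRight N).tsum_eq]
  refine tsum_congr fun q => ?_
  have hk' : Even (-(k : ℤ)) := by simpa using hk
  rw [← coset_out q, cosetMulRight_coset, cosetTerm_coset hk, cosetTerm_coset hk]
  rcases h q.out with h | h
  · rw [h]
  · rw [h, hk'.neg_zpow]

/-- The Eisenstein series is invariant under integral translations. -/
theorem eisenstein_add_intCast {k : ℕ} (hk : Even k) (τ : Matrix ι ι ℂ) {N : Matrix ι ι ℤ}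
    (hN : N.IsSymm) : eisenstein k (τ + N.map Int.cast) = eisenstein k τ := by
  refine (eisenstein_eq_of_autFactor hk (unip N hN) fun M => Or.inl ?_).symm
  obtain ⟨hA, hB, hC, hD⟩ := fromBlocks_blocks_eq_map (unip N hN) rfl
  obtain ⟨-, -, h3, h4⟩ := blocks_mul M (unip N hN)
  rw [autFactor, h3, h4, hA, hB, hC, hD, autFactor]
  congr 1
  simp [Matrix.mul_add, add_assoc]

/-- The Eisenstein series is invariant under unimodular changes of variables. -/
theorem eisenstein_conj {k : ℕ} (hk : Even k) (τ : Matrix ι ι ℂ) {U : Matrix ι ι ℤ}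
    (hU : IsUnit U.det) :
    eisenstein k (U.map Int.cast * τ * (U.map Int.cast)ᵀ) = eisenstein k τ := by
  have hV : IsUnit (U⁻¹ᵀ).det := by
    rw [det_transpose]
    exact isUnit_nonsing_inv_det U hU
  -- This element is diag(U, U⁻ᵀ), which acts by τ ↦ UτUᵀ.
  refine (eisenstein_eq_of_autFactor hk (levi (U⁻¹ᵀ) hV) fun M => ?_).symm
  obtain ⟨hA, hB, hC, hD⟩ := fromBlocks_blocks_eq_map (levi (U⁻¹ᵀ) hV) rfl
  obtain ⟨-, -, h3, h4⟩ := blocks_mul M (levi (U⁻¹ᵀ) hV)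
  have hinv : ((U⁻¹ᵀ)⁻¹)ᵀ = U := by
    rw [transpose_nonsing_inv, transpose_transpose, nonsing_inv_nonsing_inv _ hU]
  rw [hinv] at hA
  have h5 : ((U⁻¹ᵀ).map (Int.cast : ℤ → ℂ)).det = 1 ∨
      ((U⁻¹ᵀ).map (Int.cast : ℤ → ℂ)).det = -1 := by
    have h6 : ((U⁻¹ᵀ).map (Int.cast : ℤ → ℂ)).det = (((U⁻¹ᵀ).det : ℤ) : ℂ) :=
      ((Int.castRingHom ℂ).map_det _).symm
    rw [h6]
    rcases Int.isUnit_iff.1 hV with h | h <;> simp [h]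
  have h7 : (U.map (Int.cast : ℤ → ℂ))ᵀ * (U⁻¹ᵀ).map (Int.cast : ℤ → ℂ) = 1 := by
    have h8 : Uᵀ * U⁻¹ᵀ = 1 := by
      rw [← transpose_mul, nonsing_inv_mul _ hU, transpose_one]
    have h9 := congrArg (fun X : Matrix ι ι ℤ => X.map (Int.castRingHom ℂ)) h8
    simp only [Matrix.map_mul] at h9
    rw [← transpose_map]
    simpa using h9
  have h8 : autFactor (M * levi (U⁻¹ᵀ) hV) τ =
      autFactor M (U.map Int.cast * τ * (U.map Int.cast)ᵀ) *
        ((U⁻¹ᵀ).map (Int.cast : ℤ → ℂ)).det := by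
    rw [autFactor, h3, h4, hA, hB, hC, hD, autFactor, ← det_mul]
    congr 1
    rw [Matrix.map_zero _ Int.cast_zero, Matrix.mul_zero, Matrix.mul_zero, add_zero, zero_add,
      Matrix.add_mul, Matrix.mul_assoc (blockC M), Matrix.mul_assoc (blockC M) (_ * _),
      Matrix.mul_assoc (U.map Int.cast * τ), h7, Matrix.mul_one]
  rcases h5 with h | h
  · left
    rw [h8, h, mul_one]
  · right
    rw [h8, h, mul_neg_one]

section

variable {κ : Type*} [Fintype κ] [DecidableEq κ]

theorem submatrix_sumCongr_mem (f : ι ≃ κ) {M : Matrix (κ ⊕ κ) (κ ⊕ κ) ℤ}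
    (hM : M ∈ symplecticGroup κ ℤ) :
    M.submatrix (Equiv.sumCongr f f) (Equiv.sumCongr f f) ∈ symplecticGroup ι ℤ := by
  rw [SymplecticGroup.mem_iff] at hM ⊢
  have hJ : J ι ℤ = (J κ ℤ).submatrix (Equiv.sumCongr f f) (Equiv.sumCongr f f) := by
    ext (i | i) (j | j) <;> simp [J, Matrix.one_apply]
  rw [hJ, transpose_submatrix, submatrix_mul_equiv, submatrix_mul_equiv, hM]

/-- Renaming the indices of symplectic matrices. -/
def symplecticReindex (f : ι ≃ κ) : symplecticGroup ι ℤ ≃* symplecticGroup κ ℤ where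
  toFun M := ⟨_, submatrix_sumCongr_mem f.symm M.2⟩
  invFun M := ⟨_, submatrix_sumCongr_mem f M.2⟩
  left_inv M := by
    ext (i | i) (j | j) <;> simp
  right_inv M := by
    ext (i | i) (j | j) <;> simp
  map_mul' M N := by
    refine Subtype.ext ?_
    change ((M : Matrix (ι ⊕ ι) (ι ⊕ ι) ℤ) * (N : Matrix (ι ⊕ ι) (ι ⊕ ι) ℤ)).submatrix _ _ = _
    exact (submatrix_mul_equiv _ _ _ _ _).symm

theorem symplecticReindex_mem_iff (f : ι ≃ κ) (M : symplecticGroup ι ℤ) :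
    symplecticReindex f M ∈ siegelParabolic κ ↔ M ∈ siegelParabolic ι := by
  change Matrix.toBlocks₂₁ _ = 0 ↔ Matrix.toBlocks₂₁ _ = 0
  constructor
  · intro h
    ext i j
    simpa [symplecticReindex, toBlocks₂₁] using congrFun (congrFun h (f i)) (f j)
  · intro h
    ext i j
    simpa [symplecticReindex, toBlocks₂₁] using congrFun (congrFun h (f.symm i)) (f.symm j)

/-- Renaming the indices does not change the Eisenstein series. -/
theorem eisenstein_submatrix {k : ℕ} (hk : Even k) (f : ι ≃ κ) (τ : Matrix κ κ ℂ) :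
    eisenstein k (τ.submatrix f f) = eisenstein k τ := by
  let E : Quotient (QuotientGroup.rightRel (siegelParabolic ι)) ≃
      Quotient (QuotientGroup.rightRel (siegelParabolic κ)) :=
    Quotient.congr (symplecticReindex f).toEquiv fun M M' => by
      change (QuotientGroup.rightRel _) M M' ↔
        (QuotientGroup.rightRel _) (symplecticReindex f M) (symplecticReindex f M')
      rw [QuotientGroup.rightRel_apply, QuotientGroup.rightRel_apply, ← map_inv, ← map_mul,
        symplecticReindex_mem_iff]
  rw [eisenstein_eq_tsum, eisenstein_eq_tsum, ← E.tsum_eq]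
  refine tsum_congr fun q => ?_
  have h1 : E (coset q.out) = coset (symplecticReindex f q.out) := rfl
  rw [← coset_out q, h1, cosetTerm_coset hk, cosetTerm_coset hk]
  congr 1
  have h2 : blockC (symplecticReindex f q.out) = (blockC q.out).submatrix f.symm f.symm := rfl
  have h3 : blockD (symplecticReindex f q.out) = (blockD q.out).submatrix f.symm f.symm := rfl
  rw [autFactor, autFactor, h2, h3, ← det_submatrix_equiv_self f]
  congr 1
  ext i j
  simp only [Matrix.add_apply, submatrix_apply, Equiv.symm_apply_apply, Matrix.mul_apply]
  congr 1
  exact Fintype.sum_equiv f _ _ fun l => by simp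

end

/-! ### Cosets that come from genus one less -/

/-- A vector of integers without common divisor is mapped to a basis vector by some unimodular
matrix. -/
theorem exists_unimodular_mulVec_eq_single (i₀ : ι) (a : ι → ℤ)
    (ha : ∀ d : ℤ, (∀ i, d ∣ a i) → IsUnit d) :
    ∃ U : Matrix ι ι ℤ, IsUnit U.det ∧ U *ᵥ a = Pi.single i₀ 1 := by
  induction hn : ∑ i, (a i).natAbs using Nat.strong_induction_on generalizing a with
  | _ n ih =>
  -- Euclid's algorithm: as long as two entries are nonzero, adding ± one to the other lowers the
  -- sum of absolute values. Otherwise a single entry is left, and it is a unit.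
  by_cases h : ∃ i j, i ≠ j ∧ a i ≠ 0 ∧ (a i).natAbs ≤ (a j).natAbs
  · obtain ⟨i, j, hij, hi, hle⟩ := h
    have hc : ∃ c : ℤ, (a j + c * a i).natAbs < (a j).natAbs := by
      rcases le_or_gt 0 (a i) with h1 | h1 <;> rcases le_or_gt 0 (a j) with h2 | h2
      · exact ⟨-1, by omega⟩
      · exact ⟨1, by omega⟩
      · exact ⟨1, by omega⟩
      · exact ⟨-1, by omega⟩
    obtain ⟨c, hc⟩ := hc
    set a' := transvection j i c *ᵥ a with ha'
    have hj : a' j = a j + c * a i := by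
      simp [ha', transvection, add_mulVec, single_mulVec, Function.update]
    have hl : ∀ l, l ≠ j → a' l = a l := by
      intro l hl
      simp [ha', transvection, add_mulVec, single_mulVec, hl]
    obtain ⟨U, hU, hUa⟩ := ih (∑ i, (a' i).natAbs) (by
      rw [← hn]
      refine Finset.sum_lt_sum (fun l _ => ?_) ⟨j, Finset.mem_univ j, by rwa [hj]⟩
      rcases eq_or_ne l j with rfl | h
      · rw [hj]
        exact hc.le
      · rw [hl l h]) a' (fun d hd => ha d fun l => by
        rcases eq_or_ne l j with rfl | h
        · have h1 := hd l
          have h2 := hd i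
          rw [hj] at h1
          rw [hl i hij] at h2
          exact (dvd_add_left (dvd_mul_of_dvd_right h2 c)).1 h1
        · rw [← hl l h]
          exact hd l) rfl
    refine ⟨U * transvection j i c, ?_, ?_⟩
    · rw [det_mul, det_transvection_of_ne j i hij.symm, mul_one]
      exact hU
    · rw [← mulVec_mulVec, ← ha', hUa]
  · push Not at h
    have hne : ∃ i, a i ≠ 0 := by
      by_contra! h0
      exact not_isUnit_zero (ha 0 fun i => by rw [h0 i])
    obtain ⟨i, hi⟩ := hne
    have hz : ∀ j, j ≠ i → a j = 0 := by
      intro j hj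
      by_contra h0
      have h1 := h i j hj.symm hi
      have h2 := h j i hj h0
      omega
    have hu : IsUnit (a i) := ha (a i) fun j => by
      rcases eq_or_ne j i with rfl | hj
      · exact dvd_rfl
      · rw [hz j hj]
        exact dvd_zero _
    have ha2 : a = Pi.single i (a i) := by
      ext j
      rcases eq_or_ne j i with rfl | hj
      · simp
      · simp [hz j hj, hj]
    have hsq : a i * a i = 1 := by
      rcases Int.isUnit_iff.1 hu with h | h <;> simp [h]
    refine ⟨(diagonal fun _ : ι => a i).submatrix (Equiv.swap i i₀) id, ?_, ?_⟩
    · rw [det_permute, det_diagonal, Finset.prod_const]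
      exact ((Units.isUnit _).map (Int.castRingHom ℤ)).mul (hu.pow _)
    · ext j
      have h1 : ((diagonal fun _ : ι => a i).submatrix (Equiv.swap i i₀) id *ᵥ a) j =
          a i * a (Equiv.swap i i₀ j) := by
        simp [mulVec, dotProduct, Matrix.diagonal_apply]
      rw [h1]
      rcases eq_or_ne j i₀ with rfl | hj
      · simp [hsq]
      · have h2 : Equiv.swap i i₀ j ≠ i := by
          intro h3
          rw [Equiv.swap_apply_eq_iff, Equiv.swap_apply_left] at h3
          exact hj h3
        rw [hz _ h2]
        simp [hj]


theorem toBlocks₁₁_inv (M : symplecticGroup ι ℤ) :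
    ((M⁻¹ : symplecticGroup ι ℤ) : Matrix (ι ⊕ ι) (ι ⊕ ι) ℤ).toBlocks₁₁ =
      ((M : Matrix (ι ⊕ ι) (ι ⊕ ι) ℤ).toBlocks₂₂)ᵀ := by
  rw [SymplecticGroup.coe_inv]
  conv_lhs => rw [← fromBlocks_toBlocks (M : Matrix (ι ⊕ ι) (ι ⊕ ι) ℤ)]
  simp [Matrix.J, fromBlocks_transpose, fromBlocks_multiply, fromBlocks_neg]

/-- Two elements of `Sp(ℤ)` are in the same coset if and only if their lower rows `(C, D)` span the
same lattice. -/
theorem coset_eq_iff_toBlocks {M N : symplecticGroup ι ℤ} :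
    coset M = coset N ↔
      (N : Matrix (ι ⊕ ι) (ι ⊕ ι) ℤ).toBlocks₂₁ * ((M : Matrix (ι ⊕ ι) (ι ⊕ ι) ℤ).toBlocks₂₂)ᵀ =
      (N : Matrix (ι ⊕ ι) (ι ⊕ ι) ℤ).toBlocks₂₂ *
        ((M : Matrix (ι ⊕ ι) (ι ⊕ ι) ℤ).toBlocks₂₁)ᵀ := by
  rw [coset_eq_iff]
  change Matrix.toBlocks₂₁ _ = 0 ↔ _
  rw [Submonoid.coe_mul, toBlocks₂₁_mul, toBlocks₁₁_inv, toBlocks₂₁_inv, Matrix.mul_neg,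
    ← sub_eq_add_neg, sub_eq_zero]

section

variable {κ : Type*} [Fintype κ] [DecidableEq κ]

/-- The embedding of the symplectic group into the one of genus one more. -/
def embed (M : symplecticGroup κ ℤ) : symplecticGroup (Unit ⊕ κ) ℤ :=
  ⟨fromBlocks (fromBlocks 1 0 0 (M : Matrix (κ ⊕ κ) (κ ⊕ κ) ℤ).toBlocks₁₁)
    (fromBlocks 0 0 0 (M : Matrix (κ ⊕ κ) (κ ⊕ κ) ℤ).toBlocks₁₂)
    (fromBlocks 0 0 0 (M : Matrix (κ ⊕ κ) (κ ⊕ κ) ℤ).toBlocks₂₁)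
    (fromBlocks 1 0 0 (M : Matrix (κ ⊕ κ) (κ ⊕ κ) ℤ).toBlocks₂₂), by
    have h := M.2
    rw [← fromBlocks_toBlocks (M : Matrix (κ ⊕ κ) (κ ⊕ κ) ℤ),
      SymplecticGroup.fromBlocks_mem_iff] at h
    obtain ⟨h1, h2, h3⟩ := h
    rw [SymplecticGroup.fromBlocks_mem_iff]
    simp [fromBlocks_transpose, fromBlocks_multiply, h1, h2, sub_eq_add_neg, fromBlocks_neg,
      fromBlocks_add, ← fromBlocks_one]
    rw [← sub_eq_add_neg, h3]⟩

theorem coset_embed_eq_iff {M N : symplecticGroup κ ℤ} :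
    coset (embed M) = coset (embed N) ↔ coset M = coset N := by
  rw [coset_eq_iff_toBlocks, coset_eq_iff_toBlocks]
  simp [embed, fromBlocks_transpose, fromBlocks_multiply, fromBlocks_inj]

theorem autFactor_embed (M : symplecticGroup κ ℤ) (z : Matrix Unit Unit ℂ) (τ : Matrix κ κ ℂ) :
    autFactor (embed M) (fromBlocks z 0 0 τ) = autFactor M τ := by
  obtain ⟨-, -, h3, h4⟩ := fromBlocks_blocks_eq_map (embed M) rfl
  rw [autFactor, h3, h4, fromBlocks_map, fromBlocks_map, fromBlocks_multiply, fromBlocks_add]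
  simp [autFactor, blockC, blockD]

/-- When the first column of C is zero, the first column of A is primitive and a Levi element moves
it to the first basis vector. The symplectic relations then give C and D the shape of an embedded
element, up to a column of D that does not affect the coset. -/
theorem exists_embed_of_toBlocks₂₁_eq_zero (M : symplecticGroup (Unit ⊕ κ) ℤ)
    (h : ∀ i, (M : Matrix ((Unit ⊕ κ) ⊕ (Unit ⊕ κ)) ((Unit ⊕ κ) ⊕ (Unit ⊕ κ)) ℤ).toBlocks₂₁ i (Sum.inl ()) = 0) :
    ∃ N : symplecticGroup κ ℤ, coset M = coset (embed N) := by
  set A := (M : Matrix ((Unit ⊕ κ) ⊕ (Unit ⊕ κ)) ((Unit ⊕ κ) ⊕ (Unit ⊕ κ)) ℤ).toBlocks₁₁ with hA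
  set B := (M : Matrix ((Unit ⊕ κ) ⊕ (Unit ⊕ κ)) ((Unit ⊕ κ) ⊕ (Unit ⊕ κ)) ℤ).toBlocks₁₂ with hB
  set C := (M : Matrix ((Unit ⊕ κ) ⊕ (Unit ⊕ κ)) ((Unit ⊕ κ) ⊕ (Unit ⊕ κ)) ℤ).toBlocks₂₁ with hC
  set D := (M : Matrix ((Unit ⊕ κ) ⊕ (Unit ⊕ κ)) ((Unit ⊕ κ) ⊕ (Unit ⊕ κ)) ℤ).toBlocks₂₂ with hD
  have hM : (M : Matrix ((Unit ⊕ κ) ⊕ (Unit ⊕ κ)) ((Unit ⊕ κ) ⊕ (Unit ⊕ κ)) ℤ) = fromBlocks A B C D := (fromBlocks_toBlocks _).symm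
  have hM' := M.2
  rw [hM, SymplecticGroup.fromBlocks_mem_iff] at hM'
  obtain ⟨-, -, h3⟩ := hM'
  obtain ⟨U, hU, hUa⟩ := exists_unimodular_mulVec_eq_single (Sum.inl () : Unit ⊕ κ)
    (fun i => A i (Sum.inl ())) fun d hd => by
      -- The corner entry of AᵀD - CᵀB = 1 reads ∑ A_{i1} D_{i1} = 1, so the first column of A has
      -- no common divisor.
      have h4 := congrFun (congrFun h3 (Sum.inl ())) (Sum.inl ())
      simp only [Matrix.sub_apply, Matrix.mul_apply, transpose_apply, h, zero_mul,
        Finset.sum_const_zero, sub_zero, one_apply_eq] at h4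
      rw [isUnit_iff_dvd_one, ← h4]
      exact Finset.dvd_sum fun i _ => Dvd.dvd.mul_right (hd i) _
  have hV : IsUnit (U⁻¹ᵀ).det := by
    rw [det_transpose]
    exact isUnit_nonsing_inv_det U hU
  have hinv : ((U⁻¹ᵀ)⁻¹)ᵀ = U := by
    rw [transpose_nonsing_inv, transpose_transpose, nonsing_inv_nonsing_inv _ hU]
  have hM1 : ((levi (U⁻¹ᵀ) hV * M : symplecticGroup (Unit ⊕ κ) ℤ) :
      Matrix ((Unit ⊕ κ) ⊕ (Unit ⊕ κ)) ((Unit ⊕ κ) ⊕ (Unit ⊕ κ)) ℤ) =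
      fromBlocks (U * A) (U * B) (U⁻¹ᵀ * C) (U⁻¹ᵀ * D) := by
    rw [Submonoid.coe_mul, hM]
    change fromBlocks _ _ _ _ * _ = _
    rw [fromBlocks_multiply, hinv]
    simp
  rw [← coset_mul_of_mem (levi_mem _ hV) M]
  set M₁ := levi (U⁻¹ᵀ) hV * M with hM₁
  have h5 := M₁.2
  rw [hM1, SymplecticGroup.fromBlocks_mem_iff] at h5
  have hA0 : ∀ i, (U * A) i (Sum.inl ()) = (Pi.single (Sum.inl ()) 1 : Unit ⊕ κ → ℤ) i :=
    fun i => congrFun hUa i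
  have hC0 : ∀ i, (U⁻¹ᵀ * C) i (Sum.inl ()) = 0 := fun i => by
    simp [Matrix.mul_apply, h]
  generalize U * A = A₁ at hM1 h5 hA0
  generalize U * B = B₁ at hM1 h5
  generalize U⁻¹ᵀ * C = C₁ at hM1 h5 hC0
  generalize U⁻¹ᵀ * D = D₁ at hM1 h5
  obtain ⟨h6, h7, h8⟩ := h5
  -- The first rows of AᵀC = CᵀA and of AᵀD - CᵀB = 1 give the first rows of C and D.
  have hC1 : ∀ j, C₁ (Sum.inl ()) j = 0 := fun j => by
    have h9 := congrFun (congrFun h6 (Sum.inl ())) j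
    simpa [Matrix.mul_apply, hA0, hC0] using h9
  have hD1 : ∀ j, D₁ (Sum.inl ()) j = (1 : Matrix (Unit ⊕ κ) (Unit ⊕ κ) ℤ) (Sum.inl ()) j :=
    fun j => by
    have h9 := congrFun (congrFun h8 (Sum.inl ())) j
    simpa [Matrix.mul_apply, hA0, hC0] using h9
  let N : symplecticGroup κ ℤ := ⟨fromBlocks A₁.toBlocks₂₂ B₁.toBlocks₂₂ C₁.toBlocks₂₂
    D₁.toBlocks₂₂, by
      rw [SymplecticGroup.fromBlocks_mem_iff]
      refine ⟨?_, ?_, ?_⟩ <;> ext i j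
      · have h9 := congrFun (congrFun h6 (Sum.inr i)) (Sum.inr j)
        simpa [Matrix.mul_apply, toBlocks₂₂, hC1] using h9
      · have h9 := congrFun (congrFun h7 (Sum.inr i)) (Sum.inr j)
        simpa [Matrix.mul_apply, toBlocks₂₂, hD1] using h9
      · have h9 := congrFun (congrFun h8 (Sum.inr i)) (Sum.inr j)
        simpa [Matrix.mul_apply, toBlocks₂₂, hD1, hC1, Matrix.one_apply] using h9⟩
  refine ⟨N, ?_⟩
  have h9 := SymplecticGroup.transpose_mem N.2
  change (fromBlocks A₁.toBlocks₂₂ B₁.toBlocks₂₂ C₁.toBlocks₂₂ D₁.toBlocks₂₂)ᵀ ∈ _ at h9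
  rw [fromBlocks_transpose, SymplecticGroup.fromBlocks_mem_iff, transpose_transpose,
    transpose_transpose, transpose_transpose, transpose_transpose] at h9
  rw [coset_eq_iff_toBlocks, hM1, toBlocks_fromBlocks₂₁, toBlocks_fromBlocks₂₂]
  have hC2 : C₁ = fromBlocks 0 0 0 C₁.toBlocks₂₂ := by
    ext (i | i) (j | j)
    · exact hC0 _
    · exact hC1 _
    · exact hC0 _
    · rfl
  -- The lower left block of D is arbitrary, but in the coset criterion it only meets the zero
  -- blocks of C.
  have hD2 : D₁ = fromBlocks 1 0 D₁.toBlocks₂₁ D₁.toBlocks₂₂ := by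
    ext (i | i) (j | j)
    · simpa using hD1 (Sum.inl ())
    · simpa using hD1 (Sum.inr j)
    · rfl
    · rfl
  rw [hC2, hD2]
  simp [embed, N, fromBlocks_transpose, fromBlocks_multiply, h9.2.1]

/-- The map on cosets induced by `embed`. -/
def cosetEmbed (q : Quotient (QuotientGroup.rightRel (siegelParabolic κ))) :
    Quotient (QuotientGroup.rightRel (siegelParabolic (Unit ⊕ κ))) := coset (embed q.out)

theorem cosetEmbed_injective : Function.Injective (cosetEmbed (κ := κ)) := by
  intro q q' h
  rw [cosetEmbed, cosetEmbed, coset_embed_eq_iff, coset_out, coset_out] at h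
  exact h

theorem cosetEmbed_coset (M : symplecticGroup κ ℤ) : cosetEmbed (coset M) = coset (embed M) := by
  rw [cosetEmbed, coset_embed_eq_iff, coset_out]

theorem cosetTerm_cosetEmbed {k : ℕ} (hk : Even k)
    (q : Quotient (QuotientGroup.rightRel (siegelParabolic κ))) (z : Matrix Unit Unit ℂ)
    (τ : Matrix κ κ ℂ) : cosetTerm k (cosetEmbed q) (fromBlocks z 0 0 τ) = cosetTerm k q τ := by
  rw [cosetEmbed, cosetTerm_coset hk, autFactor_embed, cosetTerm]

/-! ### The Siegel operator -/

/-- The point `diag (it, τ)`. -/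
def cuspPoint (t : ℝ) (τ : Matrix κ κ ℂ) : Matrix (Unit ⊕ κ) (Unit ⊕ κ) ℂ :=
  fromBlocks (diagonal fun _ => Complex.I * t) 0 0 τ

/-- The basis vector of the first coordinate. -/
def cuspVec (κ : Type*) [DecidableEq κ] : Unit ⊕ κ → ℝ := Pi.single (Sum.inl ()) 1

theorem cuspPoint_eq (t : ℝ) (τ : Matrix κ κ ℂ) :
    cuspPoint t τ = cuspPoint 1 τ + (Complex.I * ((t - 1 : ℝ) : ℂ)) •
      vecMulVec (fun i => (cuspVec κ i : ℂ)) (fun i => (cuspVec κ i : ℂ)) := by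
  ext (i | i) (j | j)
  · simp [cuspPoint, cuspVec, vecMulVec_apply]
    ring
  · simp [cuspPoint, cuspVec, vecMulVec_apply]
  · simp [cuspPoint, cuspVec, vecMulVec_apply]
  · simp [cuspPoint, cuspVec, vecMulVec_apply]

theorem imGE_cuspPoint {δ t : ℝ} (hδt : δ ≤ t) {τ : Matrix κ κ ℂ} (h : ImGE δ τ) :
    ImGE δ (cuspPoint t τ) := by
  constructor
  · rw [IsSymm, cuspPoint, fromBlocks_transpose, h.1.eq]
    simp
  · intro v
    have h1 := h.2 fun i => v (Sum.inr i)
    have h2 : v ⬝ᵥ ((cuspPoint t τ).map Complex.im) *ᵥ v = t * v (Sum.inl ()) ^ 2 +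
        (fun i => v (Sum.inr i)) ⬝ᵥ (τ.map Complex.im) *ᵥ fun i => v (Sum.inr i) := by
      simp [dotProduct, mulVec, cuspPoint]
      ring
    rw [h2, Fintype.sum_sum_type, mul_add]
    refine add_le_add ?_ h1
    simpa using mul_le_mul_of_nonneg_right hδt (sq_nonneg (v (Sum.inl ())))

theorem ImGE.mono {δ δ' : ℝ} (hδ : δ' ≤ δ) {τ : Matrix ι ι ℂ} (h : ImGE δ τ) : ImGE δ' τ :=
  ⟨h.1, fun v => (mul_le_mul_of_nonneg_right hδ
    (Finset.sum_nonneg fun _ _ => sq_nonneg _)).trans (h.2 v)⟩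

/-- Along the cusp the automorphy factor is linear in t with slope proportional to ζ = wᵀZw. If ζ =
0, positivity gives wZ = 0; by symmetry Zw = 0, hence Cw = 0, and the coset comes from lower genus.
Otherwise the factor grows without bound. -/
theorem tendsto_cosetTerm_cuspPoint {k : ℕ} (hk0 : k ≠ 0) {δ : ℝ} (hδ : 0 < δ)
    {τ : Matrix κ κ ℂ} (h : ImGE δ (cuspPoint 1 τ))
    {q : Quotient (QuotientGroup.rightRel (siegelParabolic (Unit ⊕ κ)))}
    (hq : q ∉ Set.range cosetEmbed) :
    Filter.Tendsto (fun t => cosetTerm k q (cuspPoint t τ)) Filter.atTop (nhds 0) := by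
  set w : Unit ⊕ κ → ℂ := fun i => (cuspVec κ i : ℂ) with hw
  have hζ : w ⬝ᵥ autZ q.out (cuspPoint 1 τ) *ᵥ w ≠ 0 := by
    intro h0
    have h1 := dotProduct_autZ_im q.out hδ h (cuspVec κ)
    rw [← hw, h0, Complex.zero_im, neg_zero] at h1
    have h2 : ∑ i, ‖(w ᵥ* autZ q.out (cuspPoint 1 τ)) i‖ ^ 2 = 0 :=
      le_antisymm (nonpos_of_mul_nonpos_right h1 hδ) (by positivity)
    rw [Finset.sum_eq_zero_iff_of_nonneg fun _ _ => by positivity] at h2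
    have h3 : w ᵥ* autZ q.out (cuspPoint 1 τ) = 0 := by
      ext i
      simpa using h2 i (Finset.mem_univ i)
    have h4 : blockC q.out *ᵥ w = 0 := by
      rw [← autMatrix_mul_autZ q.out hδ h, ← mulVec_mulVec, ← (autZ_isSymm q.out hδ h).eq,
        mulVec_transpose, h3, mulVec_zero]
    obtain ⟨N, hN⟩ := exists_embed_of_toBlocks₂₁_eq_zero q.out fun i => by
      have h5 := congrFun h4 i
      simpa [hw, cuspVec, mulVec, dotProduct, blockC] using h5
    refine hq ⟨coset N, ?_⟩
    rw [cosetEmbed_coset, ← hN, coset_out]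
  have h5 : ∀ t : ℝ, autFactor q.out (cuspPoint t τ) = autFactor q.out (cuspPoint 1 τ) *
      (1 + (Complex.I * ((t - 1 : ℝ) : ℂ)) * (w ⬝ᵥ autZ q.out (cuspPoint 1 τ) *ᵥ w)) := fun t => by
    rw [cuspPoint_eq t, autFactor_add_smul_vecMulVec q.out hδ h]
  rw [tendsto_zero_iff_norm_tendsto_zero]
  simp only [norm_cosetTerm_eq]
  rw [← zero_pow hk0]
  refine Filter.Tendsto.pow ?_ k
  refine Filter.Tendsto.inv_tendsto_atTop ?_
  have h5' : (fun t => ‖autFactor q.out (cuspPoint t τ)‖) = fun t : ℝ =>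
      ‖autFactor q.out (cuspPoint 1 τ)‖ * ‖1 + (Complex.I * ((t - 1 : ℝ) : ℂ)) *
        (w ⬝ᵥ autZ q.out (cuspPoint 1 τ) *ᵥ w)‖ := by
    ext t
    rw [h5 t, norm_mul]
  rw [h5']
  refine Filter.Tendsto.const_mul_atTop (norm_pos_iff.2 (autFactor_ne_zero hδ h q.out)) ?_
  set ζ := w ⬝ᵥ autZ q.out (cuspPoint 1 τ) *ᵥ w with hζd
  -- Reverse triangle inequality, in a form linear in t.
  have h6 : ∀ t : ℝ, t * ‖ζ‖ - (‖ζ‖ + 1) ≤ ‖1 + Complex.I * ((t - 1 : ℝ) : ℂ) * ζ‖ := fun t => by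
    have h7 : ‖Complex.I * ((t - 1 : ℝ) : ℂ) * ζ‖ ≤
        ‖1 + Complex.I * ((t - 1 : ℝ) : ℂ) * ζ‖ + 1 := by
      have := norm_sub_le (1 + Complex.I * ((t - 1 : ℝ) : ℂ) * ζ) 1
      simpa using this
    rw [norm_mul, norm_mul, Complex.norm_I, one_mul, Complex.norm_real] at h7
    have h8 := mul_le_mul_of_nonneg_right (le_abs_self (t - 1)) (norm_nonneg ζ)
    rw [Real.norm_eq_abs] at h7
    linarith
  refine Filter.tendsto_atTop_mono h6 ?_
  exact Filter.tendsto_atTop_add_const_right _ _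
    (Filter.tendsto_id.atTop_mul_const (norm_pos_iff.2 hζ))

/-- The Siegel operator maps Eisenstein series to Eisenstein series. -/
theorem tendsto_eisenstein_cuspPoint {k : ℕ} (hk : Even k) (hk' : Fintype.card κ + 2 < k)
    {τ : Matrix κ κ ℂ} (hτ : τ ∈ siegelUpperHalfSpace κ) :
    Filter.Tendsto (fun t => eisenstein k (cuspPoint t τ)) Filter.atTop
      (nhds (eisenstein k τ)) := by
  classical
  obtain ⟨δ', hδ', h'⟩ := exists_imGE hτ
  obtain ⟨δ, hδ, h1, h2⟩ : ∃ δ : ℝ, 0 < δ ∧ δ ≤ 1 ∧ δ ≤ δ' :=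
    ⟨min 1 δ', lt_min one_pos hδ', min_le_left _ _, min_le_right _ _⟩
  have h := imGE_cuspPoint h1 (h'.mono h2)
  have hcard : Fintype.card (Unit ⊕ κ) + 1 < k := by
    rw [Fintype.card_sum, Fintype.card_unit]
    omega
  -- On embedded cosets the term does not depend on t, so its value at t = 1 is already the limit;
  -- the other terms tend to 0.
  have hlim : eisenstein k τ = ∑' q, (Set.range cosetEmbed).indicator
      (fun q => cosetTerm k q (cuspPoint 1 τ)) q := by
    rw [eisenstein_eq_tsum, ← cosetEmbed_injective.tsum_eq Set.support_indicator_subset]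
    refine tsum_congr fun q => ?_
    rw [Set.indicator_of_mem (Set.mem_range_self q), cuspPoint, cosetTerm_cosetEmbed hk]
  rw [hlim]
  refine tendsto_tsum_of_dominated_convergence
    (summable_norm_cosetTerm hk hcard (h.mem hδ)) (fun q => ?_) ?_
  · by_cases hq : q ∈ Set.range cosetEmbed
    · rw [Set.indicator_of_mem hq]
      obtain ⟨q, rfl⟩ := hq
      refine (Filter.tendsto_congr fun t => ?_).2 tendsto_const_nhds
      change cosetTerm k _ _ = _
      rw [cuspPoint, cuspPoint, cosetTerm_cosetEmbed hk, cosetTerm_cosetEmbed hk]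
    · rw [Set.indicator_of_notMem hq]
      exact tendsto_cosetTerm_cuspPoint (by omega) hδ h hq
  -- Raising t only increases the automorphy factor, so the terms at t = 1 dominate.
  · filter_upwards [Filter.eventually_ge_atTop 1] with t ht q
    change ‖cosetTerm k q _‖ ≤ _
    rw [norm_cosetTerm_eq, norm_cosetTerm_eq]
    refine pow_le_pow_left₀ (by positivity) ?_ k
    refine inv_anti₀ (norm_pos_iff.2 (autFactor_ne_zero hδ h q.out)) ?_
    rw [cuspPoint_eq t]
    exact norm_autFactor_le_add_smul_vecMulVec q.out hδ h (sub_nonneg.2 ht) _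

end

/-! ### The Eisenstein series as a function on a tube -/

theorem ImGE.perturb {δ ε : ℝ} {τ τ' : Matrix ι ι ℂ} (h : ImGE δ τ) (hs : τ'.IsSymm)
    (hε : ∀ i j, ‖τ' i j - τ i j‖ ≤ ε) : ImGE (δ - Fintype.card ι * ε) τ' := by
  refine ⟨hs, fun v => ?_⟩
  have h1 : v ⬝ᵥ (τ'.map Complex.im) *ᵥ v = v ⬝ᵥ (τ.map Complex.im) *ᵥ v +
      ∑ i, ∑ j, v i * (τ' i j - τ i j).im * v j := by
    simp only [dotProduct, mulVec, map_apply, Finset.mul_sum, ← Finset.sum_add_distrib,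
      Complex.sub_im]
    exact Finset.sum_congr rfl fun i _ => Finset.sum_congr rfl fun j _ => by ring
  have h2 : -(Fintype.card ι * ε * ∑ i, v i ^ 2) ≤
      ∑ i, ∑ j, v i * (τ' i j - τ i j).im * v j := by
    have h3 : ∑ i, ∑ j, ε * (2⁻¹ * (v i ^ 2 + v j ^ 2)) = Fintype.card ι * ε * ∑ i, v i ^ 2 := by
      simp only [← Finset.mul_sum, Finset.sum_add_distrib, Finset.sum_const, Finset.card_univ,
        nsmul_eq_mul]
      ring
    rw [← h3, ← Finset.sum_neg_distrib]
    refine Finset.sum_le_sum fun i _ => ?_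
    rw [← Finset.sum_neg_distrib]
    refine Finset.sum_le_sum fun j _ => ?_
    have h4 := (Complex.abs_im_le_norm (τ' i j - τ i j)).trans (hε i j)
    have h5 : |v i * (τ' i j - τ i j).im * v j| ≤ ε * (2⁻¹ * (v i ^ 2 + v j ^ 2)) := by
      have h6 : |v i| * |v j| ≤ 2⁻¹ * (v i ^ 2 + v j ^ 2) := by
        rw [← sq_abs (v i), ← sq_abs (v j)]
        linarith [two_mul_le_add_sq |v i| |v j|]
      rw [abs_mul, abs_mul, mul_comm |v i|, mul_assoc]
      exact mul_le_mul h4 h6 (by positivity) ((abs_nonneg _).trans h4)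
    linarith [neg_abs_le (v i * (τ' i j - τ i j).im * v j)]
  rw [h1, sub_mul]
  linarith [h.2 v]

theorem ImGE.add_smul_vecMulVec {δ t : ℝ} {τ : Matrix ι ι ℂ} (h : ImGE δ τ) (ht : 0 ≤ t)
    (v : ι → ℝ) : ImGE δ (τ + (Complex.I * t) •
      vecMulVec (fun i => (v i : ℂ)) (fun i => (v i : ℂ))) := by
  refine ⟨?_, fun u => ?_⟩
  · ext i j
    simp only [transpose_apply, Matrix.add_apply, Matrix.smul_apply, vecMulVec_apply, h.1.apply i j,
      mul_comm]
  · have h1 : (τ + (Complex.I * t) • vecMulVec (fun i => (v i : ℂ)) (fun i => (v i : ℂ))).map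
        Complex.im = τ.map Complex.im + t • vecMulVec v v := by
      ext i j
      simp [vecMulVec_apply, mul_assoc, ← Complex.ofReal_mul]
    have h2 : u ⬝ᵥ (vecMulVec v v) *ᵥ u = (v ⬝ᵥ u) ^ 2 := by
      rw [vecMulVec_mulVec, sq]
      simp [dotProduct_smul, dotProduct_comm]
    rw [h1, add_mulVec, dotProduct_add, smul_mulVec, dotProduct_smul, h2, smul_eq_mul]
    linarith [h.2 u, mul_nonneg ht (sq_nonneg (v ⬝ᵥ u))]

theorem norm_cosetTerm_add_smul_vecMulVec_le {δ t : ℝ} (hδ : 0 < δ) {τ : Matrix ι ι ℂ}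
    (h : ImGE δ τ) (ht : 0 ≤ t) (v : ι → ℝ) (k : ℕ)
    (q : Quotient (QuotientGroup.rightRel (siegelParabolic ι))) :
    ‖cosetTerm k q (τ + (Complex.I * t) •
      vecMulVec (fun i => (v i : ℂ)) (fun i => (v i : ℂ)))‖ ≤ ‖cosetTerm k q τ‖ := by
  rw [norm_cosetTerm_eq, norm_cosetTerm_eq]
  refine pow_le_pow_left₀ (by positivity) ?_ k
  refine inv_anti₀ (norm_pos_iff.2 (autFactor_ne_zero hδ h q.out)) ?_
  exact norm_autFactor_le_add_smul_vecMulVec q.out hδ h ht v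

/-- Locally uniform domination of the Eisenstein series. -/
theorem exists_locally_dominated {k : ℕ} (hk : Even k) (hk' : Fintype.card ι + 1 < k)
    {τ : Matrix ι ι ℂ} (hτ : τ ∈ siegelUpperHalfSpace ι) :
    ∃ ε > 0, ∃ u : Quotient (QuotientGroup.rightRel (siegelParabolic ι)) → ℝ, Summable u ∧
      ∀ τ' : Matrix ι ι ℂ, τ'.IsSymm → (∀ i j, ‖τ' i j - τ i j‖ ≤ ε) →
        τ' ∈ siegelUpperHalfSpace ι ∧ ∀ q, ‖cosetTerm k q τ'‖ ≤ u q := by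
  obtain ⟨δ, hδ, h⟩ := exists_imGE hτ
  have hc : (0 : ℝ) < Fintype.card ι + 1 := by positivity
  -- Small enough that the lower bound δ of Im τ loses at most half; the added 1 covers the empty
  -- index type.
  set ε : ℝ := δ / 2 / (Fintype.card ι + 1) with hε
  have hε0 : 0 < ε := by positivity
  have hδ' : 0 < δ - Fintype.card ι * ε := by
    have : (Fintype.card ι + 1) * ε = δ / 2 := by
      rw [hε]
      field_simp
    nlinarith
  refine ⟨ε, hε0, fun q => compConst ι (δ - Fintype.card ι * ε) ε ^ k * ‖cosetTerm k q τ‖,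
    (summable_norm_cosetTerm hk hk' hτ).mul_left _, fun τ' hs hε' => ?_⟩
  have h' := h.perturb hs hε'
  refine ⟨h'.mem hδ', fun q => norm_cosetTerm_le hδ' hδ h' h (fun i j => ?_) k q⟩
  rw [norm_sub_rev]
  exact hε' i j

/-- The symmetric matrix with given entries. -/
def symMat {R : Type*} (z : Sym2 ι → R) : Matrix ι ι R := Matrix.of fun i j => z s(i, j)

theorem symMat_apply {R : Type*} (z : Sym2 ι → R) (i j : ι) : symMat z i j = z s(i, j) := rfl

theorem symMat_isSymm {R : Type*} (z : Sym2 ι → R) : (symMat z).IsSymm := by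
  ext i j
  simp [symMat, Sym2.eq_swap]

/-- The entries of a symmetric matrix. -/
def symVec {R : Type*} (T : Matrix ι ι R) (p : Sym2 ι) : R := T p.out.1 p.out.2

theorem symMat_symVec {R : Type*} {T : Matrix ι ι R} (hT : T.IsSymm) : symMat (symVec T) = T := by
  ext i j
  rw [symMat_apply, symVec]
  have h : s((s(i, j)).out.1, (s(i, j)).out.2) = s(i, j) := Quot.out_eq _
  rcases Sym2.eq_iff.1 h with ⟨h1, h2⟩ | ⟨h1, h2⟩
  · rw [h1, h2]
  · rw [h1, h2, hT.apply i j]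

section

variable {κ : Type*} [Fintype κ] [DecidableEq κ] (τ₂ : Matrix ι κ ℂ) (τ₄ : Matrix κ κ ℂ)

/-- The point `(τ₁ τ₂; τ₂ᵀ τ₄)`. -/
def blockPoint (τ₁ : Matrix ι ι ℂ) : Matrix (ι ⊕ κ) (ι ⊕ κ) ℂ := fromBlocks τ₁ τ₂ τ₂ᵀ τ₄

/-- The admissible imaginary parts of `τ₁`. -/
def heights : Set (Sym2 ι → ℝ) :=
  {y | τ₄.IsSymm ∧ (fromBlocks (symMat y) (τ₂.map Complex.im) (τ₂.map Complex.im)ᵀ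
    (τ₄.map Complex.im)).PosDef}

theorem blockPoint_map_im (τ₁ : Matrix ι ι ℂ) : (blockPoint τ₂ τ₄ τ₁).map Complex.im =
    fromBlocks (τ₁.map Complex.im) (τ₂.map Complex.im) (τ₂.map Complex.im)ᵀ (τ₄.map Complex.im) := by
  rw [blockPoint, fromBlocks_map, transpose_map]

theorem blockPoint_isSymm {τ₁ : Matrix ι ι ℂ} :
    (blockPoint τ₂ τ₄ τ₁).IsSymm ↔ τ₁.IsSymm ∧ τ₄.IsSymm := by
  rw [IsSymm, blockPoint, fromBlocks_transpose, fromBlocks_inj]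
  simp [IsSymm]

theorem mem_tube_heights {z : Sym2 ι → ℂ} : z ∈ tube (heights τ₂ τ₄) ↔
    blockPoint τ₂ τ₄ (symMat z) ∈ siegelUpperHalfSpace (ι ⊕ κ) := by
  rw [siegelUpperHalfSpace, Set.mem_ofPred_eq, blockPoint_isSymm, blockPoint_map_im]
  simp only [symMat_isSymm, true_and]
  rfl

theorem mem_heights_iff {y : Sym2 ι → ℝ} : y ∈ heights τ₂ τ₄ ↔
    blockPoint τ₂ τ₄ (symMat (cpt 0 y)) ∈ siegelUpperHalfSpace (ι ⊕ κ) := by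
  rw [← mem_tube_heights]
  simp [tube, im_cpt]

theorem norm_blockPoint_sub_le (z z' : Sym2 ι → ℂ) (i j : ι ⊕ κ) :
    ‖blockPoint τ₂ τ₄ (symMat z') i j - blockPoint τ₂ τ₄ (symMat z) i j‖ ≤ ‖z' - z‖ := by
  rcases i with i | i <;> rcases j with j | j
  · exact norm_le_pi_norm (z' - z) s(i, j)
  all_goals simp [blockPoint]

theorem exists_ball_dominated {k : ℕ} (hk : Even k) (hk' : Fintype.card (ι ⊕ κ) + 1 < k)
    {z : Sym2 ι → ℂ} (hz : z ∈ tube (heights τ₂ τ₄)) :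
    ∃ ε > 0, ∃ u : Quotient (QuotientGroup.rightRel (siegelParabolic (ι ⊕ κ))) → ℝ,
      Summable u ∧ ∀ z' ∈ Metric.ball z ε, z' ∈ tube (heights τ₂ τ₄) ∧
        ∀ q, ‖cosetTerm k q (blockPoint τ₂ τ₄ (symMat z'))‖ ≤ u q := by
  rw [mem_tube_heights] at hz
  obtain ⟨ε, hε, u, hu, h⟩ := exists_locally_dominated hk hk' hz
  refine ⟨ε, hε, u, hu, fun z' hz' => ?_⟩
  rw [mem_tube_heights]
  refine h _ ((blockPoint_isSymm _ _).2 ⟨symMat_isSymm _, ((blockPoint_isSymm _ _).1 hz.1).2⟩)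
    fun i j => (norm_blockPoint_sub_le τ₂ τ₄ z z' i j).trans ?_
  rw [← dist_eq_norm]
  exact (Metric.mem_ball.1 hz').le

theorem isOpen_heights : IsOpen (heights τ₂ τ₄) := by
  rw [Metric.isOpen_iff]
  intro y hy
  rw [mem_heights_iff] at hy
  -- Openness has nothing to do with the weight; some large even k is chosen to apply the domination
  -- lemma.
  obtain ⟨k, hk, hk'⟩ : ∃ k, Even k ∧ Fintype.card (ι ⊕ κ) + 1 < k :=
    ⟨2 * (Fintype.card (ι ⊕ κ) + 1), even_two_mul _, by omega⟩
  obtain ⟨ε, hε, u, hu, h⟩ := exists_ball_dominated τ₂ τ₄ hk hk' ((mem_tube_heights _ _).2 hy)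
  refine ⟨ε, hε, fun y' hy' => ?_⟩
  rw [mem_heights_iff, ← mem_tube_heights]
  refine (h _ ?_).1
  rw [Metric.mem_ball, dist_eq_norm] at hy' ⊢
  refine lt_of_le_of_lt ?_ hy'
  refine (pi_norm_le_iff_of_nonneg (norm_nonneg _)).2 fun s => ?_
  have h1 : (cpt 0 y' - cpt 0 y) s = Complex.I * ((y' - y) s : ℝ) := by
    simp [cpt]
    ring
  rw [h1, norm_mul, Complex.norm_I, one_mul, Complex.norm_real]
  exact norm_le_pi_norm (y' - y) s

theorem convex_heights : Convex ℝ (heights τ₂ τ₄) := by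
  rw [convex_iff_forall_pos]
  intro y hy y' hy' a b ha hb hab
  refine ⟨hy.1, ?_⟩
  have h := (hy.2.smul ha).add (hy'.2.smul hb)
  rw [fromBlocks_smul, fromBlocks_smul, fromBlocks_add, ← add_smul, ← add_smul, ← add_smul, hab,
    one_smul, one_smul, one_smul] at h
  exact h

/-- The Eisenstein series as a function of `τ₁`. -/
def jacobiFun (k : ℕ) (z : Sym2 ι → ℂ) : ℂ := eisenstein k (blockPoint τ₂ τ₄ (symMat z))

theorem continuous_autFactor (M : symplecticGroup ι ℤ) : Continuous (autFactor M) := by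
  unfold autFactor
  fun_prop

theorem continuous_blockPoint : Continuous fun z : Sym2 ι → ℂ => blockPoint τ₂ τ₄ (symMat z) := by
  refine continuous_matrix fun i j => ?_
  rcases i with i | i <;> rcases j with j | j
  · exact continuous_apply s(i, j)
  all_goals exact continuous_const

theorem differentiable_autFactor_line (M : symplecticGroup (ι ⊕ κ) ℤ) (z d : Sym2 ι → ℂ) :
    Differentiable ℂ fun w : ℂ => autFactor M (blockPoint τ₂ τ₄ (symMat (z + w • d))) := by
  have h : ∀ i j, Differentiable ℂ fun w : ℂ => blockPoint τ₂ τ₄ (symMat (z + w • d)) i j := by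
    intro i j
    rcases i with i | i <;> rcases j with j | j
    · change Differentiable ℂ fun w : ℂ => z s(i, j) + w * d s(i, j)
      fun_prop
    all_goals exact differentiable_const _
  simp only [autFactor, det_apply, Matrix.add_apply, Matrix.mul_apply]
  refine Differentiable.fun_sum fun p _ => Differentiable.const_smul ?_ _
  refine Differentiable.fun_finsetProd fun i _ => ?_
  refine Differentiable.add (Differentiable.fun_sum fun l _ => ?_) (differentiable_const _)
  exact (differentiable_const _).mul (h _ _)

/-- Locally dominated series of continuous, holomorphic terms keep these properties; periodicity is
invariance under the translations diag(N, 0). -/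
theorem isTubeFunction_jacobiFun {k : ℕ} (hk : Even k) (hk' : Fintype.card (ι ⊕ κ) + 1 < k) :
    IsTubeFunction (jacobiFun τ₂ τ₄ k) (heights τ₂ τ₄) where
  isOpen := isOpen_heights τ₂ τ₄
  convex := convex_heights τ₂ τ₄
  cont := by
    intro z hz
    refine ContinuousAt.continuousWithinAt ?_
    obtain ⟨ε, hε, u, hu, h⟩ := exists_ball_dominated τ₂ τ₄ hk hk' hz
    refine ContinuousOn.continuousAt ?_ (Metric.ball_mem_nhds z hε)
    refine continuousOn_tsum (fun q => ?_) hu fun q z' hz' => (h z' hz').2 q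
    refine ContinuousOn.zpow₀ (((continuous_autFactor _).comp
      (continuous_blockPoint τ₂ τ₄)).continuousOn) _ fun z' hz' => Or.inl ?_
    obtain ⟨δ, hδ, h'⟩ := exists_imGE ((mem_tube_heights _ _).1 (h z' hz').1)
    exact autFactor_ne_zero hδ h' _
  diff := by
    intro z hz d
    obtain ⟨ε, hε, u, hu, h⟩ := exists_ball_dominated τ₂ τ₄ hk hk' hz
    have hc : Continuous fun w : ℂ => z + w • fun s => (d s : ℂ) := by fun_prop
    have hU := Metric.isOpen_ball (x := z) (ε := ε) |>.preimage hc
    refine DifferentiableOn.differentiableAt (s := (fun w : ℂ => z + w • fun s => (d s : ℂ)) ⁻¹'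
      Metric.ball z ε) ?_ (hU.mem_nhds (by simpa using hε))
    refine Complex.differentiableOn_tsum_of_summable_norm hu (fun q => ?_) hU
      fun q w hw => (h _ hw).2 q
    refine DifferentiableOn.zpow
      (differentiable_autFactor_line τ₂ τ₄ _ z fun s => (d s : ℂ)).differentiableOn
      (Or.inl fun w hw => ?_)
    obtain ⟨δ, hδ, h'⟩ := exists_imGE ((mem_tube_heights _ _).1 (h _ hw).1)
    exact autFactor_ne_zero hδ h' _
  per := by
    intro z _ n
    have h1 : (fromBlocks (symMat n) 0 0 0 : Matrix (ι ⊕ κ) (ι ⊕ κ) ℤ).IsSymm := by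
      rw [IsSymm, fromBlocks_transpose, (symMat_isSymm n).eq]
      simp
    rw [jacobiFun, jacobiFun, ← eisenstein_add_intCast hk (blockPoint τ₂ τ₄ (symMat z)) h1]
    congr 1
    rw [blockPoint, blockPoint, fromBlocks_map, fromBlocks_add]
    simp
    rfl

end

/-! ### Half-integral matrices as frequencies -/

theorem sum_sum_sym2 {R : Type*} [Field R] [CharZero R] (F : Sym2 ι → R) :
    ∑ i, ∑ j, (if i = j then 1 else 2⁻¹) * F s(i, j) = ∑ p, F p := by
  rw [← Fintype.sum_prod_type' (f := fun i j => (if i = j then 1 else 2⁻¹) * F s(i, j)),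
    ← Finset.sum_fiberwise Finset.univ (fun x : ι × ι => s(x.1, x.2))]
  refine Finset.sum_congr rfl fun p _ => ?_
  induction p with
  | _ a b =>
  have h1 : (Finset.univ.filter fun x : ι × ι => s(x.1, x.2) = s(a, b)) = {(a, b), (b, a)} := by
    ext ⟨c, d⟩
    simp
  rw [h1]
  rcases eq_or_ne a b with rfl | hab
  · simp
  · rw [Finset.sum_pair (by simp [hab])]
    simp only [hab, hab.symm, if_false, Sym2.eq_swap (a := b)]
    ring

/-- The half-integral matrix with given integral coefficients of the quadratic form. -/
def halfMat (n : Sym2 ι → ℤ) : Matrix ι ι ℝ :=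
  Matrix.of fun i j => (if i = j then 1 else 2⁻¹) * (n s(i, j) : ℝ)

theorem halfMat_apply (n : Sym2 ι → ℤ) (i j : ι) :
    halfMat n i j = (if i = j then 1 else 2⁻¹) * (n s(i, j) : ℝ) := rfl

theorem isHalfIntegral_halfMat (n : Sym2 ι → ℤ) : IsHalfIntegral (halfMat n) := by
  refine ⟨?_, fun i => ⟨n s(i, i), by simp [halfMat]⟩, fun i j => ?_⟩
  · ext i j
    simp [halfMat, Sym2.eq_swap, eq_comm]
  · rcases eq_or_ne i j with rfl | h
    · exact ⟨2 * n s(i, i), by simp [halfMat]⟩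
    · exact ⟨n s(i, j), by simp [halfMat, h]⟩

theorem halfMat_injective : Function.Injective (halfMat (ι := ι)) := by
  intro n n' h
  ext p
  induction p with
  | _ i j =>
  have h1 := congrFun (congrFun h i) j
  rw [halfMat_apply, halfMat_apply] at h1
  have h2 : (if i = j then (1 : ℝ) else 2⁻¹) ≠ 0 := by split_ifs <;> norm_num
  exact_mod_cast mul_left_cancel₀ h2 h1

theorem IsHalfIntegral.exists_halfMat {T : Matrix ι ι ℝ} (hT : IsHalfIntegral T) :
    ∃ n, halfMat n = T := by
  have h : ∀ i j, ∃ n : ℤ, (if i = j then T i j else 2 * T i j) = n := by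
    intro i j
    split_ifs with h
    · subst h
      exact hT.2.1 i
    · exact hT.2.2 i j
  choose N hN using h
  have hs : IsSymm (Matrix.of N) := by
    ext i j
    have h1 := hN i j
    have h2 := hN j i
    simp only [hT.1.apply i j, eq_comm (a := j)] at h2
    exact_mod_cast h2.symm.trans h1
  refine ⟨symVec (Matrix.of N), ?_⟩
  ext i j
  have h1 : symVec (Matrix.of N) s(i, j) = N i j := congrFun (congrFun (symMat_symVec hs) i) j
  rw [halfMat_apply, h1, ← hN]
  split_ifs <;> ring

/-- Half-integral matrices correspond to integral quadratic forms. -/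
def halfEquiv (ι : Type*) [Fintype ι] [DecidableEq ι] :
    (Sym2 ι → ℤ) ≃ {T : Matrix ι ι ℝ // IsHalfIntegral T} :=
  Equiv.ofBijective (fun n => ⟨halfMat n, isHalfIntegral_halfMat n⟩)
    ⟨fun _ _ h => halfMat_injective (congrArg Subtype.val h), fun T => by
      obtain ⟨n, hn⟩ := T.2.exists_halfMat
      exact ⟨n, Subtype.ext hn⟩⟩

theorem halfEquiv_coe (n : Sym2 ι → ℤ) : (halfEquiv ι n : Matrix ι ι ℝ) = halfMat n := rfl

/-- An off-diagonal entry occurs twice in the trace, and the factor 1/2 compensates. Half-integral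
matrices are therefore exactly the characters of integral symmetric translations. -/
theorem trace_halfMat_mul (n : Sym2 ι → ℤ) (z : Sym2 ι → ℂ) :
    ((halfMat n).map Complex.ofReal * symMat z).trace = pairing n z := by
  rw [pairing, ← sum_sum_sym2, Matrix.trace]
  refine Finset.sum_congr rfl fun i _ => ?_
  rw [diag_apply, Matrix.mul_apply]
  refine Finset.sum_congr rfl fun j _ => ?_
  rw [map_apply, halfMat_apply, symMat_apply, Sym2.eq_swap (a := j)]
  split_ifs <;> simp [mul_assoc]

theorem dotProduct_halfMat (n : Sym2 ι → ℤ) (v : ι → ℝ) (d : Sym2 ι → ℝ)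
    (hd : ∀ i j, d s(i, j) = v i * v j) : v ⬝ᵥ halfMat n *ᵥ v = ∑ p, (n p : ℝ) * d p := by
  rw [← sum_sum_sym2]
  simp only [dotProduct, mulVec, Finset.mul_sum, halfMat_apply, hd]
  exact Finset.sum_congr rfl fun i _ => Finset.sum_congr rfl fun j _ => by ring

/-! ### The Fourier–Jacobi expansion -/

section

variable {κ : Type*} [Fintype κ] [DecidableEq κ] {τ₂ : Matrix ι κ ℂ} {τ₄ : Matrix κ κ ℂ}

/-- The Fourier–Jacobi coefficients, for arbitrary index types. -/
def jacobiCoeff (k : ℕ) (τ₄ : Matrix κ κ ℂ) (τ₂ : Matrix ι κ ℂ) (T : Matrix ι ι ℝ) : ℂ :=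
  ∫ x in Set.Icc (0 : Sym2 ι → ℝ) 1,
    eisenstein k (fromBlocks (symmPoint x (baseHeight τ₄ τ₂)) τ₂ τ₂ᵀ τ₄) *
      e (-(T.map Complex.ofReal * symmPoint x (baseHeight τ₄ τ₂)).trace)

theorem baseHeight_isSymm (hτ₄ : τ₄.IsSymm) : (baseHeight τ₄ τ₂).IsSymm := by
  have h : (τ₄.map Complex.im)ᵀ = τ₄.map Complex.im := by rw [← transpose_map, hτ₄.eq]
  rw [baseHeight, IsSymm, transpose_add, transpose_mul, transpose_mul, transpose_transpose,
    transpose_one, transpose_nonsing_inv, h, Matrix.mul_assoc]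

theorem jacobiCoeff_halfMat (k : ℕ) (hτ₄ : τ₄.IsSymm) (n : Sym2 ι → ℤ) :
    jacobiCoeff k τ₄ τ₂ (halfMat n) =
      tubeCoeff (jacobiFun τ₂ τ₄ k) n (symVec (baseHeight τ₄ τ₂)) := by
  have h : ∀ x, symmPoint x (baseHeight τ₄ τ₂) = symMat (cpt x (symVec (baseHeight τ₄ τ₂))) := by
    intro x
    ext i j
    conv_lhs => rw [← symMat_symVec (baseHeight_isSymm hτ₄ (τ₂ := τ₂))]
    rfl
  simp only [jacobiCoeff, h, trace_halfMat_mul]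
  rfl

/-- The Schur complement of Im τ₄ in the block matrix is the identity. -/
theorem baseHeight_mem (hτ₄ : τ₄ ∈ siegelUpperHalfSpace κ) :
    symVec (baseHeight τ₄ τ₂) ∈ heights τ₂ τ₄ := by
  refine ⟨hτ₄.1, ?_⟩
  rw [symMat_symVec (baseHeight_isSymm hτ₄.1)]
  have hD := hτ₄.2
  have hDs := hD.isHermitian
  let := hD.isUnit.invertible
  set B : Matrix ι κ ℝ := τ₂.map Complex.im with hB
  set D : Matrix κ κ ℝ := τ₄.map Complex.im with hDd
  have hBt : Bᵀ = Bᴴ := by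
    ext i j
    simp
  rw [posDef_iff_dotProduct_mulVec]
  refine ⟨?_, fun x hx => ?_⟩
  · have h1 := (baseHeight_isSymm hτ₄.1 (τ₂ := τ₂)).eq
    have h2 : Dᵀ = D := by
      rw [hDd, ← transpose_map, hτ₄.1.eq]
    rw [IsHermitian, conjTranspose_eq_transpose_of_trivial, fromBlocks_transpose, h1, h2,
      transpose_transpose]
  · obtain ⟨u, v, rfl⟩ : ∃ u v, x = Sum.elim u v := ⟨_, _, (Sum.elim_comp_inl_inr x).symm⟩
    have h1 := schur_complement_eq₂₂ (baseHeight τ₄ τ₂) B u v hDs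
    have h2 : baseHeight τ₄ τ₂ - B * D⁻¹ * Bᴴ = 1 := by
      rw [baseHeight, ← hB, ← hDd, hBt, add_sub_cancel_right]
    rw [h2, vecMul_one, ← dotProduct_mulVec, ← dotProduct_mulVec] at h1
    rw [hBt, h1]
    by_cases hu : u = 0
    · subst hu
      have hv : v ≠ 0 := by
        rintro rfl
        exact hx (by ext (i | i) <;> rfl)
      simpa using hD.dotProduct_mulVec_pos hv
    · have h3 : 0 < star u ⬝ᵥ u := dotProduct_star_self_pos_iff.2 hu
      have h4 := hD.posSemidef.dotProduct_mulVec_nonneg ((D⁻¹ * Bᴴ) *ᵥ u + v)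
      linarith

theorem mem_of_blockPoint_mem {τ₁ : Matrix ι ι ℂ}
    (h : blockPoint τ₂ τ₄ τ₁ ∈ siegelUpperHalfSpace (ι ⊕ κ)) :
    τ₁.IsSymm ∧ τ₄ ∈ siegelUpperHalfSpace κ := by
  obtain ⟨h1, h2⟩ := (blockPoint_isSymm _ _).1 h.1
  refine ⟨h1, h2, ?_⟩
  exact h.2.submatrix Sum.inr_injective

/-- The Fourier–Jacobi expansion of the Eisenstein series. -/
theorem hasSum_jacobiCoeff {k : ℕ} (hk : Even k) (hk' : Fintype.card (ι ⊕ κ) + 1 < k)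
    {τ₁ : Matrix ι ι ℂ} (h : blockPoint τ₂ τ₄ τ₁ ∈ siegelUpperHalfSpace (ι ⊕ κ)) :
    HasSum (fun T : {T : Matrix ι ι ℝ // IsHalfIntegral T} =>
      jacobiCoeff k τ₄ τ₂ T.1 * e (T.1.map Complex.ofReal * τ₁).trace)
      (eisenstein k (blockPoint τ₂ τ₄ τ₁)) := by
  obtain ⟨h1, h2⟩ := mem_of_blockPoint_mem h
  rw [← (halfEquiv ι).hasSum_iff]
  rw [← symMat_symVec h1] at h ⊢
  refine ((isTubeFunction_jacobiFun τ₂ τ₄ hk hk').hasSum (baseHeight_mem h2)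
    ((mem_tube_heights _ _).2 h)).congr_fun fun n => ?_
  rw [Function.comp_apply, halfEquiv_coe, jacobiCoeff_halfMat k h2.1, trace_halfMat_mul]

/-- The Fourier–Jacobi expansion is unique. -/
theorem jacobiCoeff_eq_of_hasSum {k : ℕ} (hτ₄ : τ₄ ∈ siegelUpperHalfSpace κ)
    {a : {T : Matrix ι ι ℝ // IsHalfIntegral T} → ℂ}
    (h : ∀ τ₁, blockPoint τ₂ τ₄ τ₁ ∈ siegelUpperHalfSpace (ι ⊕ κ) →
      HasSum (fun T : {T : Matrix ι ι ℝ // IsHalfIntegral T} =>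
        a T * e (T.1.map Complex.ofReal * τ₁).trace) (eisenstein k (blockPoint τ₂ τ₄ τ₁)))
    (T : {T : Matrix ι ι ℝ // IsHalfIntegral T}) : jacobiCoeff k τ₄ τ₂ T.1 = a T := by
  obtain ⟨n, rfl⟩ := (halfEquiv ι).surjective T
  rw [halfEquiv_coe, jacobiCoeff_halfMat k hτ₄.1]
  refine IsTubeFunction.tubeCoeff_eq_of_hasSum (a := fun n => a (halfEquiv ι n)) (fun x => ?_) n
  have h1 := h _ ((mem_tube_heights τ₂ τ₄).1 (cpt_mem_tube x (baseHeight_mem hτ₄)))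
  rw [← (halfEquiv ι).hasSum_iff] at h1
  refine h1.congr_fun fun n => ?_
  rw [Function.comp_apply, halfEquiv_coe, trace_halfMat_mul]

/-- Choose v with vᵀTv < 0 and raise the height along t·vvᵀ. No summand of the Eisenstein series
grows, so the series stays bounded and `tubeCoeff_eq_zero` applies. -/
theorem jacobiCoeff_eq_zero {k : ℕ} (hk : Even k) (hk' : Fintype.card (ι ⊕ κ) + 1 < k)
    (hτ₄ : τ₄ ∈ siegelUpperHalfSpace κ) {T : Matrix ι ι ℝ} (hT : IsHalfIntegral T)
    (hT' : ¬ T.PosSemidef) : jacobiCoeff k τ₄ τ₂ T = 0 := by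
  obtain ⟨n, rfl⟩ := hT.exists_halfMat
  obtain ⟨v, hv⟩ : ∃ v : ι → ℝ, v ⬝ᵥ halfMat n *ᵥ v < 0 := by
    by_contra! h
    refine hT' (posSemidef_iff_dotProduct_mulVec.2 ⟨?_, fun x => by simpa using h x⟩)
    rw [IsHermitian, conjTranspose_eq_transpose_of_trivial, hT.1.eq]
  set d : Sym2 ι → ℝ := symVec (vecMulVec v v) with hd
  have hds : symMat d = vecMulVec v v := symMat_symVec (by
    ext i j
    simp [vecMulVec_apply, mul_comm])
  have hdv : ∀ i j, d s(i, j) = v i * v j := fun i j => congrFun (congrFun hds i) j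
  rw [dotProduct_halfMat n v d hdv] at hv
  rw [jacobiCoeff_halfMat k hτ₄.1]
  set y := symVec (baseHeight τ₄ τ₂) with hy
  have hy0 : y ∈ heights τ₂ τ₄ := baseHeight_mem hτ₄
  obtain ⟨δ, hδ, h0⟩ := exists_imGE ((mem_heights_iff _ _).1 hy0)
  have hx : ∀ x, ImGE δ (blockPoint τ₂ τ₄ (symMat (cpt x y))) := by
    intro x
    refine ⟨(blockPoint_isSymm _ _).2 ⟨symMat_isSymm _, hτ₄.1⟩, ?_⟩
    have h1 : (blockPoint τ₂ τ₄ (symMat (cpt x y))).map Complex.im =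
        (blockPoint τ₂ τ₄ (symMat (cpt 0 y))).map Complex.im := by
      rw [blockPoint_map_im, blockPoint_map_im]
      congr 1
    rw [h1]
    exact h0.2
  set v' : ι ⊕ κ → ℝ := Sum.elim v 0 with hv'
  have ht : ∀ (x) (t : ℝ), blockPoint τ₂ τ₄ (symMat (cpt x (y + t • d))) =
      blockPoint τ₂ τ₄ (symMat (cpt x y)) + (Complex.I * t) •
        vecMulVec (fun i => (v' i : ℂ)) (fun i => (v' i : ℂ)) := by
    intro x t
    ext (i | i) (j | j)
    · simp [blockPoint, symMat_apply, cpt, hdv, vecMulVec_apply, hv']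
      ring
    all_goals simp [blockPoint, vecMulVec_apply, hv']
  have hS := summable_norm_cosetTerm hk hk' ((mem_heights_iff _ _).1 hy0)
  -- The constant compares all real parts x in the unit cube with x = 0; the points differ by at
  -- most 1 in each entry, hence the radius 1.
  refine IsTubeFunction.tubeCoeff_eq_zero (d := d) (C := compConst (ι ⊕ κ) δ 1 ^ k *
    ∑' q, ‖cosetTerm k q (blockPoint τ₂ τ₄ (symMat (cpt 0 y)))‖) (fun t h => ?_)
    (fun t h x hxc => ?_) hv
  · refine (isTubeFunction_jacobiFun τ₂ τ₄ hk hk').tubeCoeff_eq_tubeCoeff ?_ hy0 n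
    rw [mem_heights_iff, ht]
    exact (h0.add_smul_vecMulVec h v').mem hδ
  · refine tsum_of_norm_bounded (hS.hasSum.mul_left _) fun q => ?_
    rw [ht]
    refine (norm_cosetTerm_add_smul_vecMulVec_le hδ (hx x) h v' k q).trans ?_
    refine norm_cosetTerm_le hδ hδ (hx x) h0 (fun i j => ?_) k q
    refine (norm_blockPoint_sub_le τ₂ τ₄ _ _ i j).trans ?_
    refine (pi_norm_le_iff_of_nonneg zero_le_one).2 fun s => ?_
    have h1 : (cpt 0 y - cpt x y) s = ((-x s : ℝ) : ℂ) := by simp [cpt]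
    rw [h1, Complex.norm_real, Real.norm_eq_abs, abs_neg, abs_le]
    exact ⟨by linarith [hxc.1 s, show (0 : Sym2 ι → ℝ) s = 0 from rfl], hxc.2 s⟩

end

/-! ### Unimodular changes of variables -/

theorem isHalfIntegral_iff {T : Matrix ι ι ℝ} : IsHalfIntegral T ↔
    T.IsSymm ∧ ∀ a : ι → ℤ, ∃ m : ℤ, (fun i => (a i : ℝ)) ⬝ᵥ T *ᵥ (fun i => (a i : ℝ)) = m := by
  constructor
  · intro h
    refine ⟨h.1, fun a => ?_⟩
    obtain ⟨n, rfl⟩ := h.exists_halfMat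
    have h1 : IsSymm (vecMulVec a a) := by
      ext i j
      simp [vecMulVec_apply, mul_comm]
    have h2 := symMat_symVec h1
    refine ⟨∑ p, n p * symVec (vecMulVec a a) p, ?_⟩
    rw [dotProduct_halfMat n _ (fun p => ((symVec (vecMulVec a a) p : ℤ) : ℝ)) fun i j => ?_]
    · push_cast
      rfl
    · have h3 := congrFun (congrFun h2 i) j
      rw [symMat_apply, vecMulVec_apply] at h3
      rw [h3]
      push_cast
      rfl
  · rintro ⟨h, h1⟩
    have h2 : ∀ i, ∃ m : ℤ, T i i = m := fun i => by
      obtain ⟨m, hm⟩ := h1 (Pi.single i 1)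
      have h3 : (fun j => ((Pi.single i 1 : ι → ℤ) j : ℝ)) = Pi.single i 1 := by
        ext j
        simp [Pi.single_apply]
      rw [h3] at hm
      exact ⟨m, by simpa using hm⟩
    refine ⟨h, h2, fun i j => ?_⟩
    obtain ⟨m, hm⟩ := h1 (Pi.single i 1 + Pi.single j 1)
    have h3 : (fun l => ((Pi.single i 1 + Pi.single j 1 : ι → ℤ) l : ℝ)) =
        Pi.single i 1 + Pi.single j 1 := by
      ext l
      simp [Pi.single_apply]
    rw [h3] at hm
    obtain ⟨m₁, h4⟩ := h2 i
    obtain ⟨m₂, h5⟩ := h2 j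
    refine ⟨m - m₁ - m₂, ?_⟩
    simp only [mulVec_add, add_dotProduct, dotProduct_add, single_one_dotProduct,
      mulVec_single_one, col_apply] at hm
    push_cast
    rw [← hm, ← h4, ← h5, h.apply i j]
    ring

/-- Half-integrality means that the quadratic form takes integral values on integral vectors, which
is visibly stable under integral substitutions. -/
theorem IsHalfIntegral.conj {κ : Type*} [Fintype κ] [DecidableEq κ] {S : Matrix ι ι ℝ}
    (hS : IsHalfIntegral S) (U : Matrix ι κ ℤ) :
    IsHalfIntegral ((U.map (Int.cast : ℤ → ℝ))ᵀ * S * U.map (Int.cast : ℤ → ℝ)) := by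
  rw [isHalfIntegral_iff] at hS ⊢
  refine ⟨?_, fun a => ?_⟩
  · rw [IsSymm, transpose_mul, transpose_mul, transpose_transpose, hS.1.eq, Matrix.mul_assoc]
  · obtain ⟨m, hm⟩ := hS.2 (U *ᵥ a)
    refine ⟨m, ?_⟩
    rw [← hm]
    have h1 : (fun i => ((U *ᵥ a) i : ℝ)) = U.map (Int.cast : ℤ → ℝ) *ᵥ fun i => (a i : ℝ) := by
      ext i
      simp [mulVec, dotProduct]
    rw [h1, ← mulVec_mulVec, ← mulVec_mulVec, dotProduct_mulVec, vecMul_transpose]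

theorem map_mul_map_inv (U : GL ι ℤ) : (U : Matrix ι ι ℤ).map (Int.cast : ℤ → ℝ) *
    ((U⁻¹ : GL ι ℤ) : Matrix ι ι ℤ).map (Int.cast : ℤ → ℝ) = 1 := by
  have h := Matrix.map_mul (L := (U : Matrix ι ι ℤ)) (M := ((U⁻¹ : GL ι ℤ) : Matrix ι ι ℤ))
    (f := Int.castRingHom ℝ)
  rw [Units.mul_inv, Matrix.map_one _ (map_zero _) (map_one _)] at h
  exact h.symm

/-- The action of `GL(ℤ)` on half-integral matrices. -/
def conjEquiv (U : GL ι ℤ) : {T : Matrix ι ι ℝ // IsHalfIntegral T} ≃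
    {T : Matrix ι ι ℝ // IsHalfIntegral T} where
  toFun S := ⟨_, S.2.conj (U : Matrix ι ι ℤ)⟩
  invFun S := ⟨_, S.2.conj ((U⁻¹ : GL ι ℤ) : Matrix ι ι ℤ)⟩
  left_inv S := by
    refine Subtype.ext ?_
    change _ᵀ * (_ᵀ * _ * _) * _ = _
    rw [Matrix.mul_assoc, Matrix.mul_assoc, map_mul_map_inv, Matrix.mul_one, ← Matrix.mul_assoc,
      ← transpose_mul, map_mul_map_inv, transpose_one, Matrix.one_mul]
  right_inv S := by
    have h := map_mul_map_inv U⁻¹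
    rw [inv_inv] at h
    refine Subtype.ext ?_
    change _ᵀ * (_ᵀ * _ * _) * _ = _
    rw [Matrix.mul_assoc, Matrix.mul_assoc, h, Matrix.mul_one, ← Matrix.mul_assoc, ← transpose_mul,
      h, transpose_one, Matrix.one_mul]

theorem conj_mem_siegelUpperHalfSpace {τ : Matrix ι ι ℂ} (hτ : τ ∈ siegelUpperHalfSpace ι)
    {U : Matrix ι ι ℤ} (hU : IsUnit U.det) :
    U.map Int.cast * τ * (U.map Int.cast)ᵀ ∈ siegelUpperHalfSpace ι := by
  refine ⟨?_, ?_⟩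
  · rw [IsSymm, transpose_mul, transpose_mul, transpose_transpose, hτ.1.eq, Matrix.mul_assoc]
  · have h1 : (U.map (Int.cast : ℤ → ℂ) * τ * (U.map (Int.cast : ℤ → ℂ))ᵀ).map Complex.im =
        U.map (Int.cast : ℤ → ℝ) * τ.map Complex.im * star (U.map (Int.cast : ℤ → ℝ)) := by
      ext i j
      simp [Matrix.mul_apply, Finset.sum_mul, star_apply]
    have h2 : IsUnit (U.map (Int.cast : ℤ → ℝ)) := by
      rw [isUnit_iff_isUnit_det]
      have h3 : (U.map (Int.cast : ℤ → ℝ)).det = ((U.det : ℤ) : ℝ) :=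
        ((Int.castRingHom ℝ).map_det _).symm
      rw [h3]
      exact hU.map (Int.castRingHom ℝ)
    rw [h1]
    exact h2.posDef_star_right_conjugate_iff.2 hτ.2

section

variable {κ : Type*} [Fintype κ] [DecidableEq κ] {τ₄ : Matrix κ κ ℂ}

/-- Fourier–Jacobi coefficients at equivalent matrices agree. -/
theorem jacobiCoeff_conj {k : ℕ} (hk : Even k) (hk' : Fintype.card (ι ⊕ κ) + 1 < k)
    (hτ₄ : τ₄ ∈ siegelUpperHalfSpace κ) (U : GL ι ℤ)
    (S : {T : Matrix ι ι ℝ // IsHalfIntegral T}) :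
    jacobiCoeff k τ₄ 0 (conjEquiv U S).1 = jacobiCoeff k τ₄ 0 S.1 := by
  -- Expanding at diag(U, 1)·τ·diag(U, 1)ᵀ, where the value of the series is the same, gives a
  -- second expansion with the frequencies permuted by U. At τ₂ = 0 the substitution stays within
  -- the same family of points.
  rw [jacobiCoeff_eq_of_hasSum (τ₂ := 0) hτ₄
    (a := fun T => jacobiCoeff k τ₄ 0 ((conjEquiv U).symm T).1) ?_ (conjEquiv U S),
    Equiv.symm_apply_apply]
  intro τ₁ h
  set V : Matrix ι ι ℂ := (U : Matrix ι ι ℤ).map Int.cast with hV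
  have hdet : IsUnit (fromBlocks (U : Matrix ι ι ℤ) 0 0 (1 : Matrix κ κ ℤ)).det := by
    rw [det_fromBlocks_zero₂₁, det_one, mul_one]
    exact (isUnit_iff_isUnit_det _).1 U.isUnit
  have h1 : blockPoint 0 τ₄ (V * τ₁ * Vᵀ) =
      (fromBlocks (U : Matrix ι ι ℤ) 0 0 (1 : Matrix κ κ ℤ)).map Int.cast * blockPoint 0 τ₄ τ₁ *
        ((fromBlocks (U : Matrix ι ι ℤ) 0 0 (1 : Matrix κ κ ℤ)).map Int.cast)ᵀ := by
    rw [blockPoint, blockPoint, fromBlocks_map, fromBlocks_transpose, fromBlocks_multiply,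
      fromBlocks_multiply]
    simp [hV]
  have h2 := hasSum_jacobiCoeff hk hk' (h1 ▸ conj_mem_siegelUpperHalfSpace h hdet)
  rw [h1, eisenstein_conj hk _ hdet] at h2
  rw [← (conjEquiv U).hasSum_iff]
  refine h2.congr_fun fun T => ?_
  simp only [Function.comp_apply, Equiv.symm_apply_apply]
  congr 2
  have h3 : (conjEquiv U T).1.map Complex.ofReal = Vᵀ * T.1.map Complex.ofReal * V := by
    ext i j
    simp [conjEquiv, hV, Matrix.mul_apply, Finset.sum_mul]
  rw [h3, Matrix.mul_assoc, Matrix.mul_assoc, Matrix.trace_mul_comm]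
  simp only [Matrix.mul_assoc]

end

/-! ### Coefficients at degenerate matrices -/

section

variable {κ μ : Type*} [Fintype κ] [DecidableEq κ] [Fintype μ] [DecidableEq μ]
  {τ₄ : Matrix κ κ ℂ} (f : Unit ⊕ μ ≃ ι)

/-- The matrix `diag (0, T)`, with indices renamed. -/
def extendZero (T : Matrix μ μ ℝ) : Matrix ι ι ℝ :=
  (fromBlocks (0 : Matrix Unit Unit ℝ) 0 0 T).submatrix f.symm f.symm

theorem extendZero_injective : Function.Injective (extendZero f) := by
  intro T T' h
  ext i j
  simpa [extendZero] using congrFun (congrFun h (f (Sum.inr i))) (f (Sum.inr j))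

theorem IsHalfIntegral.extendZero {T : Matrix μ μ ℝ} (hT : IsHalfIntegral T) :
    IsHalfIntegral (extendZero f T) := by
  refine ⟨?_, fun i => ?_, fun i j => ?_⟩
  · rw [IsSymm, SiegelEisenstein.extendZero, transpose_submatrix, fromBlocks_transpose, hT.1.eq]
    simp
  · rcases hi : f.symm i with a | a
    · exact ⟨0, by simp [SiegelEisenstein.extendZero, hi]⟩
    · simpa [SiegelEisenstein.extendZero, hi] using hT.2.1 a
  · rcases hi : f.symm i with a | a <;> rcases hj : f.symm j with b | b
    · exact ⟨0, by simp [SiegelEisenstein.extendZero, hi, hj]⟩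
    · exact ⟨0, by simp [SiegelEisenstein.extendZero, hi, hj]⟩
    · exact ⟨0, by simp [SiegelEisenstein.extendZero, hi, hj]⟩
    · simpa [SiegelEisenstein.extendZero, hi, hj] using hT.2.2 a b

/-- A positive semidefinite half-integral matrix whose first diagonal entry vanishes is of the form
`diag (0, T)`. -/
theorem exists_extendZero {T : Matrix ι ι ℝ} (hT : IsHalfIntegral T) (hT' : T.PosSemidef)
    (h0 : T (f (Sum.inl ())) (f (Sum.inl ())) = 0) :
    ∃ S : Matrix μ μ ℝ, IsHalfIntegral S ∧ extendZero f S = T := by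
  set p := f (Sum.inl ()) with hp
  -- A semidefinite matrix annihilates every vector on which its form vanishes.
  have h1 : ∀ j, T j p = 0 := by
    have h2 : star (Pi.single p 1 : ι → ℝ) ⬝ᵥ T *ᵥ Pi.single p 1 = 0 := by
      simpa [← Pi.single_star] using h0
    have h3 := (hT'.dotProduct_mulVec_zero_iff _).1 h2
    intro j
    simpa using congrFun h3 j
  have h1' : ∀ j, T p j = 0 := fun j => by rw [hT.1.apply j p]; exact h1 j
  refine ⟨T.submatrix (fun i => f (Sum.inr i)) (fun i => f (Sum.inr i)), ⟨?_, fun i => ?_,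
    fun i j => ?_⟩, ?_⟩
  · rw [IsSymm, transpose_submatrix, hT.1.eq]
  · exact hT.2.1 _
  · exact hT.2.2 _ _
  · ext i j
    obtain ⟨i, rfl⟩ := f.surjective i
    obtain ⟨j, rfl⟩ := f.surjective j
    have h3 : f.symm p = Sum.inl () := f.symm_apply_apply _
    rcases i with i | i <;> rcases j with j | j
    · simp [extendZero, ← hp, h0, h3]
    · simp [extendZero, ← hp, h1', h3]
    · simp [extendZero, ← hp, h1, h3]
    · simp [extendZero]

/-- The point `diag (it, τ₁)`, with indices renamed. -/
def extendPoint (t : ℝ) (τ₁ : Matrix μ μ ℂ) : Matrix ι ι ℂ :=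
  (cuspPoint t τ₁).submatrix f.symm f.symm

theorem trace_mul_extendPoint (T : Matrix ι ι ℝ) (t : ℝ) (τ₁ : Matrix μ μ ℂ) :
    (T.map Complex.ofReal * extendPoint f t τ₁).trace =
      Complex.I * (t * T (f (Sum.inl ())) (f (Sum.inl ())) : ℝ) +
      ((T.submatrix (fun i => f (Sum.inr i)) (fun i => f (Sum.inr i))).map Complex.ofReal *
        τ₁).trace := by
  simp only [Matrix.trace, diag_apply, Matrix.mul_apply, ← f.sum_comp, Fintype.sum_sum_type]
  simp [extendPoint, cuspPoint]
  ring

theorem blockPoint_extendPoint (t : ℝ) (τ₁ : Matrix μ μ ℂ) :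
    blockPoint 0 τ₄ (extendPoint f t τ₁) = (cuspPoint t (blockPoint 0 τ₄ τ₁)).submatrix
      (((Equiv.sumCongr f (Equiv.refl κ)).symm.trans (Equiv.sumAssoc Unit μ κ)))
      (((Equiv.sumCongr f (Equiv.refl κ)).symm.trans (Equiv.sumAssoc Unit μ κ))) := by
  ext i j
  obtain ⟨i, rfl⟩ := (Equiv.sumCongr f (Equiv.refl κ)).surjective i
  obtain ⟨j, rfl⟩ := (Equiv.sumCongr f (Equiv.refl κ)).surjective j
  rcases i with (i | i) | i <;> rcases j with (j | j) | j <;>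
    simp [blockPoint, extendPoint, cuspPoint]

theorem siegelUpperHalfSpace_submatrix {ν : Type*} [Fintype ν] [DecidableEq ν] (g : ν ≃ ι)
    {τ : Matrix ι ι ℂ} (h : τ ∈ siegelUpperHalfSpace ι) :
    τ.submatrix g g ∈ siegelUpperHalfSpace ν :=
  ⟨by rw [IsSymm, transpose_submatrix, h.1.eq], h.2.submatrix g.injective⟩

theorem cuspPoint_mem {t : ℝ} (ht : 0 < t) {τ : Matrix κ κ ℂ} (h : τ ∈ siegelUpperHalfSpace κ) :
    cuspPoint t τ ∈ siegelUpperHalfSpace (Unit ⊕ κ) := by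
  obtain ⟨δ, hδ, h1⟩ := exists_imGE h
  exact (imGE_cuspPoint (min_le_left t δ) (h1.mono (min_le_right t δ))).mem (lt_min ht hδ)

/-- Fourier–Jacobi coefficients at degenerate matrices come from lower genus. -/
theorem jacobiCoeff_extendZero {k : ℕ} (hk : Even k) (hk' : Fintype.card (ι ⊕ κ) + 1 < k)
    (hτ₄ : τ₄ ∈ siegelUpperHalfSpace κ) {T : Matrix μ μ ℝ} (hT : IsHalfIntegral T) :
    jacobiCoeff k τ₄ 0 (extendZero f T) = jacobiCoeff k τ₄ 0 T := by
  classical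
  have hcard : Fintype.card ι = Fintype.card μ + 1 := by
    rw [← Fintype.card_congr f, Fintype.card_sum, Fintype.card_unit, add_comm]
  -- By uniqueness in the smaller genus it suffices that the coefficients at diag(0, S) expand the
  -- Eisenstein series there.
  refine (jacobiCoeff_eq_of_hasSum (τ₂ := (0 : Matrix μ κ ℂ)) hτ₄
    (a := fun S => jacobiCoeff k τ₄ 0 (extendZero f S.1)) (fun τ₁ h => ?_) ⟨T, hT⟩).symm
  set p := f (Sum.inl ()) with hp
  have hmem : ∀ t : ℝ, 0 < t →
      blockPoint 0 τ₄ (extendPoint f t τ₁) ∈ siegelUpperHalfSpace (ι ⊕ κ) := fun t ht => by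
    rw [blockPoint_extendPoint]
    exact siegelUpperHalfSpace_submatrix _ (cuspPoint_mem ht h)
  have hE : ∀ t : ℝ, eisenstein k (blockPoint 0 τ₄ (extendPoint f t τ₁)) =
      eisenstein k (cuspPoint t (blockPoint 0 τ₄ τ₁)) := fun t => by
    rw [blockPoint_extendPoint, eisenstein_submatrix hk]
  have hlim : Filter.Tendsto (fun t : ℝ =>
      eisenstein k (blockPoint 0 τ₄ (extendPoint f t τ₁))) Filter.atTop
      (nhds (eisenstein k (blockPoint 0 τ₄ τ₁))) := by
    simp only [hE]
    refine tendsto_eisenstein_cuspPoint hk ?_ h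
    rw [Fintype.card_sum] at hk' ⊢
    omega
  set G : ℝ → {T : Matrix ι ι ℝ // IsHalfIntegral T} → ℂ := fun t S =>
    jacobiCoeff k τ₄ 0 S.1 * e (S.1.map Complex.ofReal * extendPoint f t τ₁).trace with hG
  have hsum : ∀ t : ℝ, 0 < t →
      HasSum (G t) (eisenstein k (blockPoint 0 τ₄ (extendPoint f t τ₁))) := fun t ht =>
    hasSum_jacobiCoeff hk hk' (hmem t ht)
  -- The whole dependence on t is the factor exp(-2π(t - 1) T_pp).
  have hGt : ∀ t S, G t S = G 1 S * e (Complex.I * ((t - 1) * S.1 p p : ℝ)) := fun t S => by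
    simp only [hG]
    rw [mul_assoc, ← e_add, trace_mul_extendPoint, trace_mul_extendPoint]
    congr 2
    push_cast
    ring
  have hnp : ∀ t S, ¬ S.1.PosSemidef → G t S = 0 := fun t S hS => by
    simp only [hG]
    rw [jacobiCoeff_eq_zero hk hk' hτ₄ S.2 hS, zero_mul]
  have hnorm : ∀ (x : ℝ), ‖e (Complex.I * (x : ℝ))‖ = Real.exp (-(2 * Real.pi * x)) := fun x => by
    rw [norm_e]
    simp
  -- Only semidefinite T contribute, and they have T_pp ≥ 0. So t = 1 dominates, and in the limit
  -- the terms with T_pp > 0 disappear.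
  have hdom : Filter.Tendsto (fun t => ∑' S, G t S) Filter.atTop
      (nhds (∑' S, if S.1 p p = 0 then G 1 S else 0)) := by
    refine tendsto_tsum_of_dominated_convergence (hsum 1 one_pos).summable.norm (fun S => ?_) ?_
    · by_cases hS : S.1.PosSemidef
      · by_cases h0 : S.1 p p = 0
        · rw [if_pos h0]
          refine (Filter.tendsto_congr fun t => ?_).2 tendsto_const_nhds
          rw [hGt, h0]
          simp [e_zero]
        · rw [if_neg h0]
          have hpos : 0 < S.1 p p := lt_of_le_of_ne hS.diag_nonneg (Ne.symm h0)
          rw [tendsto_zero_iff_norm_tendsto_zero]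
          have h1 : (fun t => ‖G t S‖) =
              fun t => ‖G 1 S‖ * Real.exp (-(2 * Real.pi * ((t - 1) * S.1 p p))) := by
            ext t
            rw [hGt, norm_mul, hnorm]
          rw [h1, ← mul_zero ‖G 1 S‖]
          refine Filter.Tendsto.const_mul _ (Real.tendsto_exp_atBot.comp ?_)
          refine Filter.tendsto_neg_atTop_atBot.comp ?_
          refine Filter.Tendsto.const_mul_atTop Real.two_pi_pos ?_
          refine Filter.Tendsto.atTop_mul_const hpos ?_
          exact Filter.tendsto_atTop_add_const_right _ _ Filter.tendsto_id
      · simp only [hnp _ S hS, ite_self]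
        exact tendsto_const_nhds
    · filter_upwards [Filter.eventually_ge_atTop 1] with t ht S
      by_cases hS : S.1.PosSemidef
      · rw [hGt, norm_mul, hnorm]
        refine mul_le_of_le_one_right (norm_nonneg _) (Real.exp_le_one_iff.2 ?_)
        have h1 : 0 ≤ S.1 p p := hS.diag_nonneg
        have h2 : 0 ≤ 2 * Real.pi * ((t - 1) * S.1 p p) :=
          mul_nonneg Real.two_pi_pos.le (mul_nonneg (sub_nonneg.2 ht) h1)
        linarith
      · rw [hnp t S hS, hnp 1 S hS]
  have heq : ∑' S, (if S.1 p p = 0 then G 1 S else 0) = eisenstein k (blockPoint 0 τ₄ τ₁) := by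
    refine tendsto_nhds_unique hdom (hlim.congr' ?_)
    filter_upwards [Filter.eventually_gt_atTop 0] with t ht
    exact (hsum t ht).tsum_eq.symm
  have hsummable : Summable fun S : {T : Matrix ι ι ℝ // IsHalfIntegral T} =>
      if S.1 p p = 0 then G 1 S else 0 := by
    refine Summable.of_norm_bounded (hsum 1 one_pos).summable.norm fun S => ?_
    split_ifs
    · exact le_rfl
    · simp
  have h1 := hsummable.hasSum
  rw [heq] at h1
  let g : {T : Matrix μ μ ℝ // IsHalfIntegral T} → {T : Matrix ι ι ℝ // IsHalfIntegral T} :=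
    fun S => ⟨_, S.2.extendZero f⟩
  have hg : Function.Injective g := fun S S' hS =>
    Subtype.ext (extendZero_injective f (congrArg Subtype.val hS))
  rw [← hg.hasSum_iff] at h1
  · refine h1.congr_fun fun S => ?_
    have h2 : extendZero f S.1 p p = 0 := by simp [extendZero, hp]
    have h3 : (extendZero f S.1).submatrix (fun i => f (Sum.inr i)) (fun i => f (Sum.inr i)) =
        S.1 := by
      ext i j
      simp [extendZero]
    simp only [Function.comp_apply, g, h2, if_true, hG]
    rw [trace_mul_extendPoint, ← hp, h2, h3]
    simp
  -- A surviving frequency outside the image of diag(0, ·) is not semidefinite, so its coefficient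
  -- is zero.
  · intro S hS
    by_cases h0 : S.1 p p = 0
    · rw [if_pos h0]
      refine hnp 1 S fun hps => hS ?_
      obtain ⟨S', hS', h2⟩ := exists_extendZero f S.2 hps h0
      exact ⟨⟨S', hS'⟩, Subtype.ext h2⟩
    · rw [if_neg h0]

end

/-! ### Specialization to matrices indexed by `Fin` -/

theorem zeroDiag_eq_extendZero {m : ℕ} (T : Matrix (Fin m) (Fin m) ℝ) : zeroDiag T =
    extendZero ((Equiv.sumCongr (Equiv.ofUnique Unit (Fin 1)) (Equiv.refl (Fin m))).trans
      finSumFinEquiv) T := by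
  ext i j
  obtain ⟨i, rfl⟩ := finSumFinEquiv.surjective i
  obtain ⟨j, rfl⟩ := finSumFinEquiv.surjective j
  rcases i with i | i <;> rcases j with j | j <;> simp [zeroDiag, extendZero]

theorem isHalfIntegral_zero : IsHalfIntegral (0 : Matrix ι ι ℝ) :=
  ⟨by simp [IsSymm], fun _ => ⟨0, by simp⟩, fun _ _ => ⟨0, by simp⟩⟩

theorem fourierJacobiCoeff_zeroDiag {k m s : ℕ} (hk : Even k) (hms : (1 + m) + s + 1 < k)
    {T : Matrix (Fin m) (Fin m) ℝ} (hT : IsHalfIntegral T) {τ₄ : Matrix (Fin s) (Fin s) ℂ}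
    (hτ₄ : τ₄ ∈ siegelUpperHalfSpace (Fin s)) :
    fourierJacobiCoeff k (1 + m) s τ₄ 0 (zeroDiag T) = fourierJacobiCoeff k m s τ₄ 0 T := by
  rw [zeroDiag_eq_extendZero]
  exact jacobiCoeff_extendZero _ hk (by simpa using hms) hτ₄ hT

theorem fourierJacobiCoeff_eq_of_equiv {k m s : ℕ} (hk : Even k) (hms : (1 + m) + s + 1 < k)
    {T : Matrix (Fin (1 + m)) (Fin (1 + m)) ℝ} {T' : Matrix (Fin m) (Fin m) ℝ}
    (hT' : IsHalfIntegral T') (h : UnimodularEquiv T (zeroDiag T'))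
    {τ₄ : Matrix (Fin s) (Fin s) ℂ} (hτ₄ : τ₄ ∈ siegelUpperHalfSpace (Fin s)) :
    fourierJacobiCoeff k (1 + m) s τ₄ 0 T = fourierJacobiCoeff k m s τ₄ 0 T' := by
  obtain ⟨U, rfl⟩ := h
  rw [← fourierJacobiCoeff_zeroDiag hk hms hT' hτ₄]
  have h1 : IsHalfIntegral (zeroDiag T') := by
    rw [zeroDiag_eq_extendZero]
    exact hT'.extendZero _
  exact jacobiCoeff_conj hk (by simpa using hms) hτ₄ U ⟨_, h1⟩

/-- For r = 0 there is a single frequency with trivial character, so the expansion is one term. -/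
theorem jacobiCoeff_of_isEmpty [IsEmpty ι] {κ : Type*} [Fintype κ] [DecidableEq κ] {k : ℕ}
    (hk : Even k) {τ₄ : Matrix κ κ ℂ} (hτ₄ : τ₄ ∈ siegelUpperHalfSpace κ) :
    jacobiCoeff k τ₄ 0 (0 : Matrix ι ι ℝ) = eisenstein k τ₄ := by
  refine jacobiCoeff_eq_of_hasSum hτ₄ (a := fun _ => eisenstein k τ₄) (fun τ₁ _ => ?_)
    ⟨0, isHalfIntegral_zero⟩
  have h1 : blockPoint 0 τ₄ τ₁ = τ₄.submatrix (Equiv.emptySum ι κ) (Equiv.emptySum ι κ) := by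
    ext (i | i) (j | j)
    · exact isEmptyElim i
    · exact isEmptyElim i
    · exact isEmptyElim j
    · rfl
  rw [h1, eisenstein_submatrix hk]
  have h2 : ∀ T : Matrix ι ι ℝ, (T.map Complex.ofReal * τ₁).trace = 0 := fun T => by
    simp [Matrix.trace]
  let _ : Unique {T : Matrix ι ι ℝ // IsHalfIntegral T} :=
    ⟨⟨⟨0, isHalfIntegral_zero⟩⟩, fun T => Subtype.ext (Subsingleton.elim _ _)⟩
  have h3 := hasSum_unique fun T : {T : Matrix ι ι ℝ // IsHalfIntegral T} =>
    eisenstein k τ₄ * e (T.1.map Complex.ofReal * τ₁).trace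
  rwa [h2, e_zero, mul_one] at h3

/-- The zero matrix is diag(0, 0), so the degenerate case removes one variable at a time until r =
0. -/
theorem fourierJacobiCoeff_zero {k r s : ℕ} (hk : Even k) (hrs : r + s + 1 < k)
    {τ₄ : Matrix (Fin s) (Fin s) ℂ} (hτ₄ : τ₄ ∈ siegelUpperHalfSpace (Fin s)) :
    fourierJacobiCoeff k r s τ₄ 0 0 = eisenstein k τ₄ := by
  induction r with
  | zero => exact jacobiCoeff_of_isEmpty hk hτ₄
  | succ m ih =>
    have h1 := fourierJacobiCoeff_zeroDiag hk (m := m) (by omega) isHalfIntegral_zero hτ₄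
    have h2 : zeroDiag (0 : Matrix (Fin m) (Fin m) ℝ) = 0 := by simp [zeroDiag]
    rw [h2, ih (by omega), Nat.add_comm 1 m] at h1
    exact h1

end SiegelEisenstein

end

open SiegelEisenstein
theorem mainTheorem4 (k : ℕ) (hk : Even k) :
    -- For `g = r + s` and `k > g + 1`: the Eisenstein series of genus `g` converges absolutely, and
    -- the `φ_{g,r}` are the coefficients of its Fourier–Jacobi expansion.
    (∀ r s : ℕ, r + s + 1 < k →
      ∀ (τ₁ : Matrix (Fin r) (Fin r) ℂ) (τ₂ : Matrix (Fin r) (Fin s) ℂ)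
        (τ₄ : Matrix (Fin s) (Fin s) ℂ),
        Matrix.fromBlocks τ₁ τ₂ τ₂.transpose τ₄ ∈ siegelUpperHalfSpace (Fin r ⊕ Fin s) →
        Summable (fun q : Quotient (QuotientGroup.rightRel (siegelParabolic (Fin r ⊕ Fin s))) =>
          autFactor q.out (Matrix.fromBlocks τ₁ τ₂ τ₂.transpose τ₄) ^ (-(k : ℤ))) ∧
        HasSum (fun T : {T : Matrix (Fin r) (Fin r) ℝ // IsHalfIntegral T ∧ T.PosSemidef} =>
            fourierJacobiCoeff k r s τ₄ τ₂ T.1 * e ((T.1.map Complex.ofReal * τ₁).trace))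
          (eisenstein k (Matrix.fromBlocks τ₁ τ₂ τ₂.transpose τ₄))) ∧
    -- `φ_{g,r}(τ₄, 0, T_r) = φ_{g-1,r-1}(τ₄, 0, T_{r-1})`, with `r = 1 + m` and `g = r + s`.
    (∀ m s : ℕ, (1 + m) + s + 1 < k →
      ∀ (T : Matrix (Fin (1 + m)) (Fin (1 + m)) ℝ) (T' : Matrix (Fin m) (Fin m) ℝ),
        IsHalfIntegral T → T.PosSemidef → IsHalfIntegral T' → UnimodularEquiv T (zeroDiag T') →
        ∀ τ₄ ∈ siegelUpperHalfSpace (Fin s),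
          fourierJacobiCoeff k (1 + m) s τ₄ 0 T = fourierJacobiCoeff k m s τ₄ 0 T') ∧
    -- `φ_{g,r}(τ₄, 0, 0) = E^k_{g-r}(τ₄)`, with `g = r + s`.
    (∀ r s : ℕ, r + s + 1 < k →
      ∀ τ₄ ∈ siegelUpperHalfSpace (Fin s),
        fourierJacobiCoeff k r s τ₄ 0 0 = eisenstein k τ₄) := by
  refine ⟨fun r s hrs τ₁ τ₂ τ₄ hτ => ?_, fun m s hms T T' hT _ hT' hTT' τ₄ hτ₄ => ?_,
    fun r s hrs τ₄ hτ₄ => ?_⟩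
  · have hcard : Fintype.card (Fin r ⊕ Fin s) + 1 < k := by simpa using hrs
    refine ⟨(summable_norm_cosetTerm hk hcard hτ).of_norm, ?_⟩
    have hτ₄ := (mem_of_blockPoint_mem hτ).2
    have h := hasSum_jacobiCoeff hk hcard hτ
    let g : {T : Matrix (Fin r) (Fin r) ℝ // IsHalfIntegral T ∧ T.PosSemidef} →
        {T : Matrix (Fin r) (Fin r) ℝ // IsHalfIntegral T} := fun T => ⟨T.1, T.2.1⟩
    have hg : Function.Injective g := fun T T' hT =>
      Subtype.ext (Subtype.mk.inj hT)
    -- The expansion over all half-integral T restricts to the semidefinite ones because the other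
    -- coefficients vanish.
    refine (hg.hasSum_iff fun T hT => ?_).2 h
    rw [jacobiCoeff_eq_zero hk hcard hτ₄ T.2 fun hp => hT ⟨⟨T.1, T.2, hp⟩, rfl⟩, zero_mul]
  · exact fourierJacobiCoeff_eq_of_equiv hk hms hT' hTT' hτ₄
  · exact fourierJacobiCoeff_zero hk hrs hτ₄
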